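/- Let $\Gamma$ be a finite abelian group and $R=\mathbb Z[\Gamma]$. **The monoid $\mathcal C/{\sim}$.** Let $\mathcal C$ be the category of finitely generated torsion $R$-modules (equivalently, finite $R$-modules) and $\mathcal P\subset\mathcal C$ the subcategory of modules of projective dimension at most $1$ over $R$. A sandwich is a module $M$ in $\mathcal C$ with submodules $0\subset M'\subset M''\subset M$ such that $M'$ and $M/M''$ are in $\mathcal P$; its filling is $M''/M'$. Two modules $X,Y$ in $\mathcal C$ are equivalent, $X\sim Y$, if they are the fillings of two sandwiches whose underlying modules $M$, $N$ are isomorphic as $R$-modules. The set $\mathcal C/{\sim}$ of equivalence classes $[X]$ is a commutative monoid under direct sums. For $X$ in $\mathcal C$, let $[\omega^1(X)]$ be the class of $Y$ for any short exact sequence $0\to Y\to P\to X\to 0$ with $P$ in $\mathcal P$. **The monoid $\mathcal Z^{\mathrm{adm}}$.** A finite group is elementary if, for some prime $p$, it is the product of a $p$-group and a cyclic group. For a subgroup $I\subset\Gamma$ and $\varphi\in\Gamma/I$ put $A_{I,\varphi}=\mathbb Z[\Gamma/I]/(1-\varphi^{-1}+\#I)$. Let $\mathcal Z^{\mathrm{adm}}\subset\mathcal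 C/{\sim}$ be the submonoid generated by the classes $[\omega^1(A_{I,\varphi})]$, where $I$ runs over the non-trivial elementary subgroups of $\Gamma$ and $\varphi$ over $\Gamma/I$. **The homomorphism $\beta$.** Let $\mathcal S$ be the set of pairs $(I,D)$ of subgroups $I\subset D\subset\Gamma$ such that $I$ is non-trivial and elementary and $D/I$ is cyclic. For a prime $p$ let $\Gamma_p$ be the maximal $p$-quotient of $\Gamma$, and for a subgroup $I\subset\Gamma$ let $I_p$ be its maximal $p$-quotient, viewed as a subgroup of $\Gamma_p$ (the image of $I$ in $\Gamma_p$). Let $\mathcal T$ be the finite set of tuples $(p,H,I_p^*,D_p^*)$ where $p$ is a prime number, $H\subset\Gamma$ is a subgroup such that $\Gamma/H$ is cyclic of order prime to $p$, and $I_p^*\subset D_p^*\subset\Gamma_p$ are subgroups such that $I_p^*$ is non-trivial and $D_p^*/I_p^*$ is cyclic. Let $\beta:\mathbb N^{\mathcal S}\to\mathbb N^{\mathcal T}$ be the monoid homomorphism between free commutative monoids given by $$\beta((I,D))=\sum_{\substack{(p,H,I_p^*,D_p^*)\in\mathcal T\\ D\subset H,\ I_p=I_p^*,\ D_p=D_p^*}}(p,H,I_p^*,D_p^*).$$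 **Theorem.** The monoid $\mathcal Z^{\mathrm{adm}}$ is isomorphic to the image of $\beta$. Moreover, if $\Gamma$ is a $p$-group for some prime number $p$, then $\mathcal Z^{\mathrm{adm}}$ is a free commutative monoid of rank $\#\mathcal S=\#\mathcal T$. -/

import Mathlib

open scoped nonZeroDivisors

universe u

noncomputable section

namespace GroupRingClasses

section Category

variable (R : Type u) [CommRing R]

/-- The objects of the category `𝒞`: finitely generated torsion `R`-modules. -/
structure TorsionModule where
  carrier : Type u
  [addCommGroup : AddCommGroup carrier]
  [module : Module R carrier]
  finite : Module.Finite R carrier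
  torsion : Module.IsTorsion R carrier

attribute [instance] TorsionModule.addCommGroup TorsionModule.module

instance : CoeSort (TorsionModule R) (Type u) := ⟨TorsionModule.carrier⟩

/-- `M` belongs to the subcategory `𝒫` of `𝒞`: it is finitely generated, torsion and of projective
dimension at most one over `R`. -/
def MemP (M : Type u) [AddCommGroup M] [Module R M] : Prop :=
  Module.Finite R M ∧ Module.IsTorsion R M ∧
    CategoryTheory.HasProjectiveDimensionLE (ModuleCat.of R M) 1

variable {R}

/-- `X` is (isomorphic to) the filling `M'' / M'` of a sandwich `0 ⊆ M' ⊆ M'' ⊆ M`, i.e. a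
filtration for which `M'` and `M / M''` belong to `𝒫`. -/
def IsFilling (X M : TorsionModule R) : Prop :=
  ∃ M' M'' : Submodule R M, M' ≤ M'' ∧ MemP R M' ∧ MemP R (M ⧸ M'') ∧
    Nonempty (X ≃ₗ[R] (M'' ⧸ M'.submoduleOf M''))

/-- `X ∼ Y`: they are the fillings of two sandwiches `M` and `N` that are isomorphic as
`R`-modules (not necessarily as filtered modules). -/
def Equivalent (X Y : TorsionModule R) : Prop :=
  ∃ M N : TorsionModule R, IsFilling X M ∧ IsFilling Y N ∧ Nonempty (M ≃ₗ[R] N)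

/-- `Y` represents the shift `ω¹(X)`: there is a short exact sequence `0 → Y → P → X → 0` of
`R`-modules with `P` in `𝒫`. -/
def IsShift (X Y : TorsionModule R) : Prop :=
  ∃ P : TorsionModule R, MemP R P ∧ ∃ (i : Y →ₗ[R] P) (q : P →ₗ[R] X),
    Function.Injective i ∧ Function.Exact i q ∧ Function.Surjective q

theorem isTorsion_prod {M N : Type u} [AddCommGroup M] [Module R M] [AddCommGroup N] [Module R N]
    (hM : Module.IsTorsion R M) (hN : Module.IsTorsion R N) : Module.IsTorsion R (M × N) := by
  rintro ⟨x, y⟩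
  obtain ⟨a, ha⟩ := @hM x
  obtain ⟨b, hb⟩ := @hN y
  refine ⟨a * b, ?_⟩
  ext
  · change (a * b) • x = 0
    rw [mul_comm, mul_smul, ha, smul_zero]
  · change (a * b) • y = 0
    rw [mul_smul, hb, smul_zero]

/-- The direct sum of two objects of `𝒞`. -/
def TorsionModule.prod (X Y : TorsionModule R) : TorsionModule R where
  carrier := X × Y
  finite := by
    have := X.finite
    have := Y.finite
    infer_instance
  torsion := isTorsion_prod X.torsion Y.torsion

/-- The zero object of `𝒞`. -/
def TorsionModule.zero : TorsionModule R where
  carrier := PUnit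
  finite := inferInstance
  torsion := fun _ => ⟨1, rfl⟩

theorem MemP.of_equiv {M N : Type u} [AddCommGroup M] [Module R M] [AddCommGroup N] [Module R N]
    (h : MemP R M) (e : M ≃ₗ[R] N) : MemP R N := by
  obtain ⟨h1, h2, h3⟩ := h
  refine ⟨Module.Finite.equiv e, fun x => ?_,
    CategoryTheory.hasProjectiveDimensionLT_of_iso e.toModuleIso 2⟩
  obtain ⟨a, ha⟩ := @h2 (e.symm x)
  refine ⟨a, ?_⟩
  apply e.symm.injective
  rw [map_zero, ← ha]
  exact map_smul e.symm (a : R) x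

theorem memP_of_subsingleton (M : Type u) [AddCommGroup M] [Module R M] [Subsingleton M] :
    MemP R M := by
  refine ⟨inferInstance, fun x => ⟨1, Subsingleton.elim _ _⟩, ?_⟩
  have : CategoryTheory.HasProjectiveDimensionLT (ModuleCat.of R M) 0 :=
    (ModuleCat.isZero_of_subsingleton _).hasProjectiveDimensionLT_zero
  exact CategoryTheory.hasProjectiveDimensionLT_of_ge _ 0 2 (by norm_num)

theorem isFilling_of_equiv {X M : TorsionModule R} (e : X ≃ₗ[R] M) : IsFilling X M := by
  refine ⟨⊥, ⊤, bot_le, memP_of_subsingleton _, ?_, ⟨?_⟩⟩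
  · have : Subsingleton (M ⧸ (⊤ : Submodule R M)) := Submodule.Quotient.subsingleton_iff.2 rfl
    exact memP_of_subsingleton _
  · refine e.trans (Submodule.topEquiv.symm.trans (Submodule.quotEquivOfEqBot _ ?_).symm)
    exact Submodule.ker_subtype _

theorem Equivalent.of_equiv {X Y : TorsionModule R} (e : X ≃ₗ[R] Y) : Equivalent X Y :=
  ⟨X, Y, isFilling_of_equiv (LinearEquiv.refl R X), isFilling_of_equiv (LinearEquiv.refl R Y), ⟨e⟩⟩

theorem IsFilling.prod_right {X M : TorsionModule R} (h : IsFilling X M) (Y : TorsionModule R) :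
    IsFilling (X.prod Y) (M.prod Y) := by
  obtain ⟨M', M'', hle, h1, h2, ⟨e⟩⟩ := h
  let q : M'' →ₗ[R] X := e.symm.toLinearMap ∘ₗ (M'.submoduleOf M'').mkQ
  have hq : Function.Surjective q :=
    e.symm.surjective.comp (Submodule.mkQ_surjective _)
  have hqk : ∀ m : M'', q m = 0 ↔ (m : M) ∈ M' := by
    intro m
    change e.symm ((M'.submoduleOf M'').mkQ m) = 0 ↔ _
    rw [LinearEquiv.map_eq_zero_iff, Submodule.mkQ_apply, Submodule.Quotient.mk_eq_zero]
    rfl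
  let N' : Submodule R (M × Y) := M'.prod ⊥
  let N'' : Submodule R (M × Y) := M''.prod ⊤
  let F : N'' →ₗ[R] (X × Y) :=
    LinearMap.prod
      (q ∘ₗ LinearMap.codRestrict M'' (LinearMap.fst R M Y ∘ₗ N''.subtype) (fun z => z.2.1))
      (LinearMap.snd R M Y ∘ₗ N''.subtype)
  have hF : Function.Surjective F := by
    rintro ⟨x, y⟩
    obtain ⟨m, rfl⟩ := hq x
    exact ⟨⟨(m, y), m.2, trivial⟩, rfl⟩
  have hFk : N'.submoduleOf N'' = LinearMap.ker F := by
    ext z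
    have h0 : z ∈ N'.submoduleOf N'' ↔ ((z : M × Y).1 ∈ M' ∧ (z : M × Y).2 = 0) := Iff.rfl
    have h3 := hqk ⟨(z : M × Y).1, z.2.1⟩
    rw [h0, LinearMap.mem_ker, ← h3]
    constructor
    · rintro ⟨ha, hb⟩
      exact Prod.ext ha hb
    · intro hz
      exact ⟨congrArg Prod.fst hz, congrArg Prod.snd hz⟩
  have hP1 : MemP R N' := by
    refine h1.of_equiv (LinearEquiv.ofBijective
      (LinearMap.codRestrict N' (LinearMap.inl R M Y ∘ₗ M'.subtype)
        (fun z => ⟨z.2, rfl⟩)) ⟨?_, ?_⟩)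
    · intro a b hab
      exact Subtype.ext (congrArg (fun z : N' => (z : M × Y).1) hab)
    · rintro ⟨⟨a, b⟩, ha, hb⟩
      obtain rfl : b = 0 := hb
      exact ⟨⟨a, ha⟩, rfl⟩
  have hP2 : MemP R ((M × Y) ⧸ N'') := by
    let G : (M × Y) →ₗ[R] (M ⧸ M'') := M''.mkQ ∘ₗ LinearMap.fst R M Y
    have hG : Function.Surjective G :=
      (Submodule.mkQ_surjective _).comp LinearMap.fst_surjective
    have hGk : N'' = LinearMap.ker G := by
      ext z
      rw [LinearMap.mem_ker]
      change (z.1 ∈ M'' ∧ z.2 ∈ (⊤ : Submodule R Y)) ↔ M''.mkQ z.1 = 0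
      rw [Submodule.mkQ_apply, Submodule.Quotient.mk_eq_zero]
      exact ⟨fun h => h.1, fun h => ⟨h, trivial⟩⟩
    exact h2.of_equiv
      ((Submodule.quotEquivOfEq _ _ hGk).trans (G.quotKerEquivOfSurjective hG)).symm
  exact ⟨N', N'', Submodule.prod_mono hle bot_le, hP1, hP2,
    ⟨((Submodule.quotEquivOfEq _ _ hFk).trans (F.quotKerEquivOfSurjective hF)).symm⟩⟩

theorem Equivalent.prod_right {X X' : TorsionModule R} (h : Equivalent X X')
    (Y : TorsionModule R) : Equivalent (X.prod Y) (X'.prod Y) := by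
  obtain ⟨M, N, h1, h2, ⟨e⟩⟩ := h
  exact ⟨M.prod Y, N.prod Y, h1.prod_right Y, h2.prod_right Y,
    ⟨LinearEquiv.prodCongr e (LinearEquiv.refl R Y)⟩⟩

variable (R) in
/-- The set `𝒞/∼` of equivalence classes. -/
def Classes : Type (u + 1) := Quot (Equivalent (R := R))

/-- The class `[X]` of a module `X` in `𝒞/∼`. -/
def cls (X : TorsionModule R) : Classes R := Quot.mk _ X

theorem cls_eq_of_equiv {X Y : TorsionModule R} (e : X ≃ₗ[R] Y) : cls X = cls Y :=
  Quot.sound (Equivalent.of_equiv e)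

theorem cls_prod_comm (X Y : TorsionModule R) : cls (X.prod Y) = cls (Y.prod X) :=
  cls_eq_of_equiv (LinearEquiv.prodComm R X Y)

theorem cls_prod_right {X X' : TorsionModule R} (h : Equivalent X X') (Y : TorsionModule R) :
    cls (X.prod Y) = cls (X'.prod Y) :=
  Quot.sound (h.prod_right Y)

/-- Addition on `𝒞/∼`: `[X] + [Y] = [X ⊕ Y]`. -/
instance : Add (Classes R) where
  add := Quot.lift₂ (fun X Y => cls (X.prod Y))
    (fun X Y Y' h => by
      rw [cls_prod_comm X Y, cls_prod_comm X Y']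
      exact cls_prod_right h X)
    (fun _ _ Y h => cls_prod_right h Y)

instance : Zero (Classes R) where
  zero := cls TorsionModule.zero

/-- `𝒞/∼` is a commutative monoid with respect to direct sums. -/
instance : AddCommMonoid (Classes R) where
  add_assoc := by
    rintro ⟨X⟩ ⟨Y⟩ ⟨Z⟩
    exact cls_eq_of_equiv (LinearEquiv.prodAssoc R X Y Z)
  zero_add := by
    rintro ⟨X⟩
    exact cls_eq_of_equiv (LinearEquiv.uniqueProd (R := R) (M := X) (M₂ := PUnit.{u + 1}))
  add_zero := by
    rintro ⟨X⟩
    exact cls_eq_of_equiv (LinearEquiv.prodUnique (R := R) (M := X) (M₂ := PUnit.{u + 1}))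
  add_comm := by
    rintro ⟨X⟩ ⟨Y⟩
    exact cls_prod_comm X Y
  nsmul := nsmulRec

end Category

section Group

/-- A finite group is `p`-elementary if it is the product of a `p`-group and a cyclic group;
it is elementary if it is `p`-elementary for some prime number `p`. -/
def IsElementary (G : Type u) [Group G] : Prop :=
  ∃ p : ℕ, p.Prime ∧ ∃ P C : Subgroup G, IsPGroup p P ∧ IsCyclic C ∧ Nonempty (G ≃* P × C)

variable (Γ : Type u) [CommGroup Γ]

/-- The kernel of the projection from `Γ` to its maximal `p`-quotient: the smallest subgroup `N`
such that `Γ ⧸ N` is a `p`-group. -/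
def pKernel (p : ℕ) : Subgroup Γ := sInf {N : Subgroup Γ | IsPGroup p (Γ ⧸ N)}

/-- The maximal `p`-quotient `Γ_p` of `Γ`. -/
abbrev MaxPQuotient (p : ℕ) : Type u := Γ ⧸ pKernel Γ p

variable {Γ} in
/-- The maximal `p`-quotient `I_p` of a subgroup `I ⊆ Γ`, as a subgroup of `Γ_p`: this is the
image of `I` in `Γ_p`. -/
def pPart (p : ℕ) (I : Subgroup Γ) : Subgroup (MaxPQuotient Γ p) :=
  I.map (QuotientGroup.mk' (pKernel Γ p))

/-- The set `𝒮` of pairs of subgroups `I ⊆ D ⊆ Γ` with `I` non-trivial and elementary and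
`D / I` cyclic. -/
structure SetS where
  I : Subgroup Γ
  D : Subgroup Γ
  le : I ≤ D
  ne_bot : I ≠ ⊥
  elementary : IsElementary I
  cyclic : IsCyclic (D ⧸ I.subgroupOf D)

/-- The set `𝒯` of tuples `(p, H, I*, D*)`, where `p` is a prime number, `H ⊆ Γ` is a subgroup such
that `Γ / H` is cyclic of order prime to `p`, and `I* ⊆ D* ⊆ Γ_p` are subgroups such that `I*` is
non-trivial and `D* / I*` is cyclic. -/
structure SetT where
  p : ℕ
  prime : p.Prime
  H : Subgroup Γ
  cyclic_quotient : IsCyclic (Γ ⧸ H)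
  coprime : (Nat.card (Γ ⧸ H)).Coprime p
  I : Subgroup (MaxPQuotient Γ p)
  D : Subgroup (MaxPQuotient Γ p)
  le : I ≤ D
  ne_bot : I ≠ ⊥
  cyclic : IsCyclic (D ⧸ I.subgroupOf D)

variable {Γ} in
theorem SetT.dvd_card [Finite Γ] (t : SetT Γ) : t.p ∣ Nat.card Γ := by
  have hex : ∃ N : Subgroup Γ, IsPGroup t.p (Γ ⧸ N) ∧ N ≠ ⊤ := by
    by_contra! hcon
    have htop : pKernel Γ t.p = ⊤ := sInf_eq_top.2 hcon
    have : Subsingleton (MaxPQuotient Γ t.p) := by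
      change Subsingleton (Γ ⧸ pKernel Γ t.p)
      rw [htop]
      exact QuotientGroup.subsingleton_quotient_top
    exact t.ne_bot (Subsingleton.elim _ _)
  obtain ⟨N, hN, hne⟩ := hex
  have : Fact t.p.Prime := ⟨t.prime⟩
  obtain ⟨k, hk⟩ := IsPGroup.iff_card.1 hN
  have h1 : Nat.card (Γ ⧸ N) ≠ 1 := by
    intro h
    exact hne (Subgroup.index_eq_one.1 h)
  have hk0 : k ≠ 0 := by
    rintro rfl
    exact h1 (by simpa using hk)
  exact ((dvd_pow_self t.p hk0).trans hk.symm.dvd).trans N.card_quotient_dvd_card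

instance [Finite Γ] : Finite (SetT Γ) := by
  have h0 : Nat.card Γ ≠ 0 := Nat.card_pos.ne'
  let f : SetT Γ → Σ p : (Nat.card Γ).divisors,
      Subgroup Γ × Subgroup (MaxPQuotient Γ p) × Subgroup (MaxPQuotient Γ p) :=
    fun t => ⟨⟨t.p, Nat.mem_divisors.2 ⟨t.dvd_card, h0⟩⟩, t.H, t.I, t.D⟩
  refine Finite.of_injective f ?_
  rintro ⟨p, _, H, _, _, I, D, _, _, _⟩ ⟨p', _, H', _, _, I', D', _, _, _⟩ h
  obtain ⟨h1, h2⟩ := Sigma.mk.inj_iff.1 h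
  obtain rfl : p = p' := congrArg Subtype.val h1
  obtain ⟨rfl, rfl, rfl⟩ : H = H' ∧ I = I' ∧ D = D' := by simpa using h2
  rfl

open scoped Classical in
/-- The homomorphism `β : ℕ^𝒮 → ℕ^𝒯` sending the basis element `(I, D)` to the sum of all
`(p, H, I*, D*)` in `𝒯` with `D ⊆ H`, `I_p = I*` and `D_p = D*`. -/
def beta [Finite Γ] : (SetS Γ →₀ ℕ) →+ (SetT Γ →₀ ℕ) :=
  letI := Fintype.ofFinite (SetT Γ)
  (Finsupp.linearCombination ℕ fun s : SetS Γ =>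
    ∑ t : SetT Γ with s.D ≤ t.H ∧ pPart t.p s.I = t.I ∧ pPart t.p s.D = t.D,
      Finsupp.single t 1).toAddMonoidHom

variable {Γ}

/-- The element `1 - φ⁻¹ + #I` of `ℤ[Γ/I]`. -/
def gElt (I : Subgroup Γ) (φ : Γ ⧸ I) : MonoidAlgebra ℤ (Γ ⧸ I) :=
  1 - MonoidAlgebra.of ℤ (Γ ⧸ I) φ⁻¹ + (Nat.card I : MonoidAlgebra ℤ (Γ ⧸ I))

/-- The underlying abelian group `ℤ[Γ/I] / (1 - φ⁻¹ + #I)` of `A_{I,φ}`. -/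
def ACarrier (I : Subgroup Γ) (φ : Γ ⧸ I) : Type u :=
  MonoidAlgebra ℤ (Γ ⧸ I) ⧸ Ideal.span {gElt I φ}

instance (I : Subgroup Γ) (φ : Γ ⧸ I) : CommRing (ACarrier I φ) :=
  inferInstanceAs (CommRing (MonoidAlgebra ℤ (Γ ⧸ I) ⧸ Ideal.span {gElt I φ}))

/-- The canonical ring homomorphism `ℤ[Γ] → ℤ[Γ/I] → ℤ[Γ/I] / (1 - φ⁻¹ + #I)`. -/
def AProj (I : Subgroup Γ) (φ : Γ ⧸ I) : MonoidAlgebra ℤ Γ →+* ACarrier I φ :=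
  (Ideal.Quotient.mk (Ideal.span {gElt I φ})).comp
    (MonoidAlgebra.mapDomainRingHom ℤ (QuotientGroup.mk' I))

/-- `ℤ[Γ]` acts on `ℤ[Γ/I] / (1 - φ⁻¹ + #I)` through the projection `ℤ[Γ] → ℤ[Γ/I]`. -/
instance (I : Subgroup Γ) (φ : Γ ⧸ I) : Module (MonoidAlgebra ℤ Γ) (ACarrier I φ) :=
  Module.compHom _ (AProj I φ)

theorem AProj_surjective (I : Subgroup Γ) (φ : Γ ⧸ I) : Function.Surjective (AProj I φ) := by
  refine Ideal.Quotient.mk_surjective.comp fun y => ?_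
  induction y using MonoidAlgebra.induction_linear with
  | zero => exact ⟨0, map_zero _⟩
  | add a b ha hb =>
    obtain ⟨a', rfl⟩ := ha
    obtain ⟨b', rfl⟩ := hb
    exact ⟨a' + b', map_add _ _ _⟩
  | single g n =>
    obtain ⟨g', rfl⟩ := QuotientGroup.mk'_surjective I g
    exact ⟨MonoidAlgebra.single g' n, MonoidAlgebra.mapDomain_single⟩

theorem finite_ACarrier (I : Subgroup Γ) (φ : Γ ⧸ I) :
    Module.Finite (MonoidAlgebra ℤ Γ) (ACarrier I φ) := by
  refine Module.Finite.of_surjective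
    (LinearMap.toSpanSingleton (MonoidAlgebra ℤ Γ) (ACarrier I φ) 1) ?_
  intro x
  obtain ⟨r, rfl⟩ := AProj_surjective I φ x
  exact ⟨r, mul_one _⟩

theorem torsion_ACarrier [Finite Γ] (I : Subgroup Γ) (φ : Γ ⧸ I) :
    Module.IsTorsion (MonoidAlgebra ℤ Γ) (ACarrier I φ) := by
  let m := orderOf φ
  let k : ℕ := (1 + Nat.card I) ^ m - 1
  have hm : m ≠ 0 := (orderOf_pos φ).ne'
  have hI : 0 < Nat.card I := Nat.card_pos
  have hk : k ≠ 0 := Nat.sub_ne_zero_of_lt (Nat.one_lt_pow hm (by omega))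
  have hk1 : k + 1 = (1 + Nat.card I) ^ m := Nat.sub_add_cancel (Nat.one_le_pow _ _ (by omega))
  have hreg : (k : MonoidAlgebra ℤ Γ) ∈ (MonoidAlgebra ℤ Γ)⁰ := by
    rw [mem_nonZeroDivisors_iff_right]
    intro x hx
    rw [mul_comm, ← nsmul_eq_mul] at hx
    have hx' : (k : ℤ) • x = 0 := by rw [natCast_zsmul, hx]
    exact (smul_eq_zero.1 hx').resolve_left (Int.natCast_ne_zero.2 hk)
  refine fun x => ⟨⟨k, hreg⟩, ?_⟩
  change AProj I φ (k : MonoidAlgebra ℤ Γ) * x = 0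
  have hz : ((k : ℕ) : ACarrier I φ) = 0 := by
    have h1 : Ideal.Quotient.mk (Ideal.span {gElt I φ}) (gElt I φ) = 0 :=
      Ideal.Quotient.eq_zero_iff_mem.2 (Ideal.mem_span_singleton_self _)
    let π : MonoidAlgebra ℤ (Γ ⧸ I) →+* ACarrier I φ :=
      Ideal.Quotient.mk (Ideal.span {gElt I φ})
    have h2 : π (gElt I φ) = 0 := h1
    have h3 : (1 + Nat.card I : ACarrier I φ) = π (MonoidAlgebra.of ℤ (Γ ⧸ I) φ⁻¹) := by
      rw [gElt, map_add, map_sub, map_one, map_natCast] at h2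
      linear_combination h2
    have h4 : ((k + 1 : ℕ) : ACarrier I φ) = 1 := by
      rw [hk1]
      push_cast
      rw [h3, ← map_pow, ← map_pow, inv_pow, pow_orderOf_eq_one, inv_one, map_one, map_one]
    push_cast at h4
    linear_combination h4
  rw [map_natCast, hz, zero_mul]

/-- The finite `ℤ[Γ]`-module `A_{I,φ} = ℤ[Γ/I] / (1 - φ⁻¹ + #I)`. -/
def moduleA [Finite Γ] (I : Subgroup Γ) (φ : Γ ⧸ I) : TorsionModule (MonoidAlgebra ℤ Γ) where
  carrier := ACarrier I φ
  finite := finite_ACarrier I φ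
  torsion := torsion_ACarrier I φ

variable (Γ) in
/-- The submonoid `𝒵^adm ⊆ 𝒞/∼` over `ℤ[Γ]` generated by the classes `[ω¹(A_{I,φ})]`, where `I`
runs over the non-trivial elementary subgroups of `Γ` and `φ` over the elements of `Γ/I`. -/
def Zadm [Finite Γ] : AddSubmonoid (Classes (MonoidAlgebra ℤ Γ)) :=
  AddSubmonoid.closure {c | ∃ (I : Subgroup Γ) (φ : Γ ⧸ I), I ≠ ⊥ ∧ IsElementary I ∧
    ∃ Y, IsShift (moduleA I φ) Y ∧ c = cls Y}

end Group

end GroupRingClasses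

end

/-!
The class `[ω¹(A_{I,φ})]` depends only on the pair `(I, D)`, where `D` is generated by `I` and a
lift of `φ`. The element `1 - φ⁻¹ + #I` may be replaced by `1 + #Γ - φ` without changing the class
(`shiftClass_add_card_mul`, `shiftClass_moduleA`), and `φ` by another generator of `D / I`
(`shiftClass_relModule_eq`). Hence `𝒵^adm` is the image of a homomorphism `shiftHom` from `ℕ^𝒮` to
`𝒞/∼` (`mrange_shiftHom`). The theorem says that `shiftHom` and `β` identify the same elements
of `ℕ^𝒮`.

*If `β c = β d`, then `shiftHom c = shiftHom d`* (`shiftHom_eq_of_beta_eq`). A class is determined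
by its components at the maximal ideals `𝔪` of `ℤ[Γ]` (`eq_of_compHom_eq`). Let `p` be the residue
characteristic at `𝔪` and `H` the subgroup of `Γ` acting trivially on the residue field; then
`Γ/H` is cyclic of order prime to `p`. The component of `[ω¹(A_{I,φ})]` at `𝔪` vanishes unless
`D ⊆ H` and `p` divides `#I`, and in that case it depends only on the `p`-parts of `I` and `D`
(`shiftClass_comp_relModule`). So all components factor through `β`.

*If `shiftHom c = shiftHom d`, then `β c = β d`* (`beta_eq_of_shiftHom_eq`). Modules in `𝒫` are
cohomologically trivial (`MemP.cohTrivial`), so for every subgroup `K` of `Γ` the `ℤ[Γ]`-module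
`Ĥ⁰(K, X)` depends only on the class of `X`, and `Ĥ⁰(K, ω¹(A)) ≅ Ĥ⁻¹(K, A)`. Let `#K = p ^ n` with
`n > 0`. If `K ⊆ I`, then `Ĥ⁻¹(K, A_{I,φ})` is the `p ^ n`-torsion of `A_{I,φ}`, and the number of
its `L`-invariant elements of order dividing `p ^ j` is `p ^ (j [Γ : D L])` for `j ≤ n`; if `K ⊈ I`,
it is killed by `p ^ (n - 1)`. Comparing `j = n` with `j = n - 1` therefore shows that the class
`∑ a_s [ω¹(A_s)]` determines the numbers `∑_{K ⊆ I_s} a_s [Γ : D_s L]` (`tateLog_sub_shift`).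
Möbius inversion over `K` isolates the pairs with a given `p`-part of `I`
(`sum_index_fiber_eq_zero`). The dependence on `L` yields the values of the function
`∑ a_s / #D_s · 1_{D_s}` on `Γ` (`sum_indicator_eq_zero`). A second Möbius inversion isolates the
`p`-part of `D` (`sum_indicator_fiber_eq_zero`), and pairing with a character with kernel `H` on the
prime-to-`p` part extracts `∑_{D_s ⊆ H} a_s` (`sum_coefficient_eq_zero`), a coefficient of `β`.

For a `p`-group the condition `D ⊆ H` is void and `𝒯` is in bijection with `𝒮`, so that `β` is
injective (`beta_injective_of_isPGroup`).
-/

noncomputable section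

namespace GroupRingClasses

section General

variable {R : Type u} [CommRing R]

/-! ### Equivalence classes and shifts over a commutative ring -/

theorem isFilling_of_injective {Y N : TorsionModule R} (i : Y →ₗ[R] N)
    (hi : Function.Injective i) (hP : MemP R (N ⧸ LinearMap.range i)) : IsFilling Y N := by
  refine ⟨⊥, LinearMap.range i, bot_le, memP_of_subsingleton _, hP, ⟨?_⟩⟩
  refine (LinearEquiv.ofInjective i hi).trans (Submodule.quotEquivOfEqBot _ ?_).symm
  rw [Submodule.submoduleOf, Submodule.comap_bot, Submodule.ker_subtype]

/-- A submodule whose quotient lies in `𝒫` has the same class as the whole module. -/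
theorem cls_eq_of_injective {Y N : TorsionModule R} (i : Y →ₗ[R] N)
    (hi : Function.Injective i) (hP : MemP R (N ⧸ LinearMap.range i)) : cls Y = cls N :=
  Quot.sound ⟨N, N, isFilling_of_injective i hi hP,
    isFilling_of_equiv (LinearEquiv.refl R N), ⟨LinearEquiv.refl R N⟩⟩

theorem cls_eq_of_exact {Y N : TorsionModule R} {P : Type u} [AddCommGroup P] [Module R P]
    (hP : MemP R P) (i : Y →ₗ[R] N) (q : N →ₗ[R] P) (hi : Function.Injective i)
    (he : Function.Exact i q) (hq : Function.Surjective q) : cls Y = cls N := by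
  refine cls_eq_of_injective i hi (hP.of_equiv ?_)
  exact ((Submodule.quotEquivOfEq _ _ (LinearMap.exact_iff.1 he).symm).trans
    (q.quotKerEquivOfSurjective hq)).symm

theorem cls_eq_zero_of_memP {X : TorsionModule R} (hX : MemP R X) : cls X = 0 := by
  symm
  refine cls_eq_of_exact (Y := TorsionModule.zero) hX 0 LinearMap.id ?_ ?_ Function.surjective_id
  · intro a b _
    exact Subsingleton.elim (α := PUnit) a b
  · intro x
    exact ⟨fun h => ⟨0, h.symm⟩, fun ⟨_, h⟩ => h.symm⟩

/-- Schanuel's argument: the class of a shift of `X` depends on `X` only. The fibre product of two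
modules in `𝒫` over `X` has both shifts as submodules with quotients in `𝒫`. -/
theorem cls_eq_of_isShift {X X' Y Y' : TorsionModule R} (h : IsShift X Y) (h' : IsShift X' Y')
    (e : X ≃ₗ[R] X') : cls Y = cls Y' := by
  obtain ⟨P, hP, i, q, hi, he, hq⟩ := h
  obtain ⟨P', hP', i', q', hi', he', hq'⟩ := h'
  let K : Submodule R (P × P') :=
    LinearMap.eqLocus (e.toLinearMap ∘ₗ q ∘ₗ LinearMap.fst R P P') (q' ∘ₗ LinearMap.snd R P P')
  have hK : ∀ z : P × P', z ∈ K ↔ e (q z.1) = q' z.2 := fun _ => Iff.rfl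
  -- The fibre product is an extension of `P'` by `Y`, hence finitely generated.
  let j : Y →ₗ[R] K := LinearMap.codRestrict K (LinearMap.inl R P P' ∘ₗ i) (fun y => by
    rw [hK]
    change e (q (i y)) = q' 0
    rw [(he _).2 ⟨y, rfl⟩, map_zero, map_zero])
  let j' : Y' →ₗ[R] K := LinearMap.codRestrict K (LinearMap.inr R P P' ∘ₗ i') (fun y => by
    rw [hK]
    change e (q 0) = q' (i' y)
    rw [(he' _).2 ⟨y, rfl⟩, map_zero, map_zero])
  let r : K →ₗ[R] P := LinearMap.fst R P P' ∘ₗ K.subtype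
  let r' : K →ₗ[R] P' := LinearMap.snd R P P' ∘ₗ K.subtype
  have hj : Function.Injective j := fun a b hab =>
    hi (congrArg (fun z : K => (z : P × P').1) hab)
  have hj' : Function.Injective j' := fun a b hab =>
    hi' (congrArg (fun z : K => (z : P × P').2) hab)
  have hr : Function.Surjective r := by
    intro p
    obtain ⟨p', hp'⟩ := hq' (e (q p))
    exact ⟨⟨(p, p'), (hK _).2 hp'.symm⟩, rfl⟩
  have hr' : Function.Surjective r' := by
    intro p'
    obtain ⟨p, hp⟩ := hq (e.symm (q' p'))
    exact ⟨⟨(p, p'), (hK _).2 (by simp [hp])⟩, rfl⟩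
  have hjr' : Function.Exact j r' := by
    rintro ⟨⟨p, p'⟩, hz⟩
    constructor
    · intro h0
      obtain rfl : p' = 0 := h0
      have h1 : q p = 0 := by
        have h2 := (hK _).1 hz
        rwa [map_zero, LinearEquiv.map_eq_zero_iff] at h2
      obtain ⟨y, rfl⟩ := (he p).1 h1
      exact ⟨y, rfl⟩
    · rintro ⟨y, hy⟩
      exact (congrArg (fun z : K => (z : P × P').2) hy).symm
  have hjr : Function.Exact j' r := by
    rintro ⟨⟨p, p'⟩, hz⟩
    constructor
    · intro h0
      obtain rfl : p = 0 := h0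
      have h1 : q' p' = 0 := by
        have h2 := (hK _).1 hz
        simpa using h2.symm
      obtain ⟨y, rfl⟩ := (he' p').1 h1
      exact ⟨y, rfl⟩
    · rintro ⟨y, hy⟩
      exact (congrArg (fun z : K => (z : P × P').1) hy).symm
  have hfin : Module.Finite R K := by
    have hker : LinearMap.ker r' = LinearMap.range j := LinearMap.exact_iff.1 hjr'
    have hkf : (LinearMap.ker r').FG := by
      rw [hker, LinearMap.range_eq_map]
      exact Submodule.FG.map _ Y.finite.1
    exact ⟨Submodule.fg_of_fg_map_of_fg_inf_ker r'
      (by rw [Submodule.map_top, LinearMap.range_eq_top.2 hr']; exact P'.finite.1)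
      (by rwa [top_inf_eq])⟩
  let N : TorsionModule R :=
    { carrier := K
      finite := hfin
      torsion := by
        rintro ⟨z, hz⟩
        obtain ⟨a, ha⟩ := @isTorsion_prod R _ P P' _ _ _ _ P.torsion P'.torsion z
        exact ⟨a, Subtype.ext ha⟩ }
  calc cls Y = cls N := cls_eq_of_exact (N := N) hP' j r' hj hjr' hr'
    _ = cls Y' := (cls_eq_of_exact (N := N) hP j' r hj' hjr hr).symm

open Classical in
/-- The class `[ω¹(X)]`, with junk value `0` when `X` has no shift. -/
def shiftClass (X : TorsionModule R) : Classes R :=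
  if h : ∃ Y, IsShift X Y then cls h.choose else 0

theorem IsShift.shiftClass_eq {X Y : TorsionModule R} (h : IsShift X Y) :
    shiftClass X = cls Y := by
  have hex : ∃ Y, IsShift X Y := ⟨Y, h⟩
  rw [shiftClass, dif_pos hex]
  exact cls_eq_of_isShift hex.choose_spec h (LinearEquiv.refl R X)

theorem IsShift.of_equiv {X X' Y : TorsionModule R} (h : IsShift X Y) (e : X ≃ₗ[R] X') :
    IsShift X' Y := by
  obtain ⟨P, hP, i, q, hi, he, hq⟩ := h
  refine ⟨P, hP, i, e.toLinearMap ∘ₗ q, hi, fun x => ?_, e.surjective.comp hq⟩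
  rw [← he x]
  exact e.map_eq_zero_iff

theorem shiftClass_congr {X X' : TorsionModule R} (e : X ≃ₗ[R] X') :
    shiftClass X = shiftClass X' := by
  by_cases h : ∃ Y, IsShift X Y
  · obtain ⟨Y, hY⟩ := h
    rw [hY.shiftClass_eq, (hY.of_equiv e).shiftClass_eq]
  · have h' : ¬ ∃ Y, IsShift X' Y := fun ⟨Y, hY⟩ => h ⟨Y, hY.of_equiv e.symm⟩
    rw [shiftClass, shiftClass, dif_neg h, dif_neg h']

theorem shiftClass_eq_zero_of_memP {X Y : TorsionModule R} (h : IsShift X Y) (hX : MemP R X) :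
    shiftClass X = 0 := by
  rw [h.shiftClass_eq]
  obtain ⟨P, hP, i, q, hi, he, hq⟩ := h
  rw [cls_eq_of_exact hX i q hi he hq, cls_eq_zero_of_memP hP]

/-- The class of the shift does not change along a surjection with kernel in `𝒫`. -/
theorem shiftClass_eq_of_surjective [IsNoetherianRing R] {X X' Y : TorsionModule R}
    (h : IsShift X Y) (π : X →ₗ[R] X') (hπ : Function.Surjective π)
    (hK : MemP R (LinearMap.ker π)) : shiftClass X = shiftClass X' := by
  obtain ⟨P, hP, i, q, hi, he, hq⟩ := id h
  let K' : Submodule R P := LinearMap.ker (π ∘ₗ q)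
  have := P.finite
  let Z : TorsionModule R :=
    { carrier := K'
      finite := inferInstance
      torsion := by
        rintro ⟨z, hz⟩
        obtain ⟨a, ha⟩ := @P.torsion z
        exact ⟨a, Subtype.ext ha⟩ }
  have hZ : IsShift X' Z := by
    refine ⟨P, hP, K'.subtype, π ∘ₗ q, K'.injective_subtype, ?_, hπ.comp hq⟩
    exact LinearMap.exact_subtype_ker_map _
  rw [h.shiftClass_eq, hZ.shiftClass_eq]
  let s : K' →ₗ[R] LinearMap.ker π :=
    LinearMap.codRestrict _ (q ∘ₗ K'.subtype) (fun z => z.2)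
  let j : Y →ₗ[R] K' := LinearMap.codRestrict _ i (fun y => by
    rw [LinearMap.mem_ker]
    change π (q (i y)) = 0
    rw [(he _).2 ⟨y, rfl⟩, map_zero])
  refine cls_eq_of_exact (N := Z) hK j s (fun a b hab => hi (congrArg Subtype.val hab)) ?_ ?_
  · rintro ⟨z, hz⟩
    constructor
    · intro h0
      obtain ⟨y, rfl⟩ := (he z).1 (congrArg Subtype.val h0)
      exact ⟨y, rfl⟩
    · rintro ⟨y, hy⟩
      exact Subtype.ext ((he z).2 ⟨y, congrArg Subtype.val hy⟩)
  · rintro ⟨x, hx⟩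
    obtain ⟨p, rfl⟩ := hq x
    exact ⟨⟨p, hx⟩, rfl⟩

/-- `𝒫` is closed under retracts. -/
theorem MemP.of_retract {M N : Type u} [AddCommGroup M] [Module R M] [AddCommGroup N] [Module R N]
    (h : MemP R N) (i : M →ₗ[R] N) (r : N →ₗ[R] M) (hri : r ∘ₗ i = LinearMap.id) : MemP R M := by
  obtain ⟨h1, h2, h3⟩ := h
  have hri' : ∀ x, r (i x) = x := fun x => LinearMap.congr_fun hri x
  refine ⟨Module.Finite.of_surjective r (fun x => ⟨i x, hri' x⟩), fun x => ?_, ?_⟩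
  · obtain ⟨a, ha⟩ := @h2 (i x)
    refine ⟨a, ?_⟩
    change (a : R) • x = 0
    rw [← hri' x, ← map_smul]
    exact (congrArg r ha).trans (map_zero r)
  · let ρ : CategoryTheory.Retract (ModuleCat.of R M) (ModuleCat.of R N) :=
      { i := ModuleCat.ofHom i
        r := ModuleCat.ofHom r
        retract := by
          rw [← ModuleCat.ofHom_comp, hri]
          rfl }
    exact ρ.hasProjectiveDimensionLT 2

/-- The quotient of `R` by a non-zero-divisor lies in `𝒫`. -/
theorem memP_quotient_span {g : R} (hg : g ∈ R⁰) : MemP R (R ⧸ Ideal.span {g}) := by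
  refine ⟨inferInstance, ?_, ?_⟩
  · intro x
    refine ⟨⟨g, hg⟩, ?_⟩
    obtain ⟨r, rfl⟩ := Ideal.Quotient.mk_surjective x
    change Ideal.Quotient.mk _ (g * r) = 0
    exact Ideal.Quotient.eq_zero_iff_mem.2
      (Ideal.mul_mem_right _ _ (Ideal.mem_span_singleton_self g))
  · let f : R →ₗ[R] R := LinearMap.mulLeft R g
    let p : R →ₗ[R] (R ⧸ Ideal.span {g}) := Submodule.mkQ _
    have hex : Function.Exact f p := by
      intro x
      rw [Submodule.mkQ_apply, Submodule.Quotient.mk_eq_zero, Ideal.mem_span_singleton]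
      exact ⟨fun ⟨c, hc⟩ => ⟨c, hc.symm⟩, fun ⟨c, hc⟩ => ⟨c, hc.symm⟩⟩
    have hS := ModuleCat.shortComplex_shortExact
      (ModuleCat.shortComplexOfCompEqZero f p hex.linearMap_comp_eq_zero) hex
      (fun a b hab => by
        have h1 : g * (a - b) = 0 := by rw [mul_sub]; exact sub_eq_zero.2 hab
        exact sub_eq_zero.1 ((mul_left_mem_nonZeroDivisors_eq_zero_iff hg).1 h1))
      (Submodule.mkQ_surjective _)
    have hproj : CategoryTheory.Projective (ModuleCat.of R R) :=
      (IsProjective.iff_projective R).1 inferInstance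
    have h1 : CategoryTheory.HasProjectiveDimensionLT (ModuleCat.of R R) 1 :=
      CategoryTheory.projective_iff_hasProjectiveDimensionLT_one.1 hproj
    exact hS.hasProjectiveDimensionLT_X₃ 1 h1
      (CategoryTheory.hasProjectiveDimensionLT_of_ge _ 1 2 (by norm_num))

/-- A module in `𝒫` has a presentation by projective modules without further syzygies. -/
theorem MemP.exists_projective_ker {M : Type u} [AddCommGroup M] [Module R M] (h : MemP R M) :
    Module.Projective R (LinearMap.ker (Finsupp.linearCombination R (id : M → M))) := by
  have h3 := h.2.2
  have hsurj : Function.Surjective (Finsupp.linearCombination R (id : M → M)) :=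
    Finsupp.linearCombination_id_surjective R M
  have hS := LinearMap.shortExact_shortComplexKer hsurj
  have hproj : CategoryTheory.Projective (ModuleCat.of R (M →₀ R)) :=
    (IsProjective.iff_projective (M →₀ R)).1 inferInstance
  have h1 : CategoryTheory.HasProjectiveDimensionLT (ModuleCat.of R (M →₀ R)) 1 :=
    CategoryTheory.projective_iff_hasProjectiveDimensionLT_one.1 hproj
  have h4 := hS.hasProjectiveDimensionLT_X₁ 1 h1 h3
  exact (IsProjective.iff_projective _).2
    (CategoryTheory.projective_iff_hasProjectiveDimensionLT_one.2 h4)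

/-! ### Cyclic modules -/

/-- The object `R ⧸ 𝔞` of `𝒞`, for an ideal `𝔞` containing a non-zero-divisor. -/
def cyclicModule (𝔞 : Ideal R) (h : ∃ g ∈ 𝔞, g ∈ R⁰) : TorsionModule R where
  carrier := R ⧸ 𝔞
  finite := inferInstance
  torsion := by
    obtain ⟨g, hg, hr⟩ := h
    intro x
    refine ⟨⟨g, hr⟩, ?_⟩
    obtain ⟨r, rfl⟩ := Ideal.Quotient.mk_surjective x
    change Ideal.Quotient.mk _ (g * r) = 0
    exact Ideal.Quotient.eq_zero_iff_mem.2 (Ideal.mul_mem_right _ _ hg)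

theorem exists_regular_of_le {𝔞 𝔟 : Ideal R} (hle : 𝔞 ≤ 𝔟) (h : ∃ g ∈ 𝔞, g ∈ R⁰) :
    ∃ g ∈ 𝔟, g ∈ R⁰ := by
  obtain ⟨g, hg, hr⟩ := h
  exact ⟨g, hle hg, hr⟩

theorem exists_isShift_cyclicModule [IsNoetherianRing R] (𝔞 : Ideal R)
    (h : ∃ g ∈ 𝔞, g ∈ R⁰) : ∃ Y, IsShift (cyclicModule 𝔞 h) Y := by
  obtain ⟨g, hg, hr⟩ := id h
  have hle : Ideal.span {g} ≤ 𝔞 := (Ideal.span_singleton_le_iff_mem _).2 hg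
  let P : TorsionModule R := cyclicModule (Ideal.span {g}) ⟨g, Ideal.mem_span_singleton_self g, hr⟩
  let q : (R ⧸ Ideal.span {g}) →ₗ[R] (R ⧸ 𝔞) := Submodule.factor hle
  refine ⟨{ carrier := LinearMap.ker q
            finite := inferInstance
            torsion := ?_ }, P, memP_quotient_span hr, (LinearMap.ker q).subtype, q,
    Subtype.val_injective, LinearMap.exact_subtype_ker_map q, Submodule.factor_surjective hle⟩
  rintro ⟨z, hz⟩
  obtain ⟨a, ha⟩ := @P.torsion z
  exact ⟨a, Subtype.ext ha⟩

/-- If `g` is regular on `R` and on `R ⧸ J`, then `J ⧸ gJ` is a shift of `R ⧸ (J + gR)`; it depends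
only on the action of `g` on `J`. So two such elements agreeing on `J` give the same class. -/
theorem shiftClass_eq_of_mul_eq [IsNoetherianRing R] (J : Ideal R) {g h : R} (hg : g ∈ R⁰)
    (hh : h ∈ R⁰) (hgJ : ∀ r, g * r ∈ J → r ∈ J) (hhJ : ∀ r, h * r ∈ J → r ∈ J)
    (heq : ∀ x ∈ J, g * x = h * x) (hex : ∃ a ∈ J ⊔ Ideal.span {g}, a ∈ R⁰)
    (hex' : ∃ a ∈ J ⊔ Ideal.span {h}, a ∈ R⁰) :
    shiftClass (cyclicModule (J ⊔ Ideal.span {g}) hex) =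
      shiftClass (cyclicModule (J ⊔ Ideal.span {h}) hex') := by
  -- The shift is realised as the image of `J` in `R ⧸ gR`, which is `J ⧸ gJ`.
  have key : ∀ {g : R} (hg : g ∈ R⁰) (_ : ∀ r, g * r ∈ J → r ∈ J)
      (hex : ∃ a ∈ J ⊔ Ideal.span {g}, a ∈ R⁰),
      ∃ Y, IsShift (cyclicModule (J ⊔ Ideal.span {g}) hex) Y ∧
        Nonempty (Y ≃ₗ[R] (J ⧸ LinearMap.range (LinearMap.lsmul R J g))) := by
    intro g hg hgJ hex
    have hle : Ideal.span {g} ≤ J ⊔ Ideal.span {g} := le_sup_right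
    let P : TorsionModule R :=
      cyclicModule (Ideal.span {g}) ⟨g, Ideal.mem_span_singleton_self g, hg⟩
    let q : (R ⧸ Ideal.span {g}) →ₗ[R] (R ⧸ (J ⊔ Ideal.span {g})) := Submodule.factor hle
    let i : J →ₗ[R] (R ⧸ Ideal.span {g}) := Submodule.mkQ _ ∘ₗ J.subtype
    have hiq : LinearMap.range i = LinearMap.ker q := by
      ext z
      obtain ⟨r, rfl⟩ := Submodule.mkQ_surjective _ z
      rw [LinearMap.mem_ker]
      change _ ↔ (Submodule.Quotient.mk r : R ⧸ (J ⊔ Ideal.span {g})) = 0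
      rw [Submodule.Quotient.mk_eq_zero]
      constructor
      · rintro ⟨⟨j, hj⟩, hjr⟩
        have h1 : j - r ∈ Ideal.span {g} := (Submodule.Quotient.eq _).1 hjr
        have h2 : r = j - (j - r) := by ring
        rw [h2]
        exact Submodule.sub_mem _ (Ideal.mem_sup_left hj) (Ideal.mem_sup_right h1)
      · intro hr
        obtain ⟨j, hj, s, hs, rfl⟩ := Submodule.mem_sup.1 hr
        refine ⟨⟨j, hj⟩, (Submodule.Quotient.eq _).2 ?_⟩
        change j - (j + s) ∈ _
        rw [sub_add_cancel_left]
        exact neg_mem hs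
    have hki : LinearMap.ker i = LinearMap.range (LinearMap.lsmul R J g) := by
      ext ⟨j, hj⟩
      rw [LinearMap.mem_ker]
      change (Submodule.Quotient.mk j : R ⧸ Ideal.span {g}) = 0 ↔ _
      rw [Submodule.Quotient.mk_eq_zero, Ideal.mem_span_singleton]
      constructor
      · rintro ⟨c, rfl⟩
        exact ⟨⟨c, hgJ c hj⟩, rfl⟩
      · rintro ⟨c, hc⟩
        exact ⟨c, (congrArg Subtype.val hc).symm⟩
    refine ⟨{ carrier := LinearMap.ker q
              finite := inferInstance
              torsion := ?_ }, ⟨P, memP_quotient_span hg, (LinearMap.ker q).subtype, q,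
      Subtype.val_injective, LinearMap.exact_subtype_ker_map q, Submodule.factor_surjective hle⟩,
      ⟨?_⟩⟩
    · rintro ⟨z, hz⟩
      obtain ⟨a, ha⟩ := @P.torsion z
      exact ⟨a, Subtype.ext ha⟩
    · exact (LinearEquiv.ofEq _ _ hiq).symm.trans
        (i.quotKerEquivRange.symm.trans (Submodule.quotEquivOfEq _ _ hki))
  obtain ⟨Y, hY, ⟨e⟩⟩ := key hg hgJ hex
  obtain ⟨Z, hZ, ⟨f⟩⟩ := key hh hhJ hex'
  have hlin : LinearMap.lsmul R J g = LinearMap.lsmul R J h := by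
    ext x
    exact heq x x.2
  rw [hY.shiftClass_eq, hZ.shiftClass_eq]
  exact cls_eq_of_equiv ((e.trans (Submodule.quotEquivOfEq _ _ (by rw [hlin]))).trans f.symm)

theorem shiftClass_cyclicModule_congr {𝔞 𝔟 : Ideal R} (h : 𝔞 = 𝔟) (ha : ∃ g ∈ 𝔞, g ∈ R⁰)
    (hb : ∃ g ∈ 𝔟, g ∈ R⁰) :
    shiftClass (cyclicModule 𝔞 ha) = shiftClass (cyclicModule 𝔟 hb) := by
  subst h
  rfl

end General

/-! ### Relative augmentation ideals and norm elements of an integral group ring -/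

section NormElements

variable {G : Type u} [CommGroup G]

/-- The element of `ℤ[G]` given by a group element. -/
abbrev gp (g : G) : MonoidAlgebra ℤ G := MonoidAlgebra.of ℤ G g

/-- The kernel of the projection `ℤ[G] → ℤ[G/I]`. -/
def augIdeal (I : Subgroup G) : Ideal (MonoidAlgebra ℤ G) :=
  RingHom.ker (MonoidAlgebra.mapDomainRingHom ℤ (QuotientGroup.mk' I))

theorem mapDomainRingHom_surjective (I : Subgroup G) :
    Function.Surjective (MonoidAlgebra.mapDomainRingHom ℤ (QuotientGroup.mk' I)) := by
  intro y
  induction y using MonoidAlgebra.induction_linear with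
  | zero => exact ⟨0, map_zero _⟩
  | add a b ha hb =>
    obtain ⟨a', rfl⟩ := ha
    obtain ⟨b', rfl⟩ := hb
    exact ⟨a' + b', map_add _ _ _⟩
  | single g n =>
    obtain ⟨g', rfl⟩ := QuotientGroup.mk'_surjective I g
    exact ⟨MonoidAlgebra.single g' n, MonoidAlgebra.mapDomain_single⟩

theorem mapDomainRingHom_gp (I : Subgroup G) (g : G) :
    MonoidAlgebra.mapDomainRingHom ℤ (QuotientGroup.mk' I) (gp g) = gp (g : G ⧸ I) :=
  MonoidAlgebra.mapDomain_single

theorem gp_mul (g h : G) : gp (g * h) = gp g * gp h := map_mul _ _ _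

theorem gp_pow (g : G) (n : ℕ) : gp (g ^ n) = gp g ^ n := map_pow _ _ _

theorem gp_one : gp (1 : G) = 1 := map_one _

theorem gp_sub_gp_mem_augIdeal {I : Subgroup G} {g h : G} (hgh : (g : G ⧸ I) = h) :
    gp g - gp h ∈ augIdeal I := by
  rw [augIdeal, RingHom.mem_ker, map_sub, mapDomainRingHom_gp, mapDomainRingHom_gp, hgh, sub_self]

theorem gp_sub_one_mem_augIdeal {I : Subgroup G} {g : G} (hg : g ∈ I) :
    gp g - 1 ∈ augIdeal I := by
  rw [← gp_one]
  exact gp_sub_gp_mem_augIdeal ((QuotientGroup.eq_one_iff g).2 hg)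

theorem augIdeal_mono {I J : Subgroup G} (h : I ≤ J) : augIdeal I ≤ augIdeal J := by
  have hcomp : MonoidAlgebra.mapDomainRingHom ℤ (QuotientGroup.mk' J) =
      (MonoidAlgebra.mapDomainRingHom ℤ (QuotientGroup.map I J (MonoidHom.id G) h)).comp
        (MonoidAlgebra.mapDomainRingHom ℤ (QuotientGroup.mk' I)) := by
    rw [← MonoidAlgebra.mapDomainRingHom_comp]
    rfl
  intro x hx
  rw [augIdeal, RingHom.mem_ker] at hx ⊢
  rw [hcomp, RingHom.comp_apply, hx, map_zero]

theorem augIdeal_eq_span (I : Subgroup G) :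
    augIdeal I = Ideal.span {x | ∃ g ∈ I, x = gp g - 1} := by
  apply le_antisymm
  · let s : G ⧸ I → G := Quotient.out
    have hs : ∀ g, (s g : G ⧸ I) = g := fun g => QuotientGroup.out_eq' g
    have key : ∀ x : MonoidAlgebra ℤ G,
        x - MonoidAlgebra.mapDomain s (MonoidAlgebra.mapDomainRingHom ℤ (QuotientGroup.mk' I) x) ∈
          Ideal.span {x | ∃ g ∈ I, x = gp g - 1} := by
      intro x
      induction x using MonoidAlgebra.induction_linear with
      | zero => simp
      | add a b ha hb =>
        rw [map_add, MonoidAlgebra.mapDomain_add, add_sub_add_comm]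
        exact add_mem ha hb
      | single g n =>
        have h1 : MonoidAlgebra.mapDomainRingHom ℤ (QuotientGroup.mk' I)
            (MonoidAlgebra.single g n) = MonoidAlgebra.single (g : G ⧸ I) n :=
          MonoidAlgebra.mapDomain_single
        rw [h1, MonoidAlgebra.mapDomain_single]
        have h2 : (s (g : G ⧸ I))⁻¹ * g ∈ I := QuotientGroup.eq.1 (hs g)
        have h3 : MonoidAlgebra.single g n - MonoidAlgebra.single (s (g : G ⧸ I)) n =
            MonoidAlgebra.single (s (g : G ⧸ I)) n * (gp ((s (g : G ⧸ I))⁻¹ * g) - 1) := by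
          rw [mul_sub, mul_one, gp, MonoidAlgebra.of_apply, MonoidAlgebra.single_mul_single,
            mul_inv_cancel_left, mul_one]
        rw [h3]
        exact Ideal.mul_mem_left _ _ (Ideal.subset_span ⟨_, h2, rfl⟩)
    intro x hx
    have h := key x
    rw [augIdeal, RingHom.mem_ker] at hx
    rwa [hx, MonoidAlgebra.mapDomain_zero, sub_zero] at h
  · rw [Ideal.span_le]
    rintro x ⟨g, hg, rfl⟩
    exact gp_sub_one_mem_augIdeal hg

theorem intCast_mem_nonZeroDivisors {n : ℤ} (hn : n ≠ 0) :
    (n : MonoidAlgebra ℤ G) ∈ (MonoidAlgebra ℤ G)⁰ := by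
  rw [mem_nonZeroDivisors_iff_right]
  intro x hx
  rw [mul_comm, ← zsmul_eq_mul] at hx
  exact (smul_eq_zero.1 hx).resolve_left hn

variable [Finite G]

/-- The norm element `∑ k ∈ K, k` of `ℤ[G]`. -/
def normElt (K : Subgroup G) : MonoidAlgebra ℤ G :=
  letI := Fintype.ofFinite K
  ∑ k : K, gp (k : G)

theorem normElt_eq (K : Subgroup G) [Fintype K] : normElt K = ∑ k : K, gp (k : G) := by
  rw [normElt]
  congr!

theorem gp_mul_normElt {K : Subgroup G} {k : G} (hk : k ∈ K) :
    gp k * normElt K = normElt K := by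
  let := Fintype.ofFinite K
  rw [normElt_eq, Finset.mul_sum]
  simp_rw [← gp_mul]
  exact Fintype.sum_equiv (Equiv.mulLeft (⟨k, hk⟩ : K)) _ _ (fun _ => rfl)

theorem mul_normElt_of_mem {K : Subgroup G} {x : MonoidAlgebra ℤ G} (hx : x ∈ augIdeal K) :
    x * normElt K = 0 := by
  rw [augIdeal_eq_span] at hx
  induction hx using Submodule.span_induction with
  | mem x h =>
    obtain ⟨g, hg, rfl⟩ := h
    rw [sub_mul, one_mul, gp_mul_normElt hg, sub_self]
  | zero => rw [zero_mul]
  | add a b _ _ ha hb => rw [add_mul, ha, hb, add_zero]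
  | smul a b _ hb => rw [smul_eq_mul, mul_assoc, hb, mul_zero]

theorem normElt_sub_card_mem (K : Subgroup G) :
    normElt K - (Nat.card K : MonoidAlgebra ℤ G) ∈ augIdeal K := by
  let := Fintype.ofFinite K
  rw [augIdeal, RingHom.mem_ker, map_sub, normElt_eq, map_sum, map_natCast, sub_eq_zero]
  have h : ∀ k : K, MonoidAlgebra.mapDomainRingHom ℤ (QuotientGroup.mk' K) (gp (k : G)) = 1 := by
    intro k
    rw [mapDomainRingHom_gp, (QuotientGroup.eq_one_iff (k : G)).2 k.2, gp_one]
  rw [Finset.sum_congr rfl (fun k _ => h k), Finset.sum_const, Finset.card_univ,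
    ← Nat.card_eq_fintype_card, nsmul_eq_mul, mul_one]

theorem natCast_sub_gp_mem_nonZeroDivisors {q : ℕ} (hq : 2 ≤ q) (g : G) :
    (q : MonoidAlgebra ℤ G) - gp g ∈ (MonoidAlgebra ℤ G)⁰ := by
  have hm : orderOf g ≠ 0 := (orderOf_pos g).ne'
  have h1 : (q : MonoidAlgebra ℤ G) ^ orderOf g - gp g ^ orderOf g =
      (((q : ℤ) ^ orderOf g - 1 : ℤ) : MonoidAlgebra ℤ G) := by
    rw [← gp_pow, pow_orderOf_eq_one, gp_one]
    push_cast
    rfl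
  have h2 : ((q : ℤ) ^ orderOf g - 1 : ℤ) ≠ 0 := by
    have h3 : 1 < q ^ orderOf g := Nat.one_lt_pow hm (by omega)
    have h4 : (1 : ℤ) < (q : ℤ) ^ orderOf g := by exact_mod_cast h3
    omega
  have h3 := intCast_mem_nonZeroDivisors (G := G) h2
  rw [← h1, ← geom_sum₂_mul] at h3
  exact (mul_mem_nonZeroDivisors.1 h3).2

theorem mem_augIdeal_of_natCast_sub_gp_mul_mem (I : Subgroup G) {q : ℕ} (hq : 2 ≤ q) (g : G)
    {r : MonoidAlgebra ℤ G} (hr : ((q : MonoidAlgebra ℤ G) - gp g) * r ∈ augIdeal I) :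
    r ∈ augIdeal I := by
  rw [augIdeal, RingHom.mem_ker] at hr ⊢
  rw [map_mul, map_sub, map_natCast, mapDomainRingHom_gp] at hr
  exact (mul_left_mem_nonZeroDivisors_eq_zero_iff
    (natCast_sub_gp_mem_nonZeroDivisors hq (g : G ⧸ I))).1 hr

end NormElements

/-! ### Independence of the shift class of `A_{I,φ}` of the auxiliary choices -/

section ShiftClasses

variable {Γ : Type u} [CommGroup Γ]

/-- The ideal of `ℤ[Γ]` with quotient `ℤ[Γ/I] / (1 + #Γ - φ)`. -/
def relIdeal (I : Subgroup Γ) (φ : Γ) : Ideal (MonoidAlgebra ℤ Γ) :=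
  augIdeal I ⊔ Ideal.span {((1 + Nat.card Γ : ℕ) : MonoidAlgebra ℤ Γ) - gp φ}

theorem relIdeal_congr {I : Subgroup Γ} {φ ψ : Γ} (h : (φ : Γ ⧸ I) = ψ) :
    relIdeal I φ = relIdeal I ψ := by
  have key : ∀ {φ ψ : Γ}, (φ : Γ ⧸ I) = ψ → relIdeal I φ ≤ relIdeal I ψ := by
    intro φ ψ h
    refine sup_le le_sup_left ((Ideal.span_singleton_le_iff_mem _).2 ?_)
    have h1 : ((1 + Nat.card Γ : ℕ) : MonoidAlgebra ℤ Γ) - gp φ =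
      (gp ψ - gp φ) + (((1 + Nat.card Γ : ℕ) : MonoidAlgebra ℤ Γ) - gp ψ) := by ring
    rw [h1]
    exact add_mem (Ideal.mem_sup_left (gp_sub_gp_mem_augIdeal h.symm))
      (Ideal.mem_sup_right (Ideal.mem_span_singleton_self _))
  exact le_antisymm (key h) (key h.symm)

variable [Finite Γ]

instance : IsNoetherianRing (MonoidAlgebra ℤ Γ) := by
  have : Module.Finite ℤ (MonoidAlgebra ℤ Γ) := inferInstance
  exact isNoetherian_of_tower ℤ inferInstance

/-- The class of the shift of `ℤ[Γ/I] / (z + #I u)` is independent of `u`: the element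
`z + #I v + (u - v) N_I` acts as `z + #I u` on `ℤ[Γ/I]` and as `z + #I v` on the kernel of
`ℤ[Γ] → ℤ[Γ/I]`. -/
theorem shiftClass_add_card_mul (I : Subgroup Γ) (z u v : MonoidAlgebra ℤ Γ)
    (hu : ∀ r, (z + Nat.card I * u) * r ∈ augIdeal I → r ∈ augIdeal I)
    (hv : ∀ r, (z + Nat.card I * v) * r ∈ augIdeal I → r ∈ augIdeal I)
    (hv0 : z + Nat.card I * v ∈ (MonoidAlgebra ℤ Γ)⁰)
    (hex : ∃ a ∈ augIdeal I ⊔ Ideal.span {z + Nat.card I * u}, a ∈ (MonoidAlgebra ℤ Γ)⁰)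
    (hex' : ∃ a ∈ augIdeal I ⊔ Ideal.span {z + Nat.card I * v}, a ∈ (MonoidAlgebra ℤ Γ)⁰) :
    shiftClass (cyclicModule _ hex) = shiftClass (cyclicModule _ hex') := by
  set h : MonoidAlgebra ℤ Γ := z + Nat.card I * v + (u - v) * normElt I with hh
  have hsub : h - (z + Nat.card I * u) ∈ augIdeal I := by
    have h1 : h - (z + Nat.card I * u) = (u - v) * (normElt I - Nat.card I) := by
      rw [hh]; ring
    rw [h1]
    exact Ideal.mul_mem_left _ _ (normElt_sub_card_mem I)
  have hact : ∀ x ∈ augIdeal I, h * x = (z + Nat.card I * v) * x := by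
    intro x hx
    have h1 := mul_normElt_of_mem hx
    rw [hh]
    linear_combination (u - v) * h1
  have hJ : ∀ r, h * r ∈ augIdeal I → r ∈ augIdeal I := by
    intro r hr
    apply hu
    have h1 : (z + Nat.card I * u) * r = h * r - (h - (z + Nat.card I * u)) * r := by ring
    rw [h1]
    exact sub_mem hr (Ideal.mul_mem_right _ _ hsub)
  have hreg : h ∈ (MonoidAlgebra ℤ Γ)⁰ := by
    rw [mem_nonZeroDivisors_iff_right]
    intro r hr
    rw [mul_comm] at hr
    have h1 : r ∈ augIdeal I := hJ r (by rw [hr]; exact zero_mem _)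
    rw [hact r h1] at hr
    exact (mul_left_mem_nonZeroDivisors_eq_zero_iff hv0).1 hr
  have hideal : augIdeal I ⊔ Ideal.span {z + Nat.card I * u} = augIdeal I ⊔ Ideal.span {h} := by
    apply le_antisymm
    · refine sup_le le_sup_left ((Ideal.span_singleton_le_iff_mem _).2 ?_)
      have h1 : z + Nat.card I * u = -(h - (z + Nat.card I * u)) + h := by ring
      rw [h1]
      exact add_mem (Ideal.mem_sup_left (neg_mem hsub))
        (Ideal.mem_sup_right (Ideal.mem_span_singleton_self h))
    · refine sup_le le_sup_left ((Ideal.span_singleton_le_iff_mem _).2 ?_)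
      have h1 : h = (h - (z + Nat.card I * u)) + (z + Nat.card I * u) := by ring
      rw [h1]
      exact add_mem (Ideal.mem_sup_left hsub)
        (Ideal.mem_sup_right (Ideal.mem_span_singleton_self _))
  have hexh : ∃ a ∈ augIdeal I ⊔ Ideal.span {h}, a ∈ (MonoidAlgebra ℤ Γ)⁰ :=
    ⟨h, Ideal.mem_sup_right (Ideal.mem_span_singleton_self h), hreg⟩
  rw [shiftClass_cyclicModule_congr hideal hex hexh]
  exact shiftClass_eq_of_mul_eq _ hreg hv0 hJ hv hact hexh hex'

/-- If `θ` is regular and `#I` is invertible in `ℤ[Γ/I] / θ`, then `ℤ[Γ/I] / θ` is a direct summand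
of `ℤ[Γ] / θ`, cut out by the idempotent `N_I / #I`. -/
theorem memP_of_card_invertible (I : Subgroup Γ) {θ b : MonoidAlgebra ℤ Γ}
    (hθ : θ ∈ (MonoidAlgebra ℤ Γ)⁰)
    (hb : Nat.card I * b - 1 ∈ augIdeal I ⊔ Ideal.span {θ}) :
    MemP (MonoidAlgebra ℤ Γ) (MonoidAlgebra ℤ Γ ⧸ (augIdeal I ⊔ Ideal.span {θ})) := by
  have hle : augIdeal I ⊔ Ideal.span {θ} ≤
      Submodule.comap (LinearMap.mulLeft (MonoidAlgebra ℤ Γ) (b * normElt I)) (Ideal.span {θ}) := by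
    refine sup_le ?_ ?_
    · intro x hx
      change b * normElt I * x ∈ Ideal.span {θ}
      rw [mul_assoc, mul_comm _ x, mul_normElt_of_mem hx, mul_zero]
      exact zero_mem _
    · intro x hx
      exact Ideal.mul_mem_left _ _ hx
  have hle' : Ideal.span {θ} ≤ augIdeal I ⊔ Ideal.span {θ} := le_sup_right
  refine (memP_quotient_span hθ).of_retract (Submodule.mapQ _ _ _ hle)
    (Submodule.factor hle') ?_
  apply LinearMap.ext
  intro x
  obtain ⟨r, rfl⟩ := Submodule.mkQ_surjective _ x
  change (Submodule.Quotient.mk (b * normElt I * r) : _ ⧸ (augIdeal I ⊔ Ideal.span {θ})) =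
    Submodule.Quotient.mk r
  rw [Submodule.Quotient.eq]
  have h1 : b * normElt I * r - r =
      (b * r) * (normElt I - Nat.card I) + r * (Nat.card I * b - 1) := by ring
  rw [h1]
  exact add_mem (Ideal.mul_mem_left _ _ (Ideal.mem_sup_left (normElt_sub_card_mem I)))
    (Ideal.mul_mem_left _ _ hb)

theorem two_le_one_add_card : 2 ≤ 1 + Nat.card Γ := by
  have : 0 < Nat.card Γ := Nat.card_pos
  omega

theorem exists_regular_relIdeal (I : Subgroup Γ) (φ : Γ) :
    ∃ g ∈ relIdeal I φ, g ∈ (MonoidAlgebra ℤ Γ)⁰ :=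
  ⟨_, Ideal.mem_sup_right (Ideal.mem_span_singleton_self _),
    natCast_sub_gp_mem_nonZeroDivisors two_le_one_add_card φ⟩

/-- The module `ℤ[Γ/I] / (1 + #Γ - φ)`. Its shift has the same class as that of `A_{I,φ⁻¹}`, and
the constant `1 + #Γ` serves all subgroups `I` at once. -/
def relModule (I : Subgroup Γ) (φ : Γ) : TorsionModule (MonoidAlgebra ℤ Γ) :=
  cyclicModule (relIdeal I φ) (exists_regular_relIdeal I φ)

theorem exists_isShift_relModule (I : Subgroup Γ) (φ : Γ) : ∃ Y, IsShift (relModule I φ) Y :=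
  exists_isShift_cyclicModule _ _

theorem shiftClass_natCast_sub (I : Subgroup Γ) (φ : Γ) (q : ℕ) (hq : 2 ≤ q)
    (hqI : Nat.card I ∣ q - 1)
    (hex : ∃ a ∈ augIdeal I ⊔ Ideal.span {(q : MonoidAlgebra ℤ Γ) - gp φ},
      a ∈ (MonoidAlgebra ℤ Γ)⁰) :
    shiftClass (cyclicModule _ hex) = shiftClass (relModule I φ) := by
  obtain ⟨u, hu⟩ := hqI
  obtain ⟨v, hv⟩ := I.card_subgroup_dvd_card
  have hq' : (q : MonoidAlgebra ℤ Γ) - gp φ =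
      (1 - gp φ) + Nat.card I * (u : MonoidAlgebra ℤ Γ) := by
    have h1 : q = Nat.card I * u + 1 := by omega
    rw [h1]
    push_cast
    ring
  have hv' : ((1 + Nat.card Γ : ℕ) : MonoidAlgebra ℤ Γ) - gp φ =
      (1 - gp φ) + Nat.card I * (v : MonoidAlgebra ℤ Γ) := by
    rw [hv]
    push_cast
    ring
  have e1 : augIdeal I ⊔ Ideal.span {(q : MonoidAlgebra ℤ Γ) - gp φ} =
    augIdeal I ⊔ Ideal.span {(1 - gp φ) + Nat.card I * (u : MonoidAlgebra ℤ Γ)} := by rw [hq']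
  have e2 : relIdeal I φ =
    augIdeal I ⊔ Ideal.span {(1 - gp φ) + Nat.card I * (v : MonoidAlgebra ℤ Γ)} := by
    rw [relIdeal, hv']
  rw [relModule, shiftClass_cyclicModule_congr e1 hex (e1 ▸ hex),
    shiftClass_cyclicModule_congr e2 (exists_regular_relIdeal I φ)
      (e2 ▸ exists_regular_relIdeal I φ)]
  apply shiftClass_add_card_mul
  · intro r hr
    rw [← hq'] at hr
    exact mem_augIdeal_of_natCast_sub_gp_mul_mem I hq φ hr
  · intro r hr
    rw [← hv'] at hr
    exact mem_augIdeal_of_natCast_sub_gp_mul_mem I two_le_one_add_card φ hr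
  · rw [← hv']
    exact natCast_sub_gp_mem_nonZeroDivisors two_le_one_add_card φ

/-- The annihilator of `A_{I,φ}` and the presentation of `A_{I,φ}` as a cyclic module. -/
theorem moduleA_equiv (I : Subgroup Γ) (φ : Γ) :
    ∃ hex : ∃ a ∈ augIdeal I ⊔ Ideal.span {((1 + Nat.card I : ℕ) : MonoidAlgebra ℤ Γ) - gp φ},
      a ∈ (MonoidAlgebra ℤ Γ)⁰,
    Nonempty (moduleA I ((φ : Γ ⧸ I)⁻¹) ≃ₗ[MonoidAlgebra ℤ Γ] cyclicModule _ hex) := by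
  have hc : 2 ≤ 1 + Nat.card I := by
    have : 0 < Nat.card I := Nat.card_pos
    omega
  refine ⟨⟨_, Ideal.mem_sup_right (Ideal.mem_span_singleton_self _),
    natCast_sub_gp_mem_nonZeroDivisors hc φ⟩, ⟨?_⟩⟩
  let f : MonoidAlgebra ℤ Γ →ₗ[MonoidAlgebra ℤ Γ] ACarrier I ((φ : Γ ⧸ I)⁻¹) :=
    { toFun := AProj I _
      map_add' := map_add _
      map_smul' := fun r x => map_mul _ r x }
  have hg : MonoidAlgebra.mapDomainRingHom ℤ (QuotientGroup.mk' I)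
      (((1 + Nat.card I : ℕ) : MonoidAlgebra ℤ Γ) - gp φ) = gElt I ((φ : Γ ⧸ I)⁻¹) := by
    rw [map_sub, map_natCast, mapDomainRingHom_gp, gElt, inv_inv]
    push_cast
    ring
  have hk : augIdeal I ⊔ Ideal.span {((1 + Nat.card I : ℕ) : MonoidAlgebra ℤ Γ) - gp φ} =
      LinearMap.ker f := by
    ext x
    have h1 : x ∈ LinearMap.ker f ↔ MonoidAlgebra.mapDomainRingHom ℤ (QuotientGroup.mk' I) x ∈
        Ideal.span {gElt I ((φ : Γ ⧸ I)⁻¹)} := Ideal.Quotient.eq_zero_iff_mem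
    have h2 := Ideal.map_span (MonoidAlgebra.mapDomainRingHom ℤ (QuotientGroup.mk' I))
      {((1 + Nat.card I : ℕ) : MonoidAlgebra ℤ Γ) - gp φ}
    rw [Set.image_singleton, hg] at h2
    rw [h1, ← h2, ← Ideal.mem_comap,
      Ideal.comap_map_of_surjective' _ (mapDomainRingHom_surjective I), sup_comm]
    rfl
  exact ((Submodule.quotEquivOfEq _ _ hk).trans
    (f.quotKerEquivOfSurjective (AProj_surjective I _))).symm

theorem shiftClass_moduleA (I : Subgroup Γ) (φ : Γ) :
    shiftClass (moduleA I ((φ : Γ ⧸ I)⁻¹)) = shiftClass (relModule I φ) := by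
  have hc : 0 < Nat.card I := Nat.card_pos
  obtain ⟨hex, ⟨e⟩⟩ := moduleA_equiv I φ
  rw [shiftClass_congr e]
  exact shiftClass_natCast_sub I φ _ (by omega) (by simp) hex

theorem exists_isShift_moduleA (I : Subgroup Γ) (φ : Γ ⧸ I) : ∃ Y, IsShift (moduleA I φ) Y := by
  obtain ⟨ψ, hψ⟩ := QuotientGroup.mk_surjective φ⁻¹
  obtain ⟨hex, ⟨e⟩⟩ := moduleA_equiv I ψ
  rw [hψ, inv_inv] at e
  obtain ⟨Y, hY⟩ := exists_isShift_cyclicModule _ hex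
  exact ⟨Y, hY.of_equiv e.symm⟩

/-- Two generators of the same subgroup are powers of each other, with an exponent that can be
taken prime to any multiple of their order. -/
theorem exists_coprime_pow_eq {G : Type*} [Group G] [Finite G] {x y : G}
    (h : Subgroup.zpowers x = Subgroup.zpowers y) {n : ℕ} (hn : n ≠ 0) (hd : orderOf x ∣ n) :
    ∃ k : ℕ, k.Coprime n ∧ 1 ≤ k ∧ x ^ k = y := by
  have hy : y ∈ Submonoid.powers x :=
    mem_powers_iff_mem_zpowers.2 (h ▸ Subgroup.mem_zpowers y)
  obtain ⟨j, rfl⟩ := hy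
  have hord : orderOf (x ^ j) = orderOf x := by
    rw [← Nat.card_zpowers, ← Nat.card_zpowers, h]
  have hpos : 0 < orderOf x := orderOf_pos x
  have hj : j.Coprime (orderOf x) := by
    rw [orderOf_pow] at hord
    have h1 := Nat.div_mul_cancel (Nat.gcd_dvd_left (orderOf x) j)
    rw [hord] at h1
    rw [Nat.coprime_comm]
    exact Nat.eq_of_mul_eq_mul_left hpos (by rw [h1, mul_one])
  have : NeZero n := ⟨hn⟩
  obtain ⟨w, hw⟩ := ZMod.unitsMap_surjective hd (ZMod.unitOfCoprime j hj)
  refine ⟨(w : ZMod n).val + n, ?_, by omega, ?_⟩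
  · rw [Nat.coprime_add_self_left]
    exact ZMod.val_coe_unit_coprime w
  · have h1 : (((w : ZMod n).val + n : ℕ) : ZMod (orderOf x)) = (j : ZMod (orderOf x)) := by
      have h2 := congrArg Units.val hw
      rw [ZMod.unitsMap_val, ZMod.coe_unitOfCoprime, ← ZMod.natCast_val] at h2
      rw [Nat.cast_add, h2, (ZMod.natCast_eq_zero_iff n (orderOf x)).2 hd, add_zero]
    exact pow_eq_pow_iff_modEq.2 ((ZMod.natCast_eq_natCast_iff _ _ _).1 h1)

theorem geom_sum_mul_of_pow_eq_one {S : Type*} [CommRing S] {x : S} {n : ℕ} (hx : x ^ n = 1)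
    (m : ℕ) : ∑ j ∈ Finset.range (n * m), x ^ j = m * ∑ j ∈ Finset.range n, x ^ j := by
  induction m with
  | zero => simp
  | succ m ih =>
    have h1 : ∀ j, x ^ (n * m + j) = x ^ j := fun j => by
      rw [pow_add, pow_mul, hx, one_pow, one_mul]
    rw [Nat.mul_succ, Finset.sum_range_add, ih]
    simp_rw [h1]
    push_cast
    ring

/-- If `x ^ n = 1`, `n = 0` and `q = 1` in `S`, and `k` is prime to `n`, then `∑ q ^ i x ^ (k-1-i)`
is a unit of `S`: the sums for `x, k` and `x ^ k, k'` multiply to the sum for `x, k k'`. -/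
theorem exists_geom_sum_mul_eq_one {S : Type*} [CommRing S] {x : S} {n : ℕ} (hx : x ^ n = 1)
    (hn : (n : S) = 0) {k : ℕ} (hk : k.Coprime n) (hk1 : 1 ≤ k) :
    ∃ j, (∑ i ∈ Finset.range k, x ^ i) * ∑ i ∈ Finset.range j, (x ^ k) ^ i = 1 := by
  -- The exponent `k * j` is chosen congruent to `1` modulo `n ^ 2`.
  have hcop : k.Coprime (n * n) := Nat.Coprime.mul_right hk hk
  by_cases hn0 : n = 0
  · subst hn0
    obtain rfl : k = 1 := by simpa using hk
    exact ⟨1, by simp⟩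
  have htot : 0 < (n * n).totient := Nat.totient_pos.2 (by positivity)
  have hmod := Nat.ModEq.pow_totient hcop
  have hge : 1 ≤ k ^ (n * n).totient := Nat.one_le_pow _ _ hk1
  obtain ⟨w, hw⟩ := (Nat.modEq_iff_dvd' hge).1 hmod.symm
  refine ⟨k ^ ((n * n).totient - 1), ?_⟩
  have h1 : k * k ^ ((n * n).totient - 1) = n * (n * w) + 1 := by
    rw [← pow_succ', Nat.sub_add_cancel htot]
    rw [← mul_assoc]
    omega
  have h2 : ∀ j, (∑ i ∈ Finset.range k, x ^ i) * ∑ i ∈ Finset.range j, (x ^ k) ^ i =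
      ∑ i ∈ Finset.range (k * j), x ^ i := by
    intro j
    induction j with
    | zero => simp
    | succ j ih =>
      rw [Finset.sum_range_succ, mul_add, ih, Nat.mul_succ, Finset.sum_range_add]
      congr 1
      rw [Finset.sum_mul]
      exact Finset.sum_congr rfl fun i _ => by ring
  rw [h2, h1, Finset.sum_range_succ, geom_sum_mul_of_pow_eq_one hx]
  push_cast
  rw [hn, pow_mul, hx, one_pow]
  ring

/-- The class of the shift of `ℤ[Γ/I] / (1 + #Γ - φ)` depends only on `I` and on the subgroup
generated by `I` and `φ`. With `ψ = φ ^ k` modulo `I`, the kernel of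
`ℤ[Γ/I] / (q ^ k - φ ^ k) → ℤ[Γ/I] / (q - φ)` is `ℤ[Γ/I] / θ` with `θ` invertible modulo `#Γ`. -/
theorem shiftClass_relModule_eq (I : Subgroup Γ) (φ ψ : Γ)
    (h : I ⊔ Subgroup.zpowers φ = I ⊔ Subgroup.zpowers ψ) :
    shiftClass (relModule I φ) = shiftClass (relModule I ψ) := by
  set n := Nat.card Γ with hn
  have hn0 : n ≠ 0 := Nat.card_pos.ne'
  have hz : Subgroup.zpowers (φ : Γ ⧸ I) = Subgroup.zpowers (ψ : Γ ⧸ I) := by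
    have h1 := congrArg (Subgroup.map (QuotientGroup.mk' I)) h
    rwa [Subgroup.map_sup, Subgroup.map_sup, QuotientGroup.map_mk'_self, bot_sup_eq, bot_sup_eq,
      MonoidHom.map_zpowers, MonoidHom.map_zpowers] at h1
  have hdiv : orderOf (φ : Γ ⧸ I) ∣ n :=
    (orderOf_map_dvd (QuotientGroup.mk' I) φ).trans (orderOf_dvd_natCard φ)
  obtain ⟨k, hkn, hk1, hk⟩ := exists_coprime_pow_eq hz hn0 hdiv
  set q : ℕ := 1 + n with hq
  have hq2 : 2 ≤ q := two_le_one_add_card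
  have hqk : 2 ≤ q ^ k := hq2.trans (Nat.le_self_pow (by omega) q)
  let θ : MonoidAlgebra ℤ Γ :=
    ∑ i ∈ Finset.range k, (q : MonoidAlgebra ℤ Γ) ^ i * gp φ ^ (k - 1 - i)
  have hθmul : θ * ((q : MonoidAlgebra ℤ Γ) - gp φ) =
      ((q ^ k : ℕ) : MonoidAlgebra ℤ Γ) - gp (φ ^ k) := by
    rw [geom_sum₂_mul, gp_pow]
    push_cast
    rfl
  have hθ : θ ∈ (MonoidAlgebra ℤ Γ)⁰ := by
    have h1 := natCast_sub_gp_mem_nonZeroDivisors hqk (φ ^ k)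
    rw [← hθmul] at h1
    exact (mul_mem_nonZeroDivisors.1 h1).1
  obtain ⟨v, hv⟩ := I.card_subgroup_dvd_card
  rw [← hn] at hv
  have hb : ∃ b : MonoidAlgebra ℤ Γ, Nat.card I * b - 1 ∈ augIdeal I ⊔ Ideal.span {θ} := by
    let S := MonoidAlgebra ℤ Γ ⧸ Ideal.span {(n : MonoidAlgebra ℤ Γ)}
    let π : MonoidAlgebra ℤ Γ →+* S := Ideal.Quotient.mk _
    have hnS : (n : S) = 0 := by
      rw [← map_natCast π]
      exact Ideal.Quotient.eq_zero_iff_mem.2 (Ideal.mem_span_singleton_self _)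
    have hxS : π (gp φ) ^ n = 1 := by
      have h1 : φ ^ n = 1 := pow_card_eq_one'
      rw [← map_pow, ← gp_pow, h1, gp_one, map_one]
    obtain ⟨j, hj⟩ := exists_geom_sum_mul_eq_one hxS hnS hkn hk1
    have hπθ : π θ = ∑ i ∈ Finset.range k, π (gp φ) ^ i := by
      rw [map_sum, ← Finset.sum_range_reflect]
      refine Finset.sum_congr rfl fun i hi => ?_
      have hi' : k - 1 - (k - 1 - i) = i := by
        have := Finset.mem_range.1 hi
        omega
      rw [map_mul, map_pow, map_natCast, hq]
      push_cast
      rw [hnS, add_zero, one_pow, one_mul, map_pow, hi']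
    let η : MonoidAlgebra ℤ Γ := ∑ i ∈ Finset.range j, (gp φ ^ k) ^ i
    have h1 : π (1 - θ * η) = 0 := by
      rw [map_sub, map_one, map_mul, hπθ, map_sum]
      simp_rw [map_pow]
      rw [hj, sub_self]
    obtain ⟨c, hc⟩ := Ideal.mem_span_singleton.1 (Ideal.Quotient.eq_zero_iff_mem.1 h1)
    refine ⟨v * c, Ideal.mem_sup_right (Ideal.mem_span_singleton.2 ⟨-η, ?_⟩)⟩
    have h2 : (n : MonoidAlgebra ℤ Γ) = Nat.card I * v := by rw [hv]; push_cast; rfl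
    rw [h2] at hc
    linear_combination -hc
  obtain ⟨b, hb⟩ := hb
  have hP := memP_of_card_invertible I hθ hb
  let 𝔞 : Ideal (MonoidAlgebra ℤ Γ) :=
    augIdeal I ⊔ Ideal.span {((q ^ k : ℕ) : MonoidAlgebra ℤ Γ) - gp (φ ^ k)}
  have hex : ∃ a ∈ 𝔞, a ∈ (MonoidAlgebra ℤ Γ)⁰ :=
    ⟨_, Ideal.mem_sup_right (Ideal.mem_span_singleton_self _),
      natCast_sub_gp_mem_nonZeroDivisors hqk _⟩
  have hle : 𝔞 ≤ relIdeal I φ := by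
    refine sup_le le_sup_left ((Ideal.span_singleton_le_iff_mem _).2 ?_)
    rw [← hθmul]
    exact Ideal.mul_mem_left _ _ (Ideal.mem_sup_right (Ideal.mem_span_singleton_self _))
  let π : (MonoidAlgebra ℤ Γ ⧸ 𝔞) →ₗ[MonoidAlgebra ℤ Γ] (MonoidAlgebra ℤ Γ ⧸ relIdeal I φ) :=
    Submodule.factor hle
  have hker : MemP (MonoidAlgebra ℤ Γ) (LinearMap.ker π) := by
    let f : MonoidAlgebra ℤ Γ →ₗ[MonoidAlgebra ℤ Γ] (MonoidAlgebra ℤ Γ ⧸ 𝔞) :=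
      Submodule.mkQ 𝔞 ∘ₗ LinearMap.mulLeft _ ((q : MonoidAlgebra ℤ Γ) - gp φ)
    have hf1 : LinearMap.range f = LinearMap.ker π := by
      ext z
      obtain ⟨r, rfl⟩ := Submodule.mkQ_surjective _ z
      rw [LinearMap.mem_ker]
      change _ ↔ (Submodule.Quotient.mk r : MonoidAlgebra ℤ Γ ⧸ relIdeal I φ) = 0
      rw [Submodule.Quotient.mk_eq_zero]
      constructor
      · rintro ⟨c, hc⟩
        have h1 : ((q : MonoidAlgebra ℤ Γ) - gp φ) * c - r ∈ 𝔞 := (Submodule.Quotient.eq _).1 hc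
        have h2 : r = c * ((q : MonoidAlgebra ℤ Γ) - gp φ) -
          (((q : MonoidAlgebra ℤ Γ) - gp φ) * c - r) := by ring
        rw [h2]
        exact sub_mem (Ideal.mul_mem_left _ _
          (Ideal.mem_sup_right (Ideal.mem_span_singleton_self _))) (hle h1)
      · intro hr
        obtain ⟨x, hx, s, hs, rfl⟩ := Submodule.mem_sup.1 hr
        obtain ⟨c, rfl⟩ := Ideal.mem_span_singleton.1 hs
        refine ⟨c, (Submodule.Quotient.eq _).2 ?_⟩
        change ((q : MonoidAlgebra ℤ Γ) - gp φ) * c - (x + ((q : MonoidAlgebra ℤ Γ) - gp φ) * c) ∈ 𝔞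
        rw [sub_add_cancel_right]
        exact neg_mem (Ideal.mem_sup_left hx)
    have hf2 : LinearMap.ker f = augIdeal I ⊔ Ideal.span {θ} := by
      ext r
      rw [LinearMap.mem_ker]
      change (Submodule.Quotient.mk (((q : MonoidAlgebra ℤ Γ) - gp φ) * r) : _ ⧸ 𝔞) = 0 ↔ _
      rw [Submodule.Quotient.mk_eq_zero]
      constructor
      · intro hr
        obtain ⟨x, hx, s, hs, hxs⟩ := Submodule.mem_sup.1 hr
        obtain ⟨c, rfl⟩ := Ideal.mem_span_singleton.1 hs
        rw [← hθmul] at hxs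
        have h1 : r - θ * c ∈ augIdeal I := by
          apply mem_augIdeal_of_natCast_sub_gp_mul_mem I hq2 φ
          have h2 : ((q : MonoidAlgebra ℤ Γ) - gp φ) * (r - θ * c) = x := by
            linear_combination -hxs
          rwa [h2]
        have h3 : r = (r - θ * c) + θ * c := by ring
        rw [h3]
        exact add_mem (Ideal.mem_sup_left h1)
          (Ideal.mem_sup_right (Ideal.mem_span_singleton.2 ⟨c, rfl⟩))
      · intro hr
        obtain ⟨x, hx, s, hs, rfl⟩ := Submodule.mem_sup.1 hr
        obtain ⟨c, rfl⟩ := Ideal.mem_span_singleton.1 hs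
        rw [mul_add]
        refine add_mem (Ideal.mem_sup_left (Ideal.mul_mem_left _ _ hx))
          (Ideal.mem_sup_right (Ideal.mem_span_singleton.2 ⟨c, ?_⟩))
        rw [← hθmul]
        ring
    exact hP.of_equiv ((Submodule.quotEquivOfEq _ _ hf2.symm).trans
      (f.quotKerEquivRange.trans (LinearEquiv.ofEq _ _ hf1)))
  obtain ⟨Y, hY⟩ := exists_isShift_cyclicModule 𝔞 hex
  have h1 : shiftClass (cyclicModule 𝔞 hex) = shiftClass (relModule I φ) :=
    shiftClass_eq_of_surjective hY (X' := relModule I φ) π (Submodule.factor_surjective hle) hker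
  have hIq : Nat.card I ∣ q ^ k - 1 := by
    have h2 : q - 1 ∣ q ^ k - 1 := by simpa using Nat.sub_dvd_pow_sub_pow q 1 k
    have h3 : Nat.card I ∣ q - 1 := ⟨v, by rw [hq, hv]; omega⟩
    exact h3.trans h2
  have h2 := shiftClass_natCast_sub I (φ ^ k) (q ^ k) hqk hIq hex
  rw [← h1, h2]
  exact shiftClass_cyclicModule_congr (relIdeal_congr (by simpa using hk)) _ _

end ShiftClasses

/-! ### Components at maximal ideals -/

section Equivalence

variable {R : Type u} [CommRing R]

theorem cls_eq_of_exact_left {P : Type u} [AddCommGroup P] [Module R P] {N X : TorsionModule R}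
    (hP : MemP R P) (i : P →ₗ[R] N) (q : N →ₗ[R] X) (hi : Function.Injective i)
    (he : Function.Exact i q) (hq : Function.Surjective q) : cls X = cls N := by
  refine Quot.sound ⟨N, N, ⟨LinearMap.range i, ⊤, le_top, ?_, ?_, ⟨?_⟩⟩,
    isFilling_of_equiv (LinearEquiv.refl R N), ⟨LinearEquiv.refl R N⟩⟩
  · exact hP.of_equiv (LinearEquiv.ofInjective i hi)
  · have : Subsingleton (N ⧸ (⊤ : Submodule R N)) := Submodule.Quotient.subsingleton_iff.2 rfl
    exact memP_of_subsingleton _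
  · refine (((Submodule.Quotient.equiv _ _ Submodule.topEquiv ?_).trans
      (Submodule.quotEquivOfEq _ _ (LinearMap.exact_iff.1 he).symm)).trans
      (q.quotKerEquivOfSurjective hq)).symm
    rw [Submodule.submoduleOf]
    exact Submodule.map_comap_eq_of_surjective (f := Submodule.topEquiv.toLinearMap)
      Submodule.topEquiv.surjective _

/-- A submodule of an object of `𝒞` over a Noetherian ring. -/
def TorsionModule.sub [IsNoetherianRing R] (X : TorsionModule R) (K : Submodule R X) :
    TorsionModule R where
  carrier := K
  finite := by
    have := X.finite
    infer_instance
  torsion := by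
    rintro ⟨z, hz⟩
    obtain ⟨a, ha⟩ := @X.torsion z
    exact ⟨a, Subtype.ext ha⟩

/-- A function on `𝒞` that is unchanged by passing to the middle of a short exact sequence with
one end in `𝒫` is constant on the classes of `∼`. -/
theorem Equivalent.map_eq [IsNoetherianRing R] {S : Type*} (f : TorsionModule R → S)
    (hr : ∀ {Y N P : TorsionModule R} (i : Y →ₗ[R] N) (q : N →ₗ[R] P), MemP R P →
      Function.Injective i → Function.Exact i q → Function.Surjective q → f Y = f N)
    (hl : ∀ {P N X : TorsionModule R} (i : P →ₗ[R] N) (q : N →ₗ[R] X), MemP R P →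
      Function.Injective i → Function.Exact i q → Function.Surjective q → f X = f N)
    {X Y : TorsionModule R} (h : Equivalent X Y) : f X = f Y := by
  have hiso : ∀ {X Y : TorsionModule R}, (X ≃ₗ[R] Y) → f X = f Y := by
    intro X Y e
    refine hr (P := TorsionModule.zero) e.toLinearMap 0 (memP_of_subsingleton PUnit) e.injective
      (fun y => ⟨fun _ => e.surjective y, fun _ => rfl⟩) ?_
    intro y
    exact ⟨0, Subsingleton.elim (α := PUnit) _ _⟩
  have hfill : ∀ {X M : TorsionModule R}, IsFilling X M → f X = f M := by
    rintro X M ⟨M', M'', hle, h1, h2, ⟨e⟩⟩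
    let q : M'' →ₗ[R] X := e.symm.toLinearMap ∘ₗ (M'.submoduleOf M'').mkQ
    have hq : Function.Surjective q := e.symm.surjective.comp (Submodule.mkQ_surjective _)
    let i : M' →ₗ[R] M'' := Submodule.inclusion hle
    have he : Function.Exact i q := by
      intro z
      change e.symm ((M'.submoduleOf M'').mkQ z) = 0 ↔ _
      rw [LinearEquiv.map_eq_zero_iff, Submodule.mkQ_apply, Submodule.Quotient.mk_eq_zero]
      exact ⟨fun hz => ⟨⟨z, hz⟩, rfl⟩, fun ⟨y, hy⟩ => by rw [← hy]; exact y.2⟩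
    have e1 : f X = f (M.sub M'') :=
      hl (P := M.sub M') (N := M.sub M'') i q h1 (Submodule.inclusion_injective hle) he hq
    let Q : TorsionModule R := ⟨M ⧸ M'', h2.1, h2.2.1⟩
    have e2 : f (M.sub M'') = f M :=
      hr (P := Q) (Y := M.sub M'') M''.subtype M''.mkQ h2 M''.injective_subtype
        (LinearMap.exact_subtype_mkQ M'') M''.mkQ_surjective
    rw [e1, e2]
  obtain ⟨M, N, h1, h2, ⟨e⟩⟩ := h
  rw [hfill h1, hfill h2, hiso e]

theorem cls_sup_eq_sum [IsNoetherianRing R] (X : TorsionModule R) {ι : Type*} [DecidableEq ι]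
    (p : ι → Submodule R X) (s : Finset ι) (hs : s.SupIndep p) :
    cls (X.sub (s.sup p)) = ∑ i ∈ s, cls (X.sub (p i)) := by
  induction s using Finset.induction_on with
  | empty =>
    rw [Finset.sum_empty, Finset.sup_empty]
    refine cls_eq_zero_of_memP ?_
    exact memP_of_subsingleton (⊥ : Submodule R X)
  | insert a s ha ih =>
    rw [Finset.sum_insert ha, ← ih (hs.subset (Finset.subset_insert a s)), Finset.sup_insert]
    have hd : Disjoint (p a) (s.sup p) :=
      hs (Finset.subset_insert a s) (Finset.mem_insert_self a s) ha
    let f : (p a × (s.sup p : Submodule R X)) →ₗ[R] X :=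
      LinearMap.coprod (p a).subtype (s.sup p).subtype
    have hf : Function.Injective f := by
      rw [← LinearMap.ker_eq_bot]
      refine LinearMap.ker_coprod_of_disjoint_range _ _ ?_ |>.trans ?_
      · rwa [Submodule.range_subtype, Submodule.range_subtype]
      · rw [Submodule.ker_subtype, Submodule.ker_subtype, Submodule.prod_bot]
    have hr : LinearMap.range f = p a ⊔ s.sup p := by
      rw [LinearMap.range_coprod, Submodule.range_subtype, Submodule.range_subtype]
    symm
    exact cls_eq_of_equiv (X := (X.sub (p a)).prod (X.sub (s.sup p)))
      (Y := X.sub (p a ⊔ s.sup p)) ((LinearEquiv.ofInjective f hf).trans (LinearEquiv.ofEq _ _ hr))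

end Equivalence

section Primary

variable {R : Type u} [CommRing R]

/-- The elements of `M` killed by a power of `𝔪`. For a module of finite length and a maximal ideal
`𝔪` this is the localization of `M` at `𝔪`. -/
def primarySub (𝔪 : Ideal R) (M : Type u) [AddCommGroup M] [Module R M] : Submodule R M where
  carrier := {x | ∃ k : ℕ, ∀ r ∈ 𝔪 ^ k, r • x = 0}
  zero_mem' := ⟨0, fun _ _ => smul_zero _⟩
  add_mem' := by
    rintro x y ⟨k, hk⟩ ⟨l, hl⟩
    refine ⟨max k l, fun r hr => ?_⟩
    rw [smul_add, hk r (Ideal.pow_le_pow_right (le_max_left _ _) hr),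
      hl r (Ideal.pow_le_pow_right (le_max_right _ _) hr), add_zero]
  smul_mem' := by
    rintro a x ⟨k, hk⟩
    exact ⟨k, fun r hr => by rw [smul_comm, hk r hr, smul_zero]⟩

theorem map_mem_primarySub {𝔪 : Ideal R} {M N : Type u} [AddCommGroup M] [Module R M]
    [AddCommGroup N] [Module R N] (f : M →ₗ[R] N) {x : M} (hx : x ∈ primarySub 𝔪 M) :
    f x ∈ primarySub 𝔪 N := by
  obtain ⟨k, hk⟩ := hx
  exact ⟨k, fun r hr => by rw [← map_smul, hk r hr, map_zero]⟩

/-- The map induced on `𝔪`-primary parts. -/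
def primaryMap (𝔪 : Ideal R) {M N : Type u} [AddCommGroup M] [Module R M]
    [AddCommGroup N] [Module R N] (f : M →ₗ[R] N) : primarySub 𝔪 M →ₗ[R] primarySub 𝔪 N :=
  f.restrict fun _ hx => map_mem_primarySub f hx

theorem eq_zero_of_mem_primarySub {𝔪 : Ideal R} (h𝔪 : 𝔪.IsMaximal) {M : Type u} [AddCommGroup M]
    [Module R M] {x : M} (hx : x ∈ primarySub 𝔪 M) {n : R} (hn : n ∉ 𝔪) (hnx : n • x = 0) :
    x = 0 := by
  obtain ⟨k, hk⟩ := hx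
  have h1 : 𝔪 ⊔ Ideal.span {n} = ⊤ := by
    by_contra hne
    have h2 := h𝔪.eq_of_le hne le_sup_left
    exact hn (h2 ▸ Ideal.mem_sup_right (Ideal.mem_span_singleton_self n))
  have h2 : 𝔪 ^ k ⊔ Ideal.span {n} = ⊤ := Ideal.pow_sup_eq_top h1
  obtain ⟨a, ha, b, hb, hab⟩ := Submodule.mem_sup.1 ((Ideal.eq_top_iff_one _).1 h2)
  obtain ⟨c, rfl⟩ := Ideal.mem_span_singleton.1 hb
  rw [← one_smul R x, ← hab, add_smul, hk a ha, mul_comm, mul_smul, hnx, smul_zero, add_zero]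

theorem primaryMap_injective (𝔪 : Ideal R)
    {M N : Type u} [AddCommGroup M] [Module R M]
    [AddCommGroup N] [Module R N]
    (f : M →ₗ[R] N) (hf : Function.Injective f) :
    Function.Injective (primaryMap 𝔪 f) :=
  fun _ _ hab => Subtype.ext (hf (congrArg Subtype.val hab))

theorem primaryMap_exact {𝔪 : Ideal R} {M N L : Type u} [AddCommGroup M] [Module R M]
    [AddCommGroup N] [Module R N] [AddCommGroup L]
    [Module R L] (f : M →ₗ[R] N) (hf : Function.Injective f)
    (g : N →ₗ[R] L) (he : Function.Exact f g) :
    Function.Exact (primaryMap 𝔪 f) (primaryMap 𝔪 g) := by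
  rintro ⟨y, hy⟩
  constructor
  · intro h0
    obtain ⟨x, rfl⟩ := (he y).1 (congrArg Subtype.val h0)
    obtain ⟨k, hk⟩ := hy
    refine ⟨⟨x, k, fun r hr => hf ?_⟩, rfl⟩
    rw [map_smul, hk r hr, map_zero]
  · rintro ⟨x, hx⟩
    exact Subtype.ext ((he y).2 ⟨x, congrArg Subtype.val hx⟩)

variable {Γ : Type u} [CommGroup Γ] [Finite Γ]

theorem exists_int_smul_eq_zero {M : Type u} [AddCommGroup M] [Module (MonoidAlgebra ℤ Γ) M]
    [Module.Finite (MonoidAlgebra ℤ Γ) M] (hM : Module.IsTorsion (MonoidAlgebra ℤ Γ) M) :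
    ∃ n : ℤ, n ≠ 0 ∧ ∀ x : M, (n : MonoidAlgebra ℤ Γ) • x = 0 := by
  obtain ⟨a, ha, hr⟩ := Submodule.annihilator_top_inter_nonZeroDivisors hM
  have hint : IsAlgebraic ℤ a := (Algebra.IsIntegral.isIntegral (R := ℤ) a).isAlgebraic
  obtain ⟨n, hn, c, hc⟩ := hint.exists_nonzero_dvd hr
  refine ⟨n, hn, fun x => ?_⟩
  have h1 : (n : MonoidAlgebra ℤ Γ) = c * a := by
    rw [mul_comm, ← hc]
    simp
  rw [h1, mul_smul, Submodule.mem_annihilator.1 ha x trivial, smul_zero]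

theorem finite_quotient_span_int {n : ℤ} (hn : n ≠ 0) :
    Finite (MonoidAlgebra ℤ Γ ⧸ Ideal.span {(n : MonoidAlgebra ℤ Γ)}) := by
  let S := MonoidAlgebra ℤ Γ ⧸ Ideal.span {(n : MonoidAlgebra ℤ Γ)}
  have h1 : Module.Finite ℤ S := by
    have : Module.Finite ℤ (MonoidAlgebra ℤ Γ) := inferInstance
    exact Module.Finite.of_surjective
      (Ideal.Quotient.mk (Ideal.span {(n : MonoidAlgebra ℤ Γ)})).toAddMonoidHom.toIntLinearMap
      Ideal.Quotient.mk_surjective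
  have h2 : Module.IsTorsion ℤ S := by
    intro x
    refine ⟨⟨n, mem_nonZeroDivisors_of_ne_zero hn⟩, ?_⟩
    change n • x = 0
    have h3 : (n : S) = 0 := by
      have h4 := Ideal.Quotient.eq_zero_iff_mem.2
        (Ideal.mem_span_singleton_self (n : MonoidAlgebra ℤ Γ))
      rwa [map_intCast] at h4
    rw [zsmul_eq_mul, h3, zero_mul]
  exact Module.finite_of_fg_torsion S h2

/-- A non-zero integer of `ℤ[Γ]` divides a product of powers of finitely many maximal ideals. -/
theorem exists_prod_maximal_le {n : ℤ} (hn : n ≠ 0) :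
    ∃ (S : Finset (Ideal (MonoidAlgebra ℤ Γ))) (k : ℕ), (∀ 𝔪 ∈ S, 𝔪.IsMaximal) ∧
      ∏ 𝔪 ∈ S, 𝔪 ^ k ≤ Ideal.span {(n : MonoidAlgebra ℤ Γ)} := by
  classical
  let A := MonoidAlgebra ℤ Γ ⧸ Ideal.span {(n : MonoidAlgebra ℤ Γ)}
  have hA : Finite A := finite_quotient_span_int hn
  let π : MonoidAlgebra ℤ Γ →+* A := Ideal.Quotient.mk _
  have hπ : Function.Surjective π := Ideal.Quotient.mk_surjective
  obtain ⟨Z, hZ⟩ := PrimeSpectrum.exists_primeSpectrum_prod_le A ⊥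
  have hmul : ∀ Z : Multiset (PrimeSpectrum A), (Z.map fun p => p.asIdeal.comap π).prod ≤
      (Z.map PrimeSpectrum.asIdeal).prod.comap π := by
    intro Z
    induction Z using Multiset.induction_on with
    | empty => simp
    | cons p Z ih =>
      rw [Multiset.map_cons, Multiset.prod_cons, Multiset.map_cons, Multiset.prod_cons]
      exact (Ideal.mul_mono_right ih).trans (Ideal.le_comap_mul π)
  set W : Multiset (Ideal (MonoidAlgebra ℤ Γ)) := Z.map fun p => p.asIdeal.comap π with hW
  refine ⟨W.toFinset, W.card, ?_, ?_⟩
  · intro 𝔪 h𝔪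
    rw [Multiset.mem_toFinset, hW, Multiset.mem_map] at h𝔪
    obtain ⟨p, _, rfl⟩ := h𝔪
    have : p.asIdeal.IsMaximal := inferInstance
    exact Ideal.comap_isMaximal_of_surjective π hπ
  · have h1 : W.prod ≤ Ideal.span {(n : MonoidAlgebra ℤ Γ)} := by
      refine (hmul Z).trans ((Ideal.comap_mono hZ).trans ?_)
      change RingHom.ker π ≤ _
      rw [Ideal.mk_ker]
    rw [Finset.prod_multiset_count] at h1
    refine le_trans ?_ h1
    exact Finset.prod_le_prod' fun 𝔪 _ => Ideal.pow_le_pow_right (Multiset.count_le_card _ _)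

/-- A finitely generated torsion module is killed by the product of a power of a given maximal ideal
and an ideal prime to it. -/
theorem exists_coprime_annihilator {𝔪 : Ideal (MonoidAlgebra ℤ Γ)} (h𝔪 : 𝔪.IsMaximal)
    {M : Type u} [AddCommGroup M] [Module (MonoidAlgebra ℤ Γ) M]
    [Module.Finite (MonoidAlgebra ℤ Γ) M] (hM : Module.IsTorsion (MonoidAlgebra ℤ Γ) M) :
    ∃ (𝔟 : Ideal (MonoidAlgebra ℤ Γ)) (k : ℕ), 𝔪 ⊔ 𝔟 = ⊤ ∧
      ∀ r ∈ 𝔪 ^ k, ∀ s ∈ 𝔟, ∀ x : M, (r * s) • x = 0 := by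
  classical
  obtain ⟨n, hn, hnM⟩ := exists_int_smul_eq_zero hM
  obtain ⟨S, k, hS, hk⟩ := exists_prod_maximal_le (Γ := Γ) hn
  refine ⟨∏ 𝔫 ∈ S.erase 𝔪, 𝔫 ^ k, k, ?_, ?_⟩
  · refine Ideal.sup_prod_eq_top fun 𝔫 h => Ideal.sup_pow_eq_top ?_
    obtain ⟨hne, hmem⟩ := Finset.mem_erase.1 h
    exact h𝔪.coprime_of_ne (hS 𝔫 hmem) hne.symm
  · intro r hr s hs x
    have h1 : r * s ∈ ∏ 𝔫 ∈ S, 𝔫 ^ k := by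
      by_cases hm : 𝔪 ∈ S
      · rw [← Finset.mul_prod_erase S _ hm]
        exact Ideal.mul_mem_mul hr hs
      · rw [Finset.erase_eq_of_notMem hm] at hs
        exact Ideal.mul_mem_left _ _ hs
    obtain ⟨c, hc⟩ := Ideal.mem_span_singleton.1 (hk h1)
    rw [hc, mul_comm, mul_smul, hnM, smul_zero]

theorem exists_smul_mem_primarySub {𝔪 : Ideal (MonoidAlgebra ℤ Γ)} (h𝔪 : 𝔪.IsMaximal)
    {M : Type u} [AddCommGroup M] [Module (MonoidAlgebra ℤ Γ) M]
    [Module.Finite (MonoidAlgebra ℤ Γ) M] (hM : Module.IsTorsion (MonoidAlgebra ℤ Γ) M) (k : ℕ) :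
    ∃ s : MonoidAlgebra ℤ Γ, 1 - s ∈ 𝔪 ^ k ∧ ∀ x : M, s • x ∈ primarySub 𝔪 M := by
  obtain ⟨𝔟, l, hcop, hkill⟩ := exists_coprime_annihilator h𝔪 hM
  obtain ⟨a, ha, s, hs, has⟩ := Submodule.mem_sup.1
    ((Ideal.eq_top_iff_one _).1 (Ideal.pow_sup_eq_top (n := k) hcop))
  refine ⟨s, ?_, fun x => ⟨l, fun r hr => ?_⟩⟩
  · rw [← has, add_sub_cancel_right]
    exact ha
  · rw [← mul_smul, hkill r hr s hs]

theorem exists_pow_smul_primarySub {𝔪 : Ideal (MonoidAlgebra ℤ Γ)} (h𝔪 : 𝔪.IsMaximal)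
    {M : Type u} [AddCommGroup M] [Module (MonoidAlgebra ℤ Γ) M]
    [Module.Finite (MonoidAlgebra ℤ Γ) M] (hM : Module.IsTorsion (MonoidAlgebra ℤ Γ) M) :
    ∃ k : ℕ, ∀ x ∈ primarySub 𝔪 M, ∀ r ∈ 𝔪 ^ k, r • x = 0 := by
  obtain ⟨𝔟, l, hcop, hkill⟩ := exists_coprime_annihilator h𝔪 hM
  refine ⟨l, fun x ⟨k, hk⟩ r hr => ?_⟩
  obtain ⟨a, ha, s, hs, has⟩ := Submodule.mem_sup.1
    ((Ideal.eq_top_iff_one _).1 (Ideal.pow_sup_eq_top (n := k) hcop))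
  have h1 : x = s • x := by
    conv_lhs => rw [← one_smul (MonoidAlgebra ℤ Γ) x, ← has, add_smul, hk a ha, zero_add]
  rw [h1, ← mul_smul, hkill r hr s hs]

/-- The `𝔪`-primary part of a module in `𝒫` is a direct summand, hence lies in `𝒫`. -/
theorem MemP.primarySub {𝔪 : Ideal (MonoidAlgebra ℤ Γ)} (h𝔪 : 𝔪.IsMaximal)
    {M : Type u} [AddCommGroup M] [Module (MonoidAlgebra ℤ Γ) M]
    (hM : MemP (MonoidAlgebra ℤ Γ) M) : MemP (MonoidAlgebra ℤ Γ) (primarySub 𝔪 M) := by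
  have := hM.1
  obtain ⟨k, hk⟩ := exists_pow_smul_primarySub h𝔪 hM.2.1
  obtain ⟨s, hs, hsM⟩ := exists_smul_mem_primarySub h𝔪 hM.2.1 k
  refine hM.of_retract (Submodule.subtype _)
    (LinearMap.codRestrict _ (LinearMap.lsmul _ M s) hsM) ?_
  ext ⟨x, hx⟩
  change s • x = x
  have h1 := hk x hx _ hs
  rw [sub_smul, one_smul, sub_eq_zero] at h1
  exact h1.symm

theorem primaryMap_surjective {𝔪 : Ideal (MonoidAlgebra ℤ Γ)} (h𝔪 : 𝔪.IsMaximal)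
    {M N : Type u} [AddCommGroup M] [Module (MonoidAlgebra ℤ Γ) M]
    [AddCommGroup N] [Module (MonoidAlgebra ℤ Γ) N]
    [Module.Finite (MonoidAlgebra ℤ Γ) M] (hM : Module.IsTorsion (MonoidAlgebra ℤ Γ) M)
    (f : M →ₗ[MonoidAlgebra ℤ Γ] N) (hf : Function.Surjective f) :
    Function.Surjective (primaryMap 𝔪 f) := by
  rintro ⟨y, hy⟩
  obtain ⟨k, hk⟩ := id hy
  obtain ⟨x, rfl⟩ := hf y
  obtain ⟨s, hs, hsM⟩ := exists_smul_mem_primarySub h𝔪 hM k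
  refine ⟨⟨s • x, hsM x⟩, Subtype.ext ?_⟩
  change f (s • x) = f x
  have h1 := hk _ hs
  rw [sub_smul, one_smul, sub_eq_zero] at h1
  rw [map_smul]
  exact h1.symm

/-- The component of an object of `𝒞` at `𝔪`. -/
def TorsionModule.comp (X : TorsionModule (MonoidAlgebra ℤ Γ)) (𝔪 : Ideal (MonoidAlgebra ℤ Γ)) :
    TorsionModule (MonoidAlgebra ℤ Γ) :=
  X.sub (primarySub 𝔪 X)

theorem Equivalent.comp_eq {𝔪 : Ideal (MonoidAlgebra ℤ Γ)} (h𝔪 : 𝔪.IsMaximal)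
    {X Y : TorsionModule (MonoidAlgebra ℤ Γ)} (h : Equivalent X Y) :
    cls (X.comp 𝔪) = cls (Y.comp 𝔪) := by
  refine h.map_eq (fun X => cls (X.comp 𝔪)) ?_ ?_
  · intro Y N P i q hP hi he hq
    have := N.finite
    exact cls_eq_of_exact (Y := Y.comp 𝔪) (N := N.comp 𝔪) (hP.primarySub h𝔪) (primaryMap 𝔪 i)
      (primaryMap 𝔪 q) (primaryMap_injective 𝔪 i hi) (primaryMap_exact i hi q he)
      (primaryMap_surjective h𝔪 N.torsion q hq)
  · intro P N X i q hP hi he hq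
    have := N.finite
    exact cls_eq_of_exact_left (X := X.comp 𝔪) (N := N.comp 𝔪) (hP.primarySub h𝔪)
      (primaryMap 𝔪 i) (primaryMap 𝔪 q) (primaryMap_injective 𝔪 i hi) (primaryMap_exact i hi q he)
      (primaryMap_surjective h𝔪 N.torsion q hq)

/-- The endomorphism of `𝒞/∼` sending `[X]` to the class of the component of `X` at `𝔪`. -/
def compHom {𝔪 : Ideal (MonoidAlgebra ℤ Γ)} (h𝔪 : 𝔪.IsMaximal) :
    Classes (MonoidAlgebra ℤ Γ) →+ Classes (MonoidAlgebra ℤ Γ) where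
  toFun := Quot.lift (fun X => cls (X.comp 𝔪)) fun _ _ h => h.comp_eq h𝔪
  map_zero' := by
    refine cls_eq_zero_of_memP ?_
    exact memP_of_subsingleton (primarySub 𝔪 PUnit)
  map_add' := by
    rintro ⟨X⟩ ⟨Y⟩
    refine cls_eq_of_equiv (X := (X.prod Y).comp 𝔪) (Y := (X.comp 𝔪).prod (Y.comp 𝔪)) ?_
    refine LinearEquiv.ofBijective (LinearMap.prod (primaryMap 𝔪 (LinearMap.fst _ X Y))
      (primaryMap 𝔪 (LinearMap.snd _ X Y))) ⟨?_, ?_⟩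
    · intro a b hab
      refine Subtype.ext (Prod.ext ?_ ?_)
      · exact congrArg (fun z => (z.1 : X)) hab
      · exact congrArg (fun z => (z.2 : Y)) hab
    · rintro ⟨⟨x, hx⟩, ⟨y, hy⟩⟩
      refine ⟨⟨(x, y), ?_⟩, rfl⟩
      have h1 := add_mem (map_mem_primarySub (LinearMap.inl _ X Y) hx)
        (map_mem_primarySub (LinearMap.inr _ X Y) hy)
      have h2 : LinearMap.inl (MonoidAlgebra ℤ Γ) X Y x +
          LinearMap.inr (MonoidAlgebra ℤ Γ) X Y y = (x, y) := by
        simp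
      rwa [h2] at h1

theorem compHom_cls {𝔪 : Ideal (MonoidAlgebra ℤ Γ)} (h𝔪 : 𝔪.IsMaximal)
    (X : TorsionModule (MonoidAlgebra ℤ Γ)) : compHom h𝔪 (cls X) = cls (X.comp 𝔪) := rfl

theorem IsShift.comp {𝔪 : Ideal (MonoidAlgebra ℤ Γ)} (h𝔪 : 𝔪.IsMaximal)
    {X Y : TorsionModule (MonoidAlgebra ℤ Γ)} (h : IsShift X Y) :
    IsShift (X.comp 𝔪) (Y.comp 𝔪) := by
  obtain ⟨P, hP, i, q, hi, he, hq⟩ := h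
  have := P.finite
  exact ⟨P.comp 𝔪, hP.primarySub h𝔪, primaryMap 𝔪 i, primaryMap 𝔪 q, primaryMap_injective 𝔪 i hi,
    primaryMap_exact i hi q he, primaryMap_surjective h𝔪 P.torsion q hq⟩

theorem compHom_shiftClass {𝔪 : Ideal (MonoidAlgebra ℤ Γ)} (h𝔪 : 𝔪.IsMaximal)
    {X Y : TorsionModule (MonoidAlgebra ℤ Γ)} (h : IsShift X Y) :
    compHom h𝔪 (shiftClass X) = shiftClass (X.comp 𝔪) := by
  rw [h.shiftClass_eq, (h.comp h𝔪).shiftClass_eq, compHom_cls]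

theorem cls_eq_sum_comp {S : Finset (Ideal (MonoidAlgebra ℤ Γ))} {k : ℕ}
    (hS : ∀ 𝔪 ∈ S, 𝔪.IsMaximal) (X : TorsionModule (MonoidAlgebra ℤ Γ))
    (hX : ∀ r ∈ ∏ 𝔪 ∈ S, 𝔪 ^ k, ∀ x : X, r • x = 0) :
    cls X = ∑ 𝔪 ∈ S, cls (X.comp 𝔪) := by
  classical
  have hpair : (S : Set (Ideal (MonoidAlgebra ℤ Γ))).Pairwise
      fun 𝔪 𝔫 => 𝔪 ^ k ⊔ 𝔫 ^ k = ⊤ := fun 𝔪 hm 𝔫 hn hne =>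
    Ideal.pow_sup_pow_eq_top ((hS 𝔪 hm).coprime_of_ne (hS 𝔫 hn) hne)
  have hprod : ⨅ 𝔪 ∈ S, 𝔪 ^ k = ∏ 𝔪 ∈ S, 𝔪 ^ k := by
    symm
    refine Ideal.prod_eq_iInf_of_pairwise_isCoprime fun 𝔪 hm 𝔫 hn hne => ?_
    exact Ideal.isCoprime_iff_sup_eq.2 (hpair hm hn hne)
  have htop :
      S.sup (fun 𝔪 => Submodule.torsionBySet (MonoidAlgebra ℤ Γ) X (𝔪 ^ k : Ideal _)) = ⊤ := by
    rw [Finset.sup_eq_iSup, Submodule.iSup_torsionBySet_ideal_eq_torsionBySet_iInf hpair, hprod,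
      eq_top_iff]
    intro x _
    rw [Submodule.mem_torsionBySet_iff]
    rintro ⟨r, hr⟩
    exact hX r hr x
  have hprim : ∀ 𝔪 ∈ S, Submodule.torsionBySet (MonoidAlgebra ℤ Γ) X (𝔪 ^ k : Ideal _) =
      primarySub 𝔪 X := by
    intro 𝔪 hm
    ext x
    rw [Submodule.mem_torsionBySet_iff]
    constructor
    · intro h
      exact ⟨k, fun r hr => h ⟨r, hr⟩⟩
    · rintro ⟨l, hl⟩ ⟨r, hr⟩
      -- `x` is killed by `𝔪 ^ l` and, after multiplication by `r`, by an ideal prime to `𝔪`.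
      have hcop : 𝔪 ^ l ⊔ ∏ 𝔫 ∈ S.erase 𝔪, 𝔫 ^ k = ⊤ := by
        refine Ideal.sup_prod_eq_top fun 𝔫 h => Ideal.pow_sup_pow_eq_top ?_
        obtain ⟨hne, hmem⟩ := Finset.mem_erase.1 h
        exact (hS 𝔪 hm).coprime_of_ne (hS 𝔫 hmem) hne.symm
      obtain ⟨a, ha, s, hs, has⟩ := Submodule.mem_sup.1 ((Ideal.eq_top_iff_one _).1 hcop)
      change r • x = 0
      have h1 : r * s ∈ ∏ 𝔫 ∈ S, 𝔫 ^ k := by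
        rw [← Finset.mul_prod_erase S _ hm]
        exact Ideal.mul_mem_mul hr hs
      have h2 : r = r * a + r * s := by rw [← mul_add, has, mul_one]
      rw [h2, add_smul, mul_smul, hl a ha, smul_zero, zero_add, hX _ h1]
  have h1 := cls_sup_eq_sum X _ S (Submodule.supIndep_torsionBySet_ideal (M := X) hpair)
  rw [htop] at h1
  have h2 : cls X = cls (X.sub ⊤) :=
    cls_eq_of_equiv (Y := X.sub ⊤) (Submodule.topEquiv (R := MonoidAlgebra ℤ Γ) (M := X)).symm
  rw [h2, h1]
  refine Finset.sum_congr rfl fun 𝔪 hm => ?_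
  rw [hprim 𝔪 hm]
  rfl

/-- A class is determined by its components at all maximal ideals. -/
theorem eq_of_compHom_eq {a b : Classes (MonoidAlgebra ℤ Γ)}
    (h : ∀ (𝔪 : Ideal (MonoidAlgebra ℤ Γ)) (h𝔪 : 𝔪.IsMaximal), compHom h𝔪 a = compHom h𝔪 b) :
    a = b := by
  obtain ⟨X, rfl⟩ := Quot.exists_rep a
  obtain ⟨Y, rfl⟩ := Quot.exists_rep b
  have := X.finite
  have := Y.finite
  obtain ⟨n, hn, hnX⟩ := exists_int_smul_eq_zero X.torsion
  obtain ⟨l, hl, hlY⟩ := exists_int_smul_eq_zero Y.torsion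
  obtain ⟨S, k, hS, hk⟩ := exists_prod_maximal_le (Γ := Γ) (mul_ne_zero hn hl)
  have hX : cls X = ∑ 𝔪 ∈ S, cls (X.comp 𝔪) := by
    refine cls_eq_sum_comp (k := k) hS X fun r hr x => ?_
    obtain ⟨c, rfl⟩ := Ideal.mem_span_singleton.1 (hk hr)
    push_cast
    rw [mul_comm, mul_comm (n : MonoidAlgebra ℤ Γ), ← mul_assoc, mul_smul, hnX, smul_zero]
  have hY : cls Y = ∑ 𝔪 ∈ S, cls (Y.comp 𝔪) := by
    refine cls_eq_sum_comp (k := k) hS Y fun r hr x => ?_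
    obtain ⟨c, rfl⟩ := Ideal.mem_span_singleton.1 (hk hr)
    push_cast
    rw [mul_comm, ← mul_assoc, mul_smul, hlY, smul_zero]
  change cls X = cls Y
  rw [hX, hY]
  exact Finset.sum_congr rfl fun 𝔪 hm => h 𝔪 (hS 𝔪 hm)

end Primary

/-! ### The projection of a finite abelian group onto its `p`-part -/

section PPart

/-- There is an exponent `w` such that `x ↦ x ^ w` projects every abelian group of order `n` onto
its `p`-part. -/
theorem exists_primary_exponent {p n : ℕ} (hp : p.Prime) (hn : n ≠ 0) :
    ∃ w k : ℕ, ¬ p ∣ w ∧ w * w ≡ w [MOD n] ∧ n ∣ w * p ^ k := by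
  have hcop : (p ^ (n.factorization p + 1)).Coprime (ordCompl[p] n) :=
    Nat.Coprime.pow_left _ (Nat.coprime_ordCompl hp hn)
  obtain ⟨w, hw1, hw2⟩ := Nat.chineseRemainder hcop 1 0
  have hn' : p ^ n.factorization p * ordCompl[p] n = n := Nat.ordProj_mul_ordCompl_eq_self n p
  have hw1' : w ≡ 1 [MOD p ^ n.factorization p] := hw1.of_dvd (pow_dvd_pow p (Nat.le_succ _))
  refine ⟨w, n.factorization p, ?_, ?_, ?_⟩
  · intro hdvd
    have h1 : w ≡ 1 [MOD p] := hw1.of_dvd (dvd_pow_self p (Nat.succ_ne_zero _))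
    have h2 : 0 ≡ 1 [MOD p] := ((Nat.modEq_zero_iff_dvd.2 hdvd).symm).trans h1
    have h3 := (Nat.modEq_zero_iff_dvd.1 h2.symm)
    exact hp.one_lt.ne' (Nat.dvd_one.1 h3)
  · have hc : (p ^ n.factorization p).Coprime (ordCompl[p] n) :=
      Nat.Coprime.pow_left _ (Nat.coprime_ordCompl hp hn)
    have h1 := (Nat.modEq_and_modEq_iff_modEq_mul hc).1
      ⟨by simpa using hw1'.mul_right w,
        (by simpa using (hw2.mul_right w).trans ((by simpa using hw2.symm) : 0 * w ≡ w [MOD _]) :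
          w * w ≡ w [MOD ordCompl[p] n])⟩
    rwa [hn'] at h1
  · have h2 : ordCompl[p] n ∣ w := Nat.modEq_zero_iff_dvd.1 hw2
    calc n = ordCompl[p] n * p ^ n.factorization p := by rw [mul_comm]; exact hn'.symm
      _ ∣ _ := mul_dvd_mul_right h2 _

variable {G : Type u} [CommGroup G]

/-- An endomorphism of `G` that projects onto the `p`-part of `G`, given as a power map. It maps
every subgroup into itself, and its image stands in for the maximal `p`-quotient of `G`. -/
structure IsPrimaryProj (p : ℕ) (e : G →* G) : Prop where
  prime : p.Prime
  exists_eq_pow : ∃ w : ℕ, ¬ p ∣ w ∧ ∀ x, e x = x ^ w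
  idem : ∀ x, e (e x) = e x
  exists_pow_eq_one : ∃ k : ℕ, ∀ x, e x ^ p ^ k = 1

theorem exists_isPrimaryProj [Finite G] {p : ℕ} (hp : p.Prime) :
    ∃ e : G →* G, IsPrimaryProj p e := by
  obtain ⟨w, k, hw, hww, hk⟩ := exists_primary_exponent hp (Nat.card_pos (α := G)).ne'
  refine ⟨powMonoidHom w, hp, ⟨w, hw, fun _ => rfl⟩, fun x => ?_, k, fun x => ?_⟩
  · change (x ^ w) ^ w = x ^ w
    rw [← pow_mul, pow_eq_pow_iff_modEq]
    exact hww.of_dvd (orderOf_dvd_natCard x)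
  · change (x ^ w) ^ p ^ k = 1
    rw [← pow_mul]
    obtain ⟨c, hc⟩ := hk
    rw [hc, pow_mul, pow_card_eq_one', one_pow]

namespace IsPrimaryProj

variable {p : ℕ} {e : G →* G} (he : IsPrimaryProj p e)
include he

theorem map_le (K : Subgroup G) : K.map e ≤ K := by
  obtain ⟨w, -, hw⟩ := he.exists_eq_pow
  rintro _ ⟨x, hx, rfl⟩
  rw [hw]
  exact pow_mem hx w

theorem mul_inv_mem_ker (x : G) : x * (e x)⁻¹ ∈ e.ker := by
  rw [MonoidHom.mem_ker, map_mul, map_inv, he.idem, mul_inv_cancel]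

theorem not_dvd_card_of_le_ker [Finite G] {K : Subgroup G} (hK : K ≤ e.ker) :
    ¬ p ∣ Nat.card K := by
  have := Fact.mk he.prime
  intro hdvd
  obtain ⟨⟨x, hx⟩, hord⟩ := exists_prime_orderOf_dvd_card' p hdvd
  rw [Subgroup.orderOf_mk] at hord
  obtain ⟨w, hw, hpow⟩ := he.exists_eq_pow
  have h1 : x ^ w = 1 := by rw [← hpow]; exact hK hx
  exact hw (hord ▸ orderOf_dvd_of_pow_eq_one h1)

theorem ker_eq_pKernel : e.ker = pKernel G p := by
  have := Fact.mk he.prime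
  apply le_antisymm
  · refine le_sInf fun N hN x hx => ?_
    obtain ⟨w, hw, hpow⟩ := he.exists_eq_pow
    have h1 : x ^ w = 1 := by rw [← hpow]; exact hx
    obtain ⟨k, hk⟩ := (hN : IsPGroup p (G ⧸ N)) (x : G ⧸ N)
    have h2 : (x : G ⧸ N) ^ w = 1 := by rw [← QuotientGroup.mk_pow, h1, QuotientGroup.mk_one]
    have hcop : (p ^ k).Coprime w :=
      Nat.Coprime.pow_left _ ((Nat.Prime.coprime_iff_not_dvd he.prime).2 hw)
    have h6 : orderOf (x : G ⧸ N) = 1 := Nat.dvd_one.1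
      (hcop ▸ Nat.dvd_gcd (orderOf_dvd_of_pow_eq_one hk) (orderOf_dvd_of_pow_eq_one h2))
    exact (QuotientGroup.eq_one_iff x).1 (orderOf_eq_one_iff.1 h6)
  · refine sInf_le ?_
    change IsPGroup p (G ⧸ e.ker)
    obtain ⟨k, hk⟩ := he.exists_pow_eq_one
    intro y
    obtain ⟨x, rfl⟩ := QuotientGroup.mk_surjective y
    refine ⟨k, ?_⟩
    rw [← QuotientGroup.mk_pow, QuotientGroup.eq_one_iff, MonoidHom.mem_ker, map_pow]
    exact hk x

theorem pPart_eq_iff {K L : Subgroup G} : pPart p K = pPart p L ↔ K.map e = L.map e := by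
  rw [pPart, pPart, Subgroup.map_eq_map_iff, Subgroup.map_eq_map_iff, QuotientGroup.ker_mk',
    he.ker_eq_pKernel]

theorem pPart_eq_bot_iff {K : Subgroup G} : pPart p K = ⊥ ↔ K.map e = ⊥ := by
  rw [pPart, Subgroup.map_eq_bot_iff, Subgroup.map_eq_bot_iff, QuotientGroup.ker_mk',
    he.ker_eq_pKernel]

end IsPrimaryProj

theorem isCyclic_quotient_iff {I D : Subgroup G} (h : I ≤ D) :
    IsCyclic (D ⧸ I.subgroupOf D) ↔ ∃ φ, D = I ⊔ Subgroup.zpowers φ := by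
  constructor
  · rintro ⟨⟨y, hy⟩⟩
    obtain ⟨φ, rfl⟩ := QuotientGroup.mk_surjective y
    refine ⟨φ, le_antisymm ?_ (sup_le h ((Subgroup.zpowers_le).2 φ.2))⟩
    intro d hd
    obtain ⟨j, hj⟩ := hy ((⟨d, hd⟩ : D) : D ⧸ I.subgroupOf D)
    change ((φ : D) : D ⧸ I.subgroupOf D) ^ j = _ at hj
    rw [← QuotientGroup.mk_zpow, QuotientGroup.eq] at hj
    have h1 : ((φ : G) ^ j)⁻¹ * d ∈ I := hj
    have h2 : d = ((φ : G) ^ j)⁻¹ * d * (φ : G) ^ j := by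
      rw [mul_comm, mul_inv_cancel_left]
    rw [h2]
    exact mul_mem (Subgroup.mem_sup_left h1)
      (Subgroup.mem_sup_right (Subgroup.zpow_mem_zpowers _ _))
  · rintro ⟨φ, rfl⟩
    have hφ : φ ∈ I ⊔ Subgroup.zpowers φ := Subgroup.mem_sup_right (Subgroup.mem_zpowers φ)
    refine ⟨⟨QuotientGroup.mk ⟨φ, hφ⟩, fun y => ?_⟩⟩
    obtain ⟨⟨d, hd⟩, rfl⟩ := QuotientGroup.mk_surjective y
    obtain ⟨i, hi, z, hz, hiz⟩ := Subgroup.mem_sup.1 hd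
    obtain ⟨j, rfl⟩ := Subgroup.mem_zpowers_iff.1 hz
    refine ⟨j, ?_⟩
    refine (QuotientGroup.mk_zpow _ _ j).symm.trans ?_
    rw [QuotientGroup.eq]
    change (φ ^ j)⁻¹ * d ∈ I
    rw [← hiz, mul_comm i, inv_mul_cancel_left]
    exact hi

theorem SetS.exists_gen (s : SetS G) : ∃ φ, s.D = s.I ⊔ Subgroup.zpowers φ :=
  (isCyclic_quotient_iff s.le).1 s.cyclic

/-- An element of `D` whose class generates `D / I`. -/
def SetS.gen (s : SetS G) : G := s.exists_gen.choose

theorem SetS.D_eq (s : SetS G) : s.D = s.I ⊔ Subgroup.zpowers s.gen := s.exists_gen.choose_spec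

theorem isCyclic_pPart (s : SetS G) (p : ℕ) :
    IsCyclic (pPart p s.D ⧸ (pPart p s.I).subgroupOf (pPart p s.D)) := by
  refine (isCyclic_quotient_iff (Subgroup.map_mono s.le)).2 ⟨QuotientGroup.mk' _ s.gen, ?_⟩
  refine (congrArg (pPart p) s.D_eq).trans ((Subgroup.map_sup _ _ _).trans ?_)
  rw [MonoidHom.map_zpowers]

end PPart

/-! ### Components of the modules `A_{I,φ}` -/

section LocalComparison

variable {Γ : Type u} [CommGroup Γ]

/-- The subgroup of the elements of `Γ` that act trivially on the residue field at `𝔪`. -/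
def residueKer (𝔪 : Ideal (MonoidAlgebra ℤ Γ)) : Subgroup Γ :=
  (((Ideal.Quotient.mk 𝔪 : MonoidAlgebra ℤ Γ →* MonoidAlgebra ℤ Γ ⧸ 𝔪).comp
    (MonoidAlgebra.of ℤ Γ)).toHomUnits).ker

theorem mem_residueKer {𝔪 : Ideal (MonoidAlgebra ℤ Γ)} {g : Γ} :
    g ∈ residueKer 𝔪 ↔ gp g - 1 ∈ 𝔪 := by
  rw [residueKer, MonoidHom.mem_ker, Units.ext_iff]
  change Ideal.Quotient.mk 𝔪 (gp g) = 1 ↔ _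
  rw [← map_one (Ideal.Quotient.mk 𝔪), Ideal.Quotient.eq]

theorem augIdeal_le_of_le_residueKer {𝔪 : Ideal (MonoidAlgebra ℤ Γ)} {K : Subgroup Γ}
    (hK : K ≤ residueKer 𝔪) : augIdeal K ≤ 𝔪 := by
  rw [augIdeal_eq_span, Ideal.span_le]
  rintro _ ⟨g, hg, rfl⟩
  exact mem_residueKer.1 (hK hg)

theorem SetT.ext_of_pPart {t t' : SetT Γ} {I D : Subgroup Γ} (hp : t.p = t'.p) (hH : t.H = t'.H)
    (hI : pPart t.p I = t.I) (hI' : pPart t'.p I = t'.I) (hD : pPart t.p D = t.D)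
    (hD' : pPart t'.p D = t'.D) : t = t' := by
  obtain ⟨p, _, H, _, _, It, Dt, _, _, _⟩ := t
  obtain ⟨p', _, H', _, _, It', Dt', _, _, _⟩ := t'
  obtain rfl : p = p' := hp
  obtain rfl : H = H' := hH
  obtain rfl : It = It' := hI.symm.trans hI'
  obtain rfl : Dt = Dt' := hD.symm.trans hD'
  rfl

variable [Finite Γ]

theorem isCyclic_quotient_residueKer {𝔪 : Ideal (MonoidAlgebra ℤ Γ)} (h𝔪 : 𝔪.IsMaximal) :
    IsCyclic (Γ ⧸ residueKer 𝔪) := by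
  have : IsDomain (MonoidAlgebra ℤ Γ ⧸ 𝔪) := (Ideal.Quotient.isDomain_iff_prime 𝔪).2 h𝔪.isPrime
  refine isCyclic_of_injective_ringHom ((Units.coeHom (MonoidAlgebra ℤ Γ ⧸ 𝔪)).comp
    (QuotientGroup.kerLift _)) ?_
  exact Units.val_injective.comp (QuotientGroup.kerLift_injective _)

theorem coprime_card_quotient_residueKer {𝔪 : Ideal (MonoidAlgebra ℤ Γ)} (h𝔪 : 𝔪.IsMaximal)
    {p : ℕ} (hp : p.Prime) (hpm : (p : MonoidAlgebra ℤ Γ) ∈ 𝔪) :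
    (Nat.card (Γ ⧸ residueKer 𝔪)).Coprime p := by
  have := Fact.mk hp
  have : IsDomain (MonoidAlgebra ℤ Γ ⧸ 𝔪) := (Ideal.Quotient.isDomain_iff_prime 𝔪).2 h𝔪.isPrime
  have hp0 : (p : MonoidAlgebra ℤ Γ ⧸ 𝔪) = 0 := by
    rw [← map_natCast (Ideal.Quotient.mk 𝔪)]
    exact Ideal.Quotient.eq_zero_iff_mem.2 hpm
  have : CharP (MonoidAlgebra ℤ Γ ⧸ 𝔪) p := by
    refine ringChar.of_eq (((Nat.dvd_prime hp).1 (ringChar.dvd hp0)).resolve_left ?_)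
    exact CharP.ringChar_ne_one
  rw [Nat.coprime_comm, hp.coprime_iff_not_dvd]
  intro hdvd
  obtain ⟨x, hx⟩ := exists_prime_orderOf_dvd_card' p hdvd
  obtain ⟨g, rfl⟩ := QuotientGroup.mk_surjective x
  have h1 : g ^ p ∈ residueKer 𝔪 := by
    rw [← QuotientGroup.eq_one_iff, QuotientGroup.mk_pow, ← hx, pow_orderOf_eq_one]
  have h2 : g ∈ residueKer 𝔪 := by
    rw [mem_residueKer] at h1 ⊢
    have h3 : (Ideal.Quotient.mk 𝔪 (gp g - 1)) ^ p = 0 := by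
      rw [map_sub, map_one, sub_pow_char, one_pow, ← map_pow, ← gp_pow,
        ← map_one (Ideal.Quotient.mk 𝔪), ← map_sub]
      exact Ideal.Quotient.eq_zero_iff_mem.2 h1
    exact Ideal.Quotient.eq_zero_iff_mem.1 (pow_eq_zero_iff hp.ne_zero |>.1 h3)
  rw [(QuotientGroup.eq_one_iff g).2 h2, orderOf_one] at hx
  exact hp.one_lt.ne hx

/-- A module killed by an element outside `𝔪` has trivial component at `𝔪`. -/
theorem memP_comp_of_smul_eq_zero {𝔪 : Ideal (MonoidAlgebra ℤ Γ)} (h𝔪 : 𝔪.IsMaximal)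
    (X : TorsionModule (MonoidAlgebra ℤ Γ)) {n : MonoidAlgebra ℤ Γ} (hn : n ∉ 𝔪)
    (hX : ∀ x : X, n • x = 0) : MemP (MonoidAlgebra ℤ Γ) (X.comp 𝔪) := by
  have : Subsingleton (X.comp 𝔪) := by
    refine ⟨fun a b => ?_⟩
    have h : ∀ a : primarySub 𝔪 X, a = 0 := fun a =>
      Subtype.ext (eq_zero_of_mem_primarySub h𝔪 a.2 hn (hX a))
    exact (h a).trans (h b).symm
  exact memP_of_subsingleton _

theorem smul_cyclicModule_eq_zero {R : Type u} [CommRing R] {𝔞 : Ideal R}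
    {h : ∃ g ∈ 𝔞, g ∈ R⁰} {n : R} (hn : n ∈ 𝔞) (x : cyclicModule 𝔞 h) : n • x = 0 := by
  obtain ⟨r, rfl⟩ := Submodule.mkQ_surjective 𝔞 x
  change (Submodule.Quotient.mk (n * r) : R ⧸ 𝔞) = 0
  rw [Submodule.Quotient.mk_eq_zero]
  exact Ideal.mul_mem_right _ _ hn

/-- Unless `I` and `φ` act trivially on the residue field, the component of `A_{I,φ}` is zero. -/
theorem memP_comp_relModule_of_not_le {𝔪 : Ideal (MonoidAlgebra ℤ Γ)} (h𝔪 : 𝔪.IsMaximal)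
    (hm : (Nat.card Γ : MonoidAlgebra ℤ Γ) ∈ 𝔪) (I : Subgroup Γ) (φ : Γ)
    (h : ¬ I ⊔ Subgroup.zpowers φ ≤ residueKer 𝔪) :
    MemP (MonoidAlgebra ℤ Γ) ((relModule I φ).comp 𝔪) := by
  by_cases hI : I ≤ residueKer 𝔪
  · have hφ : gp φ - 1 ∉ 𝔪 := fun hφ =>
      h (sup_le hI (Subgroup.zpowers_le.2 (mem_residueKer.2 hφ)))
    refine memP_comp_of_smul_eq_zero h𝔪 _
      (n := ((1 + Nat.card Γ : ℕ) : MonoidAlgebra ℤ Γ) - gp φ) (fun hn => hφ ?_)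
      (smul_cyclicModule_eq_zero (Ideal.mem_sup_right (Ideal.mem_span_singleton_self _)))
    have h1 : gp φ - 1 = (Nat.card Γ : MonoidAlgebra ℤ Γ) -
        (((1 + Nat.card Γ : ℕ) : MonoidAlgebra ℤ Γ) - gp φ) := by
      push_cast
      ring
    rw [h1]
    exact sub_mem hm hn
  · obtain ⟨i, hi, him⟩ := Set.not_subset.1 hI
    refine memP_comp_of_smul_eq_zero h𝔪 _ (n := gp i - 1) (fun hn => him (mem_residueKer.2 hn))
      (smul_cyclicModule_eq_zero (Ideal.mem_sup_left (gp_sub_one_mem_augIdeal hi)))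

/-- If `#I` is invertible at `𝔪`, the component of `A_{I,φ}` is a direct summand of
`ℤ[Γ] / (1 + #Γ - φ)`. -/
theorem memP_comp_relModule_of_card_notMem {𝔪 : Ideal (MonoidAlgebra ℤ Γ)} (h𝔪 : 𝔪.IsMaximal)
    (I : Subgroup Γ) (φ : Γ) (h : (Nat.card I : MonoidAlgebra ℤ Γ) ∉ 𝔪) :
    MemP (MonoidAlgebra ℤ Γ) ((relModule I φ).comp 𝔪) := by
  set g : MonoidAlgebra ℤ Γ := ((1 + Nat.card Γ : ℕ) : MonoidAlgebra ℤ Γ) - gp φ with hg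
  let X := relModule I φ
  have := X.finite
  obtain ⟨k, hk⟩ := exists_pow_smul_primarySub h𝔪 X.torsion
  obtain ⟨s, hs, hsX⟩ := exists_smul_mem_primarySub h𝔪 X.torsion k
  have h1 : 𝔪 ⊔ Ideal.span {(Nat.card I : MonoidAlgebra ℤ Γ)} = ⊤ := by
    by_contra hne
    have h2 := h𝔪.eq_of_le hne le_sup_left
    exact h (h2 ▸ Ideal.mem_sup_right (Ideal.mem_span_singleton_self _))
  obtain ⟨a, ha, b', hb', hab⟩ := Submodule.mem_sup.1
    ((Ideal.eq_top_iff_one _).1 (Ideal.pow_sup_eq_top (n := k) h1))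
  obtain ⟨b, rfl⟩ := Ideal.mem_span_singleton.1 hb'
  have hle : relIdeal I φ ≤
      Submodule.comap (LinearMap.mulLeft (MonoidAlgebra ℤ Γ) (b * normElt I)) (Ideal.span {g}) := by
    refine sup_le ?_ ?_
    · intro x hx
      change b * normElt I * x ∈ Ideal.span {g}
      rw [mul_assoc, mul_comm _ x, mul_normElt_of_mem hx, mul_zero]
      exact zero_mem _
    · intro x hx
      exact Ideal.mul_mem_left _ _ hx
  have hle' : Ideal.span {g} ≤ relIdeal I φ := le_sup_right
  let i : (MonoidAlgebra ℤ Γ ⧸ relIdeal I φ) →ₗ[MonoidAlgebra ℤ Γ]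
    (MonoidAlgebra ℤ Γ ⧸ Ideal.span {g}) := Submodule.mapQ _ _ _ hle
  let r : (MonoidAlgebra ℤ Γ ⧸ Ideal.span {g}) →ₗ[MonoidAlgebra ℤ Γ]
    (MonoidAlgebra ℤ Γ ⧸ relIdeal I φ) := Submodule.factor hle'
  have hri : ∀ x : X, r (i x) = (b * Nat.card I) • x := by
    intro x
    obtain ⟨c, rfl⟩ := Submodule.mkQ_surjective _ x
    change (Submodule.Quotient.mk (b * normElt I * c) : _ ⧸ relIdeal I φ) =
      Submodule.Quotient.mk (b * Nat.card I * c)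
    rw [Submodule.Quotient.eq]
    have h2 : b * normElt I * c - b * Nat.card I * c =
      (b * c) * (normElt I - Nat.card I) := by ring
    rw [h2]
    exact Ideal.mul_mem_left _ _ (Ideal.mem_sup_left (normElt_sub_card_mem I))
  refine (memP_quotient_span (natCast_sub_gp_mem_nonZeroDivisors two_le_one_add_card φ)).of_retract
    (i ∘ₗ Submodule.subtype _) ((LinearMap.codRestrict _ (LinearMap.lsmul _ X s) hsX) ∘ₗ r) ?_
  apply LinearMap.ext
  rintro ⟨x, hx⟩
  refine Subtype.ext ?_
  change s • r (i x) = x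
  rw [hri]
  have h2 : a • x = 0 := hk x hx a ha
  have h3 : (1 - s) • x = 0 := hk x hx _ hs
  have h4 : (b * Nat.card I) • x = x := by
    have h5 : b * (Nat.card I : MonoidAlgebra ℤ Γ) = 1 - a := by rw [← hab]; ring
    rw [h5, sub_smul, one_smul, h2, sub_zero]
  rw [h4]
  rw [sub_smul, one_smul, sub_eq_zero] at h3
  exact h3.symm

/-- Cyclic modules whose annihilators agree up to an element outside `𝔪` have isomorphic
components at `𝔪`. -/
theorem nonempty_comp_equiv_of_le {𝔪 : Ideal (MonoidAlgebra ℤ Γ)} (h𝔪 : 𝔪.IsMaximal)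
    {𝔞 𝔠 : Ideal (MonoidAlgebra ℤ Γ)} (hle : 𝔞 ≤ 𝔠) (ha : ∃ g ∈ 𝔞, g ∈ (MonoidAlgebra ℤ Γ)⁰)
    (hc : ∃ g ∈ 𝔠, g ∈ (MonoidAlgebra ℤ Γ)⁰) {n : MonoidAlgebra ℤ Γ} (hn : n ∉ 𝔪)
    (hnc : ∀ x ∈ 𝔠, n * x ∈ 𝔞) :
    Nonempty ((cyclicModule 𝔞 ha).comp 𝔪 ≃ₗ[MonoidAlgebra ℤ Γ] (cyclicModule 𝔠 hc).comp 𝔪) := by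
  let π : (MonoidAlgebra ℤ Γ ⧸ 𝔞) →ₗ[MonoidAlgebra ℤ Γ] (MonoidAlgebra ℤ Γ ⧸ 𝔠) :=
    Submodule.factor hle
  have := (cyclicModule 𝔞 ha).finite
  refine ⟨LinearEquiv.ofBijective (primaryMap 𝔪 π) ⟨?_,
    primaryMap_surjective h𝔪 (cyclicModule 𝔞 ha).torsion π (Submodule.factor_surjective hle)⟩⟩
  rw [← LinearMap.ker_eq_bot, eq_bot_iff]
  rintro ⟨x, hx⟩ h0
  have h1 : π x = 0 := congrArg Subtype.val h0
  have h2 : n • x = 0 := by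
    obtain ⟨r, rfl⟩ := Submodule.mkQ_surjective _ x
    change (Submodule.Quotient.mk r : _ ⧸ 𝔠) = 0 at h1
    rw [Submodule.Quotient.mk_eq_zero] at h1
    change (Submodule.Quotient.mk (n * r) : _ ⧸ 𝔞) = 0
    rw [Submodule.Quotient.mk_eq_zero]
    exact hnc r h1
  exact Subtype.ext (eq_zero_of_mem_primarySub h𝔪 hx hn h2)

/-- If `I` and `φ` act trivially on the residue field of characteristic `p`, the component of
`A_{I,φ}` only involves the `p`-parts of `I` and `φ`. -/
theorem shiftClass_comp_relModule {𝔪 : Ideal (MonoidAlgebra ℤ Γ)} (h𝔪 : 𝔪.IsMaximal)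
    {p : ℕ} (hpm : (p : MonoidAlgebra ℤ Γ) ∈ 𝔪) {e : Γ →* Γ} (he : IsPrimaryProj p e)
    (I : Subgroup Γ) (φ : Γ) (h : I ⊔ Subgroup.zpowers φ ≤ residueKer 𝔪) :
    shiftClass ((relModule I φ).comp 𝔪) = shiftClass ((relModule (I.map e) (e φ)).comp 𝔪) := by
  -- `D'` is the prime-to-`p` part of `⟨I, φ⟩`; its norm element is invertible at `𝔪`.
  set D' : Subgroup Γ := (I ⊔ Subgroup.zpowers φ) ⊓ e.ker with hD'
  have hN : normElt D' ∉ 𝔪 := by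
    intro hmem
    have h1 : (Nat.card D' : MonoidAlgebra ℤ Γ) ∈ 𝔪 := by
      have h2 := sub_mem hmem (augIdeal_le_of_le_residueKer (inf_le_left.trans h)
        (normElt_sub_card_mem D'))
      rwa [sub_sub_cancel] at h2
    have hcop : (Nat.card D').Coprime p :=
      Nat.Coprime.symm ((Nat.Prime.coprime_iff_not_dvd he.prime).2
        (he.not_dvd_card_of_le_ker inf_le_right))
    have h3 := Nat.isCoprime_iff_coprime.2 hcop
    obtain ⟨a, b, hab⟩ := h3
    apply h𝔪.ne_top
    rw [Ideal.eq_top_iff_one]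
    have h4 : (1 : MonoidAlgebra ℤ Γ) = a * (Nat.card D' : MonoidAlgebra ℤ Γ) + b * p := by
      exact_mod_cast congrArg (Int.cast : ℤ → MonoidAlgebra ℤ Γ) hab.symm
    rw [h4]
    exact add_mem (Ideal.mul_mem_left _ _ h1) (Ideal.mul_mem_left _ _ hpm)
  have hkill : ∀ 𝔞 : Ideal (MonoidAlgebra ℤ Γ), ∀ x ∈ 𝔞 ⊔ augIdeal D', normElt D' * x ∈ 𝔞 := by
    intro 𝔞 x hx
    obtain ⟨y, hy, z, hz, rfl⟩ := Submodule.mem_sup.1 hx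
    rw [mul_add, mul_comm _ z, mul_normElt_of_mem hz, add_zero]
    exact Ideal.mul_mem_left _ _ hy
  have hφD : φ * (e φ)⁻¹ ∈ D' := by
    refine Subgroup.mem_inf.2 ⟨Subgroup.mul_mem _ (Subgroup.mem_sup_right (Subgroup.mem_zpowers φ))
      (Subgroup.inv_mem _ ?_), he.mul_inv_mem_ker φ⟩
    exact he.map_le _ ⟨φ, Subgroup.mem_sup_right (Subgroup.mem_zpowers φ), rfl⟩
  have hφ : gp φ - gp (e φ) ∈ augIdeal D' := by
    have h1 : gp φ - gp (e φ) = gp (e φ) * (gp (φ * (e φ)⁻¹) - 1) := by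
      rw [mul_sub, mul_one, ← gp_mul, mul_comm φ, mul_inv_cancel_left]
    rw [h1]
    exact Ideal.mul_mem_left _ _ (gp_sub_one_mem_augIdeal hφD)
  have hsup : relIdeal I φ ⊔ augIdeal D' = relIdeal (I.map e) (e φ) ⊔ augIdeal D' := by
    apply le_antisymm
    · refine sup_le (sup_le ?_ ((Ideal.span_singleton_le_iff_mem _).2 ?_)) le_sup_right
      · rw [augIdeal_eq_span, Ideal.span_le]
        rintro _ ⟨i, hi, rfl⟩
        have h1 : i * (e i)⁻¹ ∈ D' := Subgroup.mem_inf.2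
          ⟨Subgroup.mul_mem _ (Subgroup.mem_sup_left hi) (Subgroup.inv_mem _
            (Subgroup.mem_sup_left (he.map_le I ⟨i, hi, rfl⟩))), he.mul_inv_mem_ker i⟩
        have h2 : gp i - 1 = gp (e i) * (gp (i * (e i)⁻¹) - 1) + (gp (e i) - 1) := by
          rw [mul_sub, mul_one, ← gp_mul, mul_comm i, mul_inv_cancel_left]
          ring
        rw [h2]
        exact add_mem (Ideal.mem_sup_right
          (Ideal.mul_mem_left _ _ (gp_sub_one_mem_augIdeal h1)))
          (Ideal.mem_sup_left (Ideal.mem_sup_left (gp_sub_one_mem_augIdeal ⟨i, hi, rfl⟩)))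
      · have h1 : ((1 + Nat.card Γ : ℕ) : MonoidAlgebra ℤ Γ) - gp φ =
          (((1 + Nat.card Γ : ℕ) : MonoidAlgebra ℤ Γ) - gp (e φ)) +
            -(gp φ - gp (e φ)) := by ring
        rw [h1]
        exact add_mem (Ideal.mem_sup_left (Ideal.mem_sup_right (Ideal.mem_span_singleton_self _)))
          (Ideal.mem_sup_right (neg_mem hφ))
    · refine sup_le (sup_le ?_ ((Ideal.span_singleton_le_iff_mem _).2 ?_)) le_sup_right
      · exact (augIdeal_mono (he.map_le I)).trans (le_sup_left.trans le_sup_left)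
      · have h1 : ((1 + Nat.card Γ : ℕ) : MonoidAlgebra ℤ Γ) - gp (e φ) =
          (((1 + Nat.card Γ : ℕ) : MonoidAlgebra ℤ Γ) - gp φ) +
            (gp φ - gp (e φ)) := by ring
        rw [h1]
        exact add_mem (Ideal.mem_sup_left (Ideal.mem_sup_right (Ideal.mem_span_singleton_self _)))
          (Ideal.mem_sup_right hφ)
  have hc1 := exists_regular_of_le (le_sup_left : relIdeal I φ ≤ relIdeal I φ ⊔ augIdeal D')
    (exists_regular_relIdeal I φ)
  have hle2 : relIdeal (I.map e) (e φ) ≤ relIdeal I φ ⊔ augIdeal D' := by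
    rw [hsup]
    exact le_sup_left
  obtain ⟨e1⟩ := nonempty_comp_equiv_of_le h𝔪 le_sup_left (exists_regular_relIdeal I φ) hc1 hN
    (hkill _)
  obtain ⟨e2⟩ := nonempty_comp_equiv_of_le h𝔪 hle2 (exists_regular_relIdeal (I.map e) (e φ)) hc1 hN
    (by rw [hsup]; exact hkill _)
  exact shiftClass_congr (X := (relModule I φ).comp 𝔪) (X' := (relModule (I.map e) (e φ)).comp 𝔪)
    (e1.trans e2.symm)

/-- The class of the shift of `A_{I,φ}` attached to a pair `(I, D)` in `𝒮`. -/
def SetS.shift (s : SetS Γ) : Classes (MonoidAlgebra ℤ Γ) := shiftClass (relModule s.I s.gen)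

theorem compHom_shift {𝔪 : Ideal (MonoidAlgebra ℤ Γ)} (h𝔪 : 𝔪.IsMaximal) (s : SetS Γ) :
    compHom h𝔪 s.shift = shiftClass ((relModule s.I s.gen).comp 𝔪) := by
  obtain ⟨Y, hY⟩ := exists_isShift_relModule s.I s.gen
  exact compHom_shiftClass h𝔪 hY

theorem compHom_shift_eq_zero {𝔪 : Ideal (MonoidAlgebra ℤ Γ)} (h𝔪 : 𝔪.IsMaximal) (s : SetS Γ)
    (h : MemP (MonoidAlgebra ℤ Γ) ((relModule s.I s.gen).comp 𝔪)) :
    compHom h𝔪 s.shift = 0 := by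
  rw [compHom_shift]
  obtain ⟨Y, hY⟩ := exists_isShift_relModule s.I s.gen
  exact shiftClass_eq_zero_of_memP (hY.comp h𝔪) h

theorem compHom_shift_eq {𝔪 : Ideal (MonoidAlgebra ℤ Γ)} (h𝔪 : 𝔪.IsMaximal)
    {p : ℕ} (hp : p.Prime) (hpm : (p : MonoidAlgebra ℤ Γ) ∈ 𝔪) {s t : SetS Γ}
    (hs : s.D ≤ residueKer 𝔪) (ht : t.D ≤ residueKer 𝔪) (hI : pPart p s.I = pPart p t.I)
    (hD : pPart p s.D = pPart p t.D) : compHom h𝔪 s.shift = compHom h𝔪 t.shift := by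
  obtain ⟨e, he⟩ := exists_isPrimaryProj (G := Γ) hp
  rw [he.pPart_eq_iff] at hI hD
  rw [s.D_eq] at hs hD
  rw [t.D_eq] at ht hD
  rw [compHom_shift, compHom_shift, shiftClass_comp_relModule h𝔪 hpm he _ _ hs,
    shiftClass_comp_relModule h𝔪 hpm he _ _ ht]
  obtain ⟨Y, hY⟩ := exists_isShift_relModule (s.I.map e) (e s.gen)
  obtain ⟨Z, hZ⟩ := exists_isShift_relModule (t.I.map e) (e t.gen)
  rw [← compHom_shiftClass h𝔪 hY, ← compHom_shiftClass h𝔪 hZ, ← hI]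
  congr 1
  apply shiftClass_relModule_eq
  rwa [Subgroup.map_sup, Subgroup.map_sup, MonoidHom.map_zpowers, MonoidHom.map_zpowers,
    ← hI] at hD

/-- The monoid homomorphism `ℕ^𝒮 → 𝒞/∼` with image `𝒵^adm`. -/
def shiftHom (Γ : Type u) [CommGroup Γ] [Finite Γ] :
    (SetS Γ →₀ ℕ) →+ Classes (MonoidAlgebra ℤ Γ) :=
  (Finsupp.linearCombination ℕ (SetS.shift (Γ := Γ))).toAddMonoidHom

theorem shiftHom_single (s : SetS Γ) (n : ℕ) : shiftHom Γ (Finsupp.single s n) = n • s.shift :=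
  Finsupp.linearCombination_single ℕ n s

open scoped Classical in
theorem beta_single (s : SetS Γ) (n : ℕ) [Fintype (SetT Γ)] :
    beta Γ (Finsupp.single s n) = n • ∑ t : SetT Γ with
      s.D ≤ t.H ∧ pPart t.p s.I = t.I ∧ pPart t.p s.D = t.D, Finsupp.single t 1 := by
  refine (Finsupp.linearCombination_single ℕ n s).trans ?_
  congr!

/-- Every component of `∑ c_s [ω¹(A_s)]` factors through `β`. -/
theorem exists_compHom_shiftHom {𝔪 : Ideal (MonoidAlgebra ℤ Γ)} (h𝔪 : 𝔪.IsMaximal) :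
    ∃ F : (SetT Γ →₀ ℕ) →+ Classes (MonoidAlgebra ℤ Γ),
      ∀ c, compHom h𝔪 (shiftHom Γ c) = F (beta Γ c) := by
  classical
  let := Fintype.ofFinite (SetT Γ)
  by_cases hex : ∃ p : ℕ, p.Prime ∧ (p : MonoidAlgebra ℤ Γ) ∈ 𝔪
  · obtain ⟨p, hp, hpm⟩ := hex
    obtain ⟨e, he⟩ := exists_isPrimaryProj (G := Γ) hp
    have hcard : ∀ n : ℕ, ¬ p ∣ n → (n : MonoidAlgebra ℤ Γ) ∉ 𝔪 := by
      intro n hn hnm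
      have hcop : n.Coprime p := Nat.Coprime.symm ((Nat.Prime.coprime_iff_not_dvd hp).2 hn)
      obtain ⟨a, b, hab⟩ := Nat.isCoprime_iff_coprime.2 hcop
      apply h𝔪.ne_top
      rw [Ideal.eq_top_iff_one]
      have h4 : (1 : MonoidAlgebra ℤ Γ) = a * (n : MonoidAlgebra ℤ Γ) + b * p := by
        exact_mod_cast congrArg (Int.cast : ℤ → MonoidAlgebra ℤ Γ) hab.symm
      rw [h4]
      exact add_mem (Ideal.mul_mem_left _ _ hnm) (Ideal.mul_mem_left _ _ hpm)
    let P : SetT Γ → SetS Γ → Prop := fun t s =>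
      s.D ≤ t.H ∧ pPart t.p s.I = t.I ∧ pPart t.p s.D = t.D
    let g : SetT Γ → Classes (MonoidAlgebra ℤ Γ) := fun t =>
      if t.p = p ∧ t.H = residueKer 𝔪 then
        if h : ∃ s, P t s then compHom h𝔪 h.choose.shift else 0
      else 0
    have hg : ∀ t s, P t s → t.p = p → t.H = residueKer 𝔪 → g t = compHom h𝔪 s.shift := by
      intro t s hts h1 h2
      have h3 : ∃ s, P t s := ⟨s, hts⟩
      have h4 := h3.choose_spec
      simp only [g]
      rw [if_pos ⟨h1, h2⟩, dif_pos h3]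
      refine compHom_shift_eq h𝔪 hp hpm (h4.1.trans h2.le) (hts.1.trans h2.le) ?_ ?_
      · rw [← h1]
        exact h4.2.1.trans hts.2.1.symm
      · rw [← h1]
        exact h4.2.2.trans hts.2.2.symm
    have hsum : ∀ s, compHom h𝔪 s.shift = ∑ t with P t s, g t := by
      intro s
      by_cases hs : s.D ≤ residueKer 𝔪 ∧ pPart p s.I ≠ ⊥
      · let t0 : SetT Γ :=
          { p := p
            prime := hp
            H := residueKer 𝔪
            cyclic_quotient := isCyclic_quotient_residueKer h𝔪
            coprime := coprime_card_quotient_residueKer h𝔪 hp hpm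
            I := pPart p s.I
            D := pPart p s.D
            le := Subgroup.map_mono s.le
            ne_bot := hs.2
            cyclic := isCyclic_pPart s p }
        have ht0 : P t0 s := ⟨hs.1, rfl, rfl⟩
        rw [Finset.sum_eq_single_of_mem t0 (by simpa using ht0), hg t0 s ht0 rfl rfl]
        intro t ht hne
        have hts : P t s := by simpa using ht
        refine if_neg ?_
        rintro ⟨h1, h2⟩
        exact hne (SetT.ext_of_pPart h1 h2 hts.2.1 rfl hts.2.2 rfl)
      · rw [Finset.sum_eq_zero]
        · apply compHom_shift_eq_zero
          by_cases hD : s.D ≤ residueKer 𝔪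
          · have hbot : pPart p s.I = ⊥ := by
              by_contra hne
              exact hs ⟨hD, hne⟩
            rw [he.pPart_eq_bot_iff, Subgroup.map_eq_bot_iff] at hbot
            exact memP_comp_relModule_of_card_notMem h𝔪 _ _
              (hcard _ (he.not_dvd_card_of_le_ker hbot))
          · by_cases hdvd : p ∣ Nat.card Γ
            · refine memP_comp_relModule_of_not_le h𝔪 ?_ _ _ (by rwa [← s.D_eq])
              obtain ⟨a, ha⟩ := hdvd
              rw [ha]
              push_cast
              exact Ideal.mul_mem_right _ _ hpm
            · exact memP_comp_relModule_of_card_notMem h𝔪 _ _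
                (hcard _ fun h => hdvd (h.trans s.I.card_subgroup_dvd_card))
        · intro t ht
          have hts : P t s := by simpa using ht
          refine if_neg ?_
          rintro ⟨rfl, h2⟩
          refine hs ⟨hts.1.trans h2.le, ?_⟩
          rw [hts.2.1]
          exact t.ne_bot
    refine ⟨(Finsupp.linearCombination ℕ g).toAddMonoidHom, fun c => ?_⟩
    induction c using Finsupp.induction_linear with
    | zero => simp
    | add a b ha hb => rw [map_add, map_add, map_add, map_add, ha, hb]
    | single s n =>
      rw [shiftHom_single, beta_single, map_nsmul, map_nsmul, hsum s, map_sum]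
      congr 1
      refine Finset.sum_congr rfl fun t _ => ?_
      exact ((Finsupp.linearCombination_single ℕ 1 t).trans (one_smul ℕ (g t))).symm
  · refine ⟨0, fun c => ?_⟩
    have hcard : ∀ n : ℕ, n ≠ 0 → (n : MonoidAlgebra ℤ Γ) ∉ 𝔪 := by
      intro n
      induction n using Nat.recOnMul with
      | zero => exact fun h => absurd rfl h
      | one =>
        intro _ h
        rw [Nat.cast_one] at h
        exact h𝔪.ne_top ((Ideal.eq_top_iff_one _).2 h)
      | prime p hp => exact fun _ h => hex ⟨p, hp, h⟩
      | mul a b ha hb =>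
        intro hab h
        rw [Nat.cast_mul] at h
        rcases h𝔪.isPrime.mem_or_mem h with h | h
        · exact ha (left_ne_zero_of_mul hab) h
        · exact hb (right_ne_zero_of_mul hab) h
    induction c using Finsupp.induction_linear with
    | zero => simp
    | add a b ha hb => rw [map_add, map_add, map_add, map_add, ha, hb]
    | single s n =>
      rw [shiftHom_single, map_nsmul, compHom_shift_eq_zero h𝔪 s, smul_zero]
      · rfl
      · exact memP_comp_relModule_of_card_notMem h𝔪 _ _ (hcard _ Nat.card_pos.ne')

theorem shiftHom_eq_of_beta_eq {c d : SetS Γ →₀ ℕ} (h : beta Γ c = beta Γ d) :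
    shiftHom Γ c = shiftHom Γ d := by
  refine eq_of_compHom_eq fun 𝔪 h𝔪 => ?_
  obtain ⟨F, hF⟩ := exists_compHom_shiftHom h𝔪
  rw [hF, hF, h]

theorem mrange_shiftHom : AddMonoidHom.mrange (shiftHom Γ) = Zadm Γ := by
  have h1 : AddMonoidHom.mrange (shiftHom Γ) = AddSubmonoid.closure (Set.range SetS.shift) := by
    apply le_antisymm
    · rintro _ ⟨c, rfl⟩
      induction c using Finsupp.induction_linear with
      | zero => rw [map_zero]; exact zero_mem _
      | add a b ha hb => rw [map_add]; exact add_mem ha hb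
      | single s n =>
        rw [shiftHom_single]
        exact AddSubmonoid.nsmul_mem _ (AddSubmonoid.subset_closure (Set.mem_range_self s)) n
    · rw [AddSubmonoid.closure_le]
      rintro _ ⟨s, rfl⟩
      exact AddMonoidHom.mem_mrange.2 ⟨Finsupp.single s 1, by rw [shiftHom_single, one_smul]⟩
  rw [h1, Zadm]
  congr 1
  ext c
  constructor
  · rintro ⟨s, rfl⟩
    obtain ⟨Y, hY⟩ := exists_isShift_moduleA s.I ((s.gen : Γ ⧸ s.I)⁻¹)
    refine ⟨s.I, (s.gen : Γ ⧸ s.I)⁻¹, s.ne_bot, s.elementary, Y, hY, ?_⟩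
    rw [← hY.shiftClass_eq, shiftClass_moduleA]
    rfl
  · rintro ⟨I, φ, hI, hel, Y, hY, rfl⟩
    obtain ⟨ψ, hψ⟩ := QuotientGroup.mk_surjective φ⁻¹
    obtain rfl : φ = (ψ : Γ ⧸ I)⁻¹ := by rw [hψ, inv_inv]
    let s : SetS Γ :=
      { I := I
        D := I ⊔ Subgroup.zpowers ψ
        le := le_sup_left
        ne_bot := hI
        elementary := hel
        cyclic := (isCyclic_quotient_iff le_sup_left).2 ⟨ψ, rfl⟩ }
    refine ⟨s, ?_⟩
    rw [← hY.shiftClass_eq, shiftClass_moduleA]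
    exact shiftClass_relModule_eq I s.gen ψ s.D_eq.symm

end LocalComparison

/-! ### Cohomological triviality of the modules in `𝒫` -/

section RelProj

variable {G : Type u} [CommGroup G]

/-- `M` is relatively projective with respect to the trivial subgroup of `K`, in the form of a
decomposition `M = ⨁ κ, T κ M` permuted simply transitively by `K`. -/
def RelProj (K : Subgroup G) (M : Type u) [AddCommGroup M] [Module (MonoidAlgebra ℤ G) M] : Prop :=
  ∃ T : K → M →+ M, (∀ [Fintype K] x, ∑ κ, T κ x = x) ∧
    ∀ (σ κ : K) (x : M), gp (σ : G) • T κ x = T (σ * κ) (gp (σ : G) • x)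

theorem RelProj.of_retract {K : Subgroup G} {M N : Type u} [AddCommGroup M]
    [Module (MonoidAlgebra ℤ G) M] [AddCommGroup N] [Module (MonoidAlgebra ℤ G) N]
    (h : RelProj K N) (i : M →ₗ[MonoidAlgebra ℤ G] N) (r : N →ₗ[MonoidAlgebra ℤ G] M)
    (hri : ∀ x, r (i x) = x) : RelProj K M := by
  obtain ⟨T, h1, h2⟩ := h
  refine ⟨fun κ => r.toAddMonoidHom.comp ((T κ).comp i.toAddMonoidHom), fun {_} x => ?_,
    fun σ κ x => ?_⟩
  · change ∑ κ, r (T κ (i x)) = x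
    rw [← map_sum, h1, hri]
  · change gp (σ : G) • r (T κ (i x)) = r (T (σ * κ) (i (gp (σ : G) • x)))
    rw [← map_smul r, h2, map_smul i]

/-- The group ring decomposes according to the components in `K` of the elements of `G`, relative to
a system of coset representatives. -/
theorem relProj_self (K : Subgroup G) : RelProj K (MonoidAlgebra ℤ G) := by
  classical
  -- The component in `K` of an element of `G`, for a fixed system of coset representatives.
  let c : G → K := fun g => ⟨((g : G ⧸ K).out)⁻¹ * g, QuotientGroup.eq.1 (QuotientGroup.out_eq' _)⟩
  have hc : ∀ (σ : K) (g : G), c (σ * g) = σ * c g := by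
    intro σ g
    apply Subtype.ext
    have h1 : (((σ : G) * g : G) : G ⧸ K) = g := by
      rw [QuotientGroup.mk_mul, (QuotientGroup.eq_one_iff (σ : G)).2 σ.2, one_mul]
    change ((((σ : G) * g : G) : G ⧸ K).out)⁻¹ * (σ * g) = σ * (((g : G ⧸ K).out)⁻¹ * g)
    rw [h1, mul_left_comm]
  let T : K → MonoidAlgebra ℤ G →+ MonoidAlgebra ℤ G := fun κ =>
    (Finsupp.liftAddHom fun g => if c g = κ then MonoidAlgebra.singleAddHom g else 0).comp
      (MonoidAlgebra.coeffAddEquiv (R := ℤ) (M := G)).toAddMonoidHom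
  have hT : ∀ κ g n, T κ (MonoidAlgebra.single g n) =
      if c g = κ then MonoidAlgebra.single g n else 0 := by
    intro κ g n
    change Finsupp.liftAddHom _ (Finsupp.single g n) = _
    rw [Finsupp.liftAddHom_apply_single]
    split_ifs <;> rfl
  refine ⟨T, fun {_} x => ?_, fun σ κ x => ?_⟩
  · induction x using MonoidAlgebra.induction_linear with
    | zero => simp
    | add a b ha hb => simp_rw [map_add, Finset.sum_add_distrib, ha, hb]
    | single g n => simp_rw [hT]; simp
  · induction x using MonoidAlgebra.induction_linear with
    | zero => simp
    | add a b ha hb => rw [map_add, smul_add, smul_add, map_add, ha, hb]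
    | single g n =>
      rw [hT, smul_eq_mul, smul_eq_mul, gp, MonoidAlgebra.of_apply, MonoidAlgebra.single_mul_single,
        hT, hc]
      simp_rw [mul_right_inj]
      split_ifs
      · rw [MonoidAlgebra.single_mul_single]
      · rw [mul_zero]

theorem RelProj.finsupp (K : Subgroup G) (ι : Type u) : RelProj K (ι →₀ MonoidAlgebra ℤ G) := by
  obtain ⟨T, h1, h2⟩ := relProj_self K
  refine ⟨fun κ => Finsupp.mapRange.addMonoidHom (T κ), fun {_} x => ?_, fun σ κ x => ?_⟩
  · ext1 i
    rw [Finsupp.finsetSum_apply]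
    exact h1 _
  · ext1 i
    exact h2 σ κ (x i)

theorem RelProj.of_projective (K : Subgroup G) (M : Type u) [AddCommGroup M]
    [Module (MonoidAlgebra ℤ G) M] [h : Module.Projective (MonoidAlgebra ℤ G) M] :
    RelProj K M := by
  obtain ⟨s, hs⟩ := h.out
  exact (RelProj.finsupp K M).of_retract s _ hs

variable [Finite G]

theorem normElt_smul {M : Type u} [AddCommGroup M] [Module (MonoidAlgebra ℤ G) M]
    (K : Subgroup G) [Fintype K] (x : M) : normElt K • x = ∑ k : K, gp (k : G) • x := by
  rw [normElt_eq, Finset.sum_smul]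

variable {K : Subgroup G} {M : Type u} [AddCommGroup M] [Module (MonoidAlgebra ℤ G) M]

theorem RelProj.exists_norm_smul (h : RelProj K M) {x : M}
    (hx : ∀ σ : K, gp (σ : G) • x = x) : ∃ y : M, normElt K • y = x := by
  let := Fintype.ofFinite K
  obtain ⟨T, h1, h2⟩ := h
  refine ⟨T 1 x, ?_⟩
  rw [normElt_smul]
  simp_rw [h2, hx, mul_one]
  exact h1 x

theorem RelProj.mem_augIdeal_smul (h : RelProj K M) {x : M} (hx : normElt K • x = 0) :
    x ∈ augIdeal K • (⊤ : Submodule (MonoidAlgebra ℤ G) M) := by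
  let := Fintype.ofFinite K
  obtain ⟨T, h1, h2⟩ := h
  have h3 : ∑ σ : K, gp (σ : G) • T σ⁻¹ x = 0 := by
    simp_rw [h2, mul_inv_cancel]
    rw [← map_sum, ← normElt_smul, hx, map_zero]
  have h4 : ∑ σ : K, T σ⁻¹ x = x := by
    rw [← h1 x]
    exact Fintype.sum_equiv (Equiv.inv K) _ _ fun σ => by rw [h1 x]; rfl
  have h5 : x = - ∑ σ : K, (gp (σ : G) - 1) • T σ⁻¹ x := by
    simp_rw [sub_smul, Finset.sum_sub_distrib, h3, one_smul, h4, zero_sub, neg_neg]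
  rw [h5]
  exact neg_mem (sum_mem fun σ _ => Submodule.smul_mem_smul (gp_sub_one_mem_augIdeal σ.2) trivial)

theorem RelProj.exists_coboundary (h : RelProj K M) {c : K → M}
    (hc : ∀ σ τ : K, c (σ * τ) = c σ + gp (σ : G) • c τ) :
    ∃ y : M, ∀ σ : K, c σ = gp (σ : G) • y - y := by
  let := Fintype.ofFinite K
  obtain ⟨T, h1, h2⟩ := h
  refine ⟨-∑ ρ : K, T ρ (c ρ), fun σ => ?_⟩
  have h3 : ∑ ρ : K, T (σ * ρ) (c (σ * ρ)) = ∑ ρ : K, T ρ (c ρ) :=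
    Fintype.sum_equiv (Equiv.mulLeft σ) _ _ fun _ => rfl
  have h4 : ∑ ρ : K, T (σ * ρ) (c σ) = c σ :=
    (Fintype.sum_equiv (Equiv.mulLeft σ) _ _ fun _ => rfl).trans (h1 (c σ))
  rw [smul_neg, Finset.smul_sum, ← h3]
  simp_rw [h2, hc, map_add, Finset.sum_add_distrib, h4]
  abel

/-- Vanishing of the second cohomology group. -/
theorem RelProj.exists_coboundary₂ (h : RelProj K M) {f : K → K → M}
    (hf : ∀ σ τ ρ : K, gp (σ : G) • f τ ρ - f (σ * τ) ρ + f σ (τ * ρ) - f σ τ = 0) :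
    ∃ g : K → M, ∀ σ τ : K, f σ τ = g σ + gp (σ : G) • g τ - g (σ * τ) := by
  let := Fintype.ofFinite K
  obtain ⟨T, h1, h2⟩ := h
  refine ⟨fun σ => ∑ ρ : K, T (σ * ρ) (f σ ρ), fun σ τ => ?_⟩
  have h3 : ∑ ρ : K, T (σ * (τ * ρ)) (f σ (τ * ρ)) = ∑ ρ : K, T (σ * ρ) (f σ ρ) :=
    Fintype.sum_equiv (Equiv.mulLeft τ) _ _ fun _ => rfl
  have h4 : ∑ ρ : K, T (σ * (τ * ρ)) (f σ τ) = f σ τ :=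
    (Fintype.sum_equiv ((Equiv.mulLeft τ).trans (Equiv.mulLeft σ)) _ (fun ρ => T ρ (f σ τ))
      fun _ => rfl).trans (h1 _)
  change f σ τ = ∑ ρ : K, T (σ * ρ) (f σ ρ) + gp (σ : G) • ∑ ρ : K, T (τ * ρ) (f τ ρ) -
    ∑ ρ : K, T (σ * τ * ρ) (f (σ * τ) ρ)
  rw [← h3, Finset.smul_sum]
  conv_lhs => rw [← h4]
  simp_rw [h2, mul_assoc]
  rw [← Finset.sum_add_distrib, ← Finset.sum_sub_distrib]
  refine Finset.sum_congr rfl fun ρ _ => ?_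
  rw [← map_add, ← map_sub]
  congr 1
  have h5 := hf σ τ ρ
  rw [sub_eq_zero] at h5
  rw [← h5]
  abel

/-- The vanishing of the Tate cohomology groups of `K` with values in `M` in the degrees `-1`, `0`
and `1`. -/
structure CohTrivial (K : Subgroup G) (M : Type u) [AddCommGroup M]
    [Module (MonoidAlgebra ℤ G) M] : Prop where
  exists_norm_smul : ∀ {x : M}, (∀ σ : K, gp (σ : G) • x = x) → ∃ y : M, normElt K • y = x
  mem_augIdeal_smul : ∀ {x : M}, normElt K • x = 0 →
    x ∈ augIdeal K • (⊤ : Submodule (MonoidAlgebra ℤ G) M)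
  exists_coboundary : ∀ {c : K → M}, (∀ σ τ : K, c (σ * τ) = c σ + gp (σ : G) • c τ) →
    ∃ y : M, ∀ σ : K, c σ = gp (σ : G) • y - y

/-- Dimension shifting along a presentation of `M` by relatively projective modules. -/
theorem CohTrivial.of_exact {F F' : Type u} [AddCommGroup F] [Module (MonoidAlgebra ℤ G) F]
    [AddCommGroup F'] [Module (MonoidAlgebra ℤ G) F'] (hF : RelProj K F) (hF' : RelProj K F')
    (i : F' →ₗ[MonoidAlgebra ℤ G] F) (q : F →ₗ[MonoidAlgebra ℤ G] M)
    (hi : Function.Injective i) (he : Function.Exact i q) (hq : Function.Surjective q) :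
    CohTrivial K M where
  exists_norm_smul := by
    intro x hx
    obtain ⟨y, rfl⟩ := hq x
    have h1 : ∀ σ : K, ∃ z : F', i z = gp (σ : G) • y - y := fun σ =>
      (he _).1 (by rw [map_sub, map_smul, hx, sub_self])
    choose c hc using h1
    obtain ⟨z, hz⟩ := hF'.exists_coboundary (c := c) fun σ τ => hi (by
      rw [map_add, map_smul, hc, hc, hc, Subgroup.coe_mul, gp_mul, mul_smul, smul_sub]
      abel)
    obtain ⟨w, hw⟩ := hF.exists_norm_smul (x := y - i z) fun σ => by
      have h2 := congrArg i (hz σ)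
      rw [hc, map_sub, map_smul] at h2
      rw [smul_sub, sub_eq_sub_iff_sub_eq_sub, h2]
    refine ⟨q w, ?_⟩
    rw [← map_smul, hw, map_sub, he.apply_apply_eq_zero, sub_zero]
  mem_augIdeal_smul := by
    intro x hx
    obtain ⟨y, rfl⟩ := hq x
    obtain ⟨z, hz⟩ := (he (normElt K • y)).1 (by rw [map_smul, hx])
    obtain ⟨w, hw⟩ := hF'.exists_norm_smul (x := z) fun σ => hi (by
      rw [map_smul, hz, ← mul_smul, gp_mul_normElt σ.2])
    have h1 : y - i w ∈ augIdeal K • (⊤ : Submodule (MonoidAlgebra ℤ G) F) :=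
      hF.mem_augIdeal_smul (by rw [smul_sub, ← map_smul, hw, hz, sub_self])
    have h2 := Submodule.mem_map_of_mem (f := q) h1
    rw [Submodule.map_smul'', map_sub, he.apply_apply_eq_zero, sub_zero] at h2
    exact Submodule.smul_mono le_rfl le_top h2
  exists_coboundary := by
    intro c hc
    choose y hy using fun σ => hq (c σ)
    have h1 : ∀ σ τ : K, ∃ z : F', i z = y σ + gp (σ : G) • y τ - y (σ * τ) := fun σ τ =>
      (he _).1 (by rw [map_sub, map_add, map_smul, hy, hy, hy, hc, sub_self])
    choose f hf using h1
    obtain ⟨g, hg⟩ := hF'.exists_coboundary₂ (f := f) fun σ τ ρ => hi (by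
      rw [map_zero, map_sub, map_add, map_sub, map_smul, hf, hf, hf, hf, smul_sub, smul_add,
        ← mul_smul, ← gp_mul, ← Subgroup.coe_mul, mul_assoc]
      abel)
    obtain ⟨w, hw⟩ := hF.exists_coboundary (c := fun σ => y σ - i (g σ)) fun σ τ => by
      have h2 := congrArg i (hg σ τ)
      rw [hf, map_sub, map_add, map_smul] at h2
      change y (σ * τ) - i (g (σ * τ)) = y σ - i (g σ) + gp (σ : G) • (y τ - i (g τ))
      rw [smul_sub, ← sub_eq_zero]
      rw [← sub_eq_zero] at h2
      rw [← neg_eq_zero, ← h2]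
      abel
    refine ⟨q w, fun σ => ?_⟩
    have h3 := congrArg q (hw σ)
    rwa [map_sub, he.apply_apply_eq_zero, sub_zero, hy, map_sub, map_smul] at h3

theorem MemP.cohTrivial (h : MemP (MonoidAlgebra ℤ G) M) (K : Subgroup G) : CohTrivial K M := by
  have := h.exists_projective_ker
  let q := Finsupp.linearCombination (MonoidAlgebra ℤ G) (id : M → M)
  exact CohTrivial.of_exact (RelProj.finsupp K M) (RelProj.of_projective K (LinearMap.ker q))
    (LinearMap.ker q).subtype q (Submodule.subtype_injective _) q.exact_subtype_ker_map
    (Finsupp.linearCombination_id_surjective _ M)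

end RelProj

/-! ### Tate cohomology in degree zero as an invariant of classes -/

section Tate

variable {G : Type u} [CommGroup G]

/-- The `K`-invariants of `M`. -/
def invSub (K : Subgroup G) (M : Type u) [AddCommGroup M] [Module (MonoidAlgebra ℤ G) M] :
    Submodule (MonoidAlgebra ℤ G) M where
  carrier := {x | ∀ σ : K, gp (σ : G) • x = x}
  zero_mem' := fun _ => smul_zero _
  add_mem' := fun {a b} ha hb σ => by rw [smul_add, ha σ, hb σ]
  smul_mem' := fun r x hx σ => by rw [smul_comm, hx σ]

theorem map_mem_invSub {K : Subgroup G} {M M' : Type u} [AddCommGroup M]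
    [Module (MonoidAlgebra ℤ G) M] [AddCommGroup M'] [Module (MonoidAlgebra ℤ G) M']
    (f : M →ₗ[MonoidAlgebra ℤ G] M') {x : M} (hx : x ∈ invSub K M) :
    f x ∈ invSub K M' := fun σ => by rw [← map_smul, hx σ]

variable [Finite G]

/-- The submodule `N_K M` of norms. -/
def nrmSub (K : Subgroup G) (M : Type u) [AddCommGroup M] [Module (MonoidAlgebra ℤ G) M] :
    Submodule (MonoidAlgebra ℤ G) M :=
  LinearMap.range (LinearMap.lsmul (MonoidAlgebra ℤ G) M (normElt K))

/-- The Tate cohomology group `Ĥ⁰(K, M)`, as a module over `ℤ[G]`. -/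
abbrev Tate (K : Subgroup G) (M : Type u) [AddCommGroup M] [Module (MonoidAlgebra ℤ G) M] :
    Type u :=
  invSub K M ⧸ (nrmSub K M).submoduleOf (invSub K M)

/-- The kernel of the norm `N_K` on `M`. -/
def nrmKer (K : Subgroup G) (M : Type u) [AddCommGroup M] [Module (MonoidAlgebra ℤ G) M] :
    Submodule (MonoidAlgebra ℤ G) M :=
  LinearMap.ker (LinearMap.lsmul (MonoidAlgebra ℤ G) M (normElt K))

/-- The Tate cohomology group `Ĥ⁻¹(K, M)`, as a module over `ℤ[G]`. -/
abbrev TateNegOne (K : Subgroup G) (M : Type u) [AddCommGroup M]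
    [Module (MonoidAlgebra ℤ G) M] : Type u :=
  nrmKer K M ⧸ (augIdeal K • (⊤ : Submodule (MonoidAlgebra ℤ G) M)).submoduleOf (nrmKer K M)

variable {K : Subgroup G} {M M' : Type u} [AddCommGroup M] [Module (MonoidAlgebra ℤ G) M]
  [AddCommGroup M'] [Module (MonoidAlgebra ℤ G) M']

theorem mem_nrmKer {x : M} : x ∈ nrmKer K M ↔ normElt K • x = 0 := Iff.rfl

theorem normElt_smul_mem_invSub (x : M) : normElt K • x ∈ invSub K M := fun σ => by
  rw [← mul_smul, gp_mul_normElt σ.2]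

theorem augIdeal_smul_le_nrmKer :
    augIdeal K • (⊤ : Submodule (MonoidAlgebra ℤ G) M) ≤ nrmKer K M :=
  Submodule.smul_le.2 fun r hr x _ => by
    rw [mem_nrmKer, ← mul_smul, mul_comm, mul_normElt_of_mem hr, zero_smul]

theorem equiv_of_ker_eq {R : Type u} [Ring R] {Z T T' : Type u} [AddCommGroup Z] [Module R Z]
    [AddCommGroup T] [Module R T] [AddCommGroup T'] [Module R T'] (f : Z →ₗ[R] T) (g : Z →ₗ[R] T')
    (hf : Function.Surjective f) (hg : Function.Surjective g)
    (h : ∀ z, f z = 0 ↔ g z = 0) : Nonempty (T ≃ₗ[R] T') := by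
  have hk : LinearMap.ker f = LinearMap.ker g := by
    ext z
    exact h z
  exact ⟨(f.quotKerEquivOfSurjective hf).symm.trans
    ((Submodule.quotEquivOfEq _ _ hk).trans (g.quotKerEquivOfSurjective hg))⟩

/-- A criterion for `f` to induce an isomorphism on `Ĥ⁰(K, -)`. -/
theorem nonempty_tate_equiv (f : M →ₗ[MonoidAlgebra ℤ G] M')
    (hinj : ∀ x ∈ invSub K M, f x ∈ nrmSub K M' → x ∈ nrmSub K M)
    (hsurj : ∀ y ∈ invSub K M', ∃ x ∈ invSub K M, y - f x ∈ nrmSub K M') :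
    Nonempty (Tate K M ≃ₗ[MonoidAlgebra ℤ G] Tate K M') := by
  refine equiv_of_ker_eq (Submodule.mkQ _)
    ((Submodule.mkQ _) ∘ₗ f.restrict fun x hx => map_mem_invSub f hx)
    (Submodule.mkQ_surjective _) ?_ ?_
  · intro t
    obtain ⟨⟨y, hy⟩, rfl⟩ := Submodule.mkQ_surjective _ t
    obtain ⟨x, hx, hxy⟩ := hsurj y hy
    refine ⟨⟨x, hx⟩, ?_⟩
    exact ((Submodule.Quotient.eq ((nrmSub K M').submoduleOf (invSub K M'))
      (x := ⟨y, hy⟩) (y := ⟨f x, map_mem_invSub f hx⟩)).2 hxy).symm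
  · rintro ⟨x, hx⟩
    rw [LinearMap.comp_apply, Submodule.mkQ_apply, Submodule.mkQ_apply,
      Submodule.Quotient.mk_eq_zero, Submodule.Quotient.mk_eq_zero]
    constructor
    · rintro ⟨y, rfl⟩
      exact ⟨f y, (map_smul f _ _).symm⟩
    · exact hinj x hx

section Exact

variable {Y N X : Type u} [AddCommGroup Y] [Module (MonoidAlgebra ℤ G) Y]
  [AddCommGroup N] [Module (MonoidAlgebra ℤ G) N] [AddCommGroup X] [Module (MonoidAlgebra ℤ G) X]
  (i : Y →ₗ[MonoidAlgebra ℤ G] N) (q : N →ₗ[MonoidAlgebra ℤ G] X)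

theorem nonempty_tate_equiv_of_cohTrivial_left (hY : CohTrivial K Y) (hi : Function.Injective i)
    (he : Function.Exact i q) (hq : Function.Surjective q) :
    Nonempty (Tate K X ≃ₗ[MonoidAlgebra ℤ G] Tate K N) := by
  suffices h : Nonempty (Tate K N ≃ₗ[MonoidAlgebra ℤ G] Tate K X) from h.map LinearEquiv.symm
  refine nonempty_tate_equiv q ?_ ?_
  · rintro x hx ⟨y, hy⟩
    obtain ⟨w, rfl⟩ := hq y
    obtain ⟨z, hz⟩ := (he (x - normElt K • w)).1 (by
      rw [map_sub, map_smul, sub_eq_zero]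
      exact hy.symm)
    obtain ⟨v, hv⟩ := hY.exists_norm_smul (x := z) fun σ => hi (by
      rw [map_smul, hz, smul_sub, hx σ, normElt_smul_mem_invSub w σ])
    refine ⟨i v + w, ?_⟩
    change normElt K • (i v + w) = x
    rw [smul_add, ← map_smul, hv, hz, sub_add_cancel]
  · intro y hy
    obtain ⟨x, rfl⟩ := hq y
    have h1 : ∀ σ : K, ∃ z, i z = gp (σ : G) • x - x := fun σ => (he _).1 (by
      rw [map_sub, map_smul, hy σ, sub_self])
    choose c hc using h1
    obtain ⟨z, hz⟩ := hY.exists_coboundary (c := c) fun σ τ => hi (by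
      rw [map_add, map_smul, hc, hc, hc, Subgroup.coe_mul, gp_mul, mul_smul, smul_sub]
      abel)
    refine ⟨x - i z, fun σ => ?_, 0, ?_⟩
    · have h2 := congrArg i (hz σ)
      rw [hc, map_sub, map_smul] at h2
      rw [smul_sub, sub_eq_sub_iff_sub_eq_sub, h2]
    · rw [map_zero, map_sub, he.apply_apply_eq_zero, sub_zero, sub_self]

theorem nonempty_tate_equiv_of_cohTrivial_right (hX : CohTrivial K X) (hi : Function.Injective i)
    (he : Function.Exact i q) (hq : Function.Surjective q) :
    Nonempty (Tate K Y ≃ₗ[MonoidAlgebra ℤ G] Tate K N) := by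
  refine nonempty_tate_equiv i ?_ ?_
  · rintro y hy ⟨w, hw⟩
    have h1 : q w ∈ augIdeal K • (⊤ : Submodule (MonoidAlgebra ℤ G) X) := hX.mem_augIdeal_smul (by
      rw [← map_smul]
      exact (congrArg q hw).trans (he.apply_apply_eq_zero y))
    rw [← LinearMap.range_eq_top.2 hq, LinearMap.range_eq_map, ← Submodule.map_smul''] at h1
    obtain ⟨v, hv, hvw⟩ := h1
    obtain ⟨z, hz⟩ := (he (w - v)).1 (by rw [map_sub, hvw, sub_self])
    refine ⟨z, hi ?_⟩
    change i (normElt K • z) = i y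
    rw [map_smul, hz, smul_sub, mem_nrmKer.1 (augIdeal_smul_le_nrmKer hv), sub_zero]
    exact hw
  · intro n hn
    obtain ⟨x, hx⟩ := hX.exists_norm_smul (map_mem_invSub q hn)
    obtain ⟨w, rfl⟩ := hq x
    obtain ⟨z, hz⟩ := (he (n - normElt K • w)).1 (by rw [map_sub, map_smul, hx, sub_self])
    refine ⟨z, fun σ => hi ?_, w, ?_⟩
    · rw [map_smul, hz, smul_sub, hn σ, normElt_smul_mem_invSub w σ]
    · rw [hz, sub_sub_cancel]
      rfl

/-- Dimension shifting `Ĥ⁰(K, Y) ≅ Ĥ⁻¹(K, X)`: both groups are quotients of the module of all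
`x ∈ N` such that `N_K x` vanishes in `X`. -/
theorem nonempty_tate_equiv_tateNegOne (hN : CohTrivial K N) (hi : Function.Injective i)
    (he : Function.Exact i q) (hq : Function.Surjective q) :
    Nonempty (Tate K Y ≃ₗ[MonoidAlgebra ℤ G] TateNegOne K X) := by
  let Z : Submodule (MonoidAlgebra ℤ G) N := (nrmKer K X).comap q
  let e : Y ≃ₗ[MonoidAlgebra ℤ G] LinearMap.range i := LinearEquiv.ofInjective i hi
  have hZ : ∀ x ∈ Z, normElt K • x ∈ LinearMap.range i := fun x hx =>
    (he _).1 (by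
      rw [map_smul]
      exact hx)
  let ν : Z →ₗ[MonoidAlgebra ℤ G] Y :=
    e.symm.toLinearMap ∘ₗ LinearMap.restrict (LinearMap.lsmul (MonoidAlgebra ℤ G) N (normElt K)) hZ
  have hν : ∀ x : Z, i (ν x) = normElt K • (x : N) := fun x =>
    congrArg Subtype.val (e.apply_symm_apply ⟨_, hZ x x.2⟩)
  have hνinv : ∀ x : Z, ν x ∈ invSub K Y := fun x σ => hi (by
    rw [map_smul, hν, normElt_smul_mem_invSub (x : N) σ])
  refine equiv_of_ker_eq (Submodule.mkQ _ ∘ₗ ν.codRestrict _ hνinv)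
    (Submodule.mkQ _ ∘ₗ q.restrict (p := Z) (q := nrmKer K X) fun x hx => hx) ?_ ?_ ?_
  · intro t
    obtain ⟨⟨y, hy⟩, rfl⟩ := Submodule.mkQ_surjective _ t
    obtain ⟨x, hx⟩ := hN.exists_norm_smul (map_mem_invSub i hy)
    have hxZ : x ∈ Z := by
      change normElt K • q x = 0
      rw [← map_smul, hx, he.apply_apply_eq_zero]
    refine ⟨⟨x, hxZ⟩, congrArg _ (Subtype.ext (hi ?_))⟩
    exact (hν _).trans hx
  · intro t
    obtain ⟨⟨a, ha⟩, rfl⟩ := Submodule.mkQ_surjective _ t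
    obtain ⟨x, rfl⟩ := hq a
    exact ⟨⟨x, ha⟩, rfl⟩
  · intro x
    rw [LinearMap.comp_apply, LinearMap.comp_apply, Submodule.mkQ_apply, Submodule.mkQ_apply,
      Submodule.Quotient.mk_eq_zero, Submodule.Quotient.mk_eq_zero]
    change ν x ∈ nrmSub K Y ↔ q x ∈ augIdeal K • (⊤ : Submodule (MonoidAlgebra ℤ G) X)
    constructor
    · rintro ⟨y, hy⟩
      have h1 : (x : N) - i y ∈ augIdeal K • (⊤ : Submodule (MonoidAlgebra ℤ G) N) :=
        hN.mem_augIdeal_smul (by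
          rw [smul_sub, ← map_smul, ← hν, ← hy, sub_eq_zero]
          rfl)
      have h2 := Submodule.mem_map_of_mem (f := q) h1
      rw [Submodule.map_smul'', map_sub, he.apply_apply_eq_zero, sub_zero] at h2
      exact Submodule.smul_mono le_rfl le_top h2
    · intro h1
      rw [← LinearMap.range_eq_top.2 hq, LinearMap.range_eq_map, ← Submodule.map_smul''] at h1
      obtain ⟨v, hv, hvx⟩ := h1
      obtain ⟨y, hy⟩ := (he ((x : N) - v)).1 (by rw [map_sub, hvx, sub_self])
      refine ⟨y, hi ?_⟩
      change i (normElt K • y) = i (ν x)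
      rw [hν, map_smul, hy, smul_sub, mem_nrmKer.1 (augIdeal_smul_le_nrmKer hv), sub_zero]

end Exact

theorem nonempty_tate_prod_equiv :
    Nonempty (Tate K (M × M') ≃ₗ[MonoidAlgebra ℤ G] Tate K M × Tate K M') := by
  refine equiv_of_ker_eq (Submodule.mkQ _)
    (LinearMap.prod
      (Submodule.mkQ _ ∘ₗ (LinearMap.fst _ M M').restrict (p := invSub K (M × M'))
        (q := invSub K M) fun x hx => map_mem_invSub _ hx)
      (Submodule.mkQ _ ∘ₗ (LinearMap.snd _ M M').restrict (p := invSub K (M × M'))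
        (q := invSub K M') fun x hx => map_mem_invSub _ hx))
    (Submodule.mkQ_surjective _) ?_ ?_
  · rintro ⟨a, b⟩
    obtain ⟨⟨x, hx⟩, rfl⟩ := Submodule.mkQ_surjective _ a
    obtain ⟨⟨y, hy⟩, rfl⟩ := Submodule.mkQ_surjective _ b
    exact ⟨⟨(x, y), fun σ => Prod.ext (hx σ) (hy σ)⟩, rfl⟩
  · rintro ⟨⟨x, y⟩, hxy⟩
    rw [LinearMap.prod_apply, Function.prod_apply, Prod.mk_eq_zero, LinearMap.comp_apply,
      LinearMap.comp_apply, Submodule.mkQ_apply, Submodule.mkQ_apply, Submodule.mkQ_apply,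
      Submodule.Quotient.mk_eq_zero, Submodule.Quotient.mk_eq_zero, Submodule.Quotient.mk_eq_zero]
    constructor
    · rintro ⟨⟨a, b⟩, hab⟩
      exact ⟨⟨a, congrArg Prod.fst hab⟩, ⟨b, congrArg Prod.snd hab⟩⟩
    · rintro ⟨⟨a, ha⟩, ⟨b, hb⟩⟩
      exact ⟨(a, b), Prod.ext ha hb⟩

theorem finite_of_isTorsion [Module.Finite (MonoidAlgebra ℤ G) M]
    (hM : Module.IsTorsion (MonoidAlgebra ℤ G) M) : Finite M := by
  obtain ⟨n, hn, hnM⟩ := exists_int_smul_eq_zero hM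
  have : Module.Finite ℤ (MonoidAlgebra ℤ G) := inferInstance
  have h1 : Module.Finite ℤ M := Module.Finite.trans (MonoidAlgebra ℤ G) M
  refine Module.finite_of_fg_torsion M fun x => ⟨⟨n, mem_nonZeroDivisors_of_ne_zero hn⟩, ?_⟩
  change n • x = 0
  rw [← hnM x, Int.cast_smul_eq_zsmul]

/-- The number of elements of a module that are killed by a set of scalars. -/
def torsionCount {R : Type u} [CommRing R] (B : Set R) (M : Type u) [AddCommGroup M]
    [Module R M] : ℕ :=
  Nat.card {x : M // ∀ b ∈ B, b • x = 0}

theorem torsionCount_congr {R : Type u} [CommRing R] (B : Set R) {M M' : Type u}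
    [AddCommGroup M] [Module R M] [AddCommGroup M'] [Module R M'] (e : M ≃ₗ[R] M') :
    torsionCount B M = torsionCount B M' :=
  Nat.card_congr (e.toEquiv.subtypeEquiv fun x => forall₂_congr fun b _ => by
    change _ ↔ b • e x = 0
    rw [← map_smul, LinearEquiv.map_eq_zero_iff])

theorem torsionCount_prod {R : Type u} [CommRing R] (B : Set R) {M M' : Type u}
    [AddCommGroup M] [Module R M] [AddCommGroup M'] [Module R M'] :
    torsionCount B (M × M') = torsionCount B M * torsionCount B M' := by
  rw [torsionCount, torsionCount, torsionCount, ← Nat.card_prod]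
  refine Nat.card_congr ((Equiv.subtypeEquivRight fun x => ?_).trans (Equiv.subtypeProdEquivProd
    (p := fun x : M => ∀ b ∈ B, b • x = 0) (q := fun x : M' => ∀ b ∈ B, b • x = 0)))
  simp only [Prod.ext_iff, Prod.smul_fst, Prod.smul_snd, Prod.fst_zero, Prod.snd_zero]
  exact ⟨fun h => ⟨fun b hb => (h b hb).1, fun b hb => (h b hb).2⟩,
    fun h b hb => ⟨h.1 b hb, h.2 b hb⟩⟩

theorem torsionCount_ne_zero {R : Type u} [CommRing R] (B : Set R) {M : Type u}
    [AddCommGroup M] [Module R M] [Finite M] : torsionCount B M ≠ 0 := by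
  have : Nonempty {x : M // ∀ b ∈ B, b • x = 0} := ⟨⟨0, fun b _ => smul_zero b⟩⟩
  exact Nat.card_pos.ne'

/-- The additive invariant of classes that counts (on a logarithmic scale) the elements of
`Ĥ⁰(K, X)` killed by `B`. -/
def tateLog (K : Subgroup G) (B : Set (MonoidAlgebra ℤ G)) :
    Classes (MonoidAlgebra ℤ G) →+ ℝ where
  toFun := Quot.lift (fun X => Real.log (torsionCount B (Tate K X))) fun X Y h => by
    refine h.map_eq (fun X => Real.log (torsionCount B (Tate K X))) ?_ ?_
    · intro Y N P i q hP hi he hq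
      obtain ⟨e⟩ := nonempty_tate_equiv_of_cohTrivial_right i q (hP.cohTrivial K) hi he hq
      exact congrArg (fun n : ℕ => Real.log n) (torsionCount_congr B e)
    · intro P N X i q hP hi he hq
      obtain ⟨e⟩ := nonempty_tate_equiv_of_cohTrivial_left i q (hP.cohTrivial K) hi he hq
      exact congrArg (fun n : ℕ => Real.log n) (torsionCount_congr B e)
  map_zero' := by
    change Real.log (torsionCount B (Tate K PUnit)) = 0
    have h1 : Subsingleton (Tate K PUnit.{u + 1}) :=
      (Submodule.mkQ_surjective _).subsingleton
    have h2 : torsionCount B (Tate K PUnit.{u + 1}) = 1 :=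
      Nat.card_eq_one_iff_unique.2 ⟨inferInstance, ⟨⟨0, fun b _ => smul_zero b⟩⟩⟩
    rw [h2, Nat.cast_one, Real.log_one]
  map_add' := by
    rintro ⟨X⟩ ⟨Y⟩
    change Real.log (torsionCount B (Tate K (X × Y))) = Real.log (torsionCount B (Tate K X)) +
      Real.log (torsionCount B (Tate K Y))
    have := X.finite
    have := Y.finite
    have := finite_of_isTorsion X.torsion
    have := finite_of_isTorsion Y.torsion
    have h1 : Finite (Tate K X) := Finite.of_surjective _ (Submodule.mkQ_surjective _)
    have h2 : Finite (Tate K Y) := Finite.of_surjective _ (Submodule.mkQ_surjective _)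
    obtain ⟨e⟩ := nonempty_tate_prod_equiv (K := K) (M := X) (M' := Y)
    rw [torsionCount_congr B e, torsionCount_prod, Nat.cast_mul, Real.log_mul
      (Nat.cast_ne_zero.2 (torsionCount_ne_zero B)) (Nat.cast_ne_zero.2 (torsionCount_ne_zero B))]

/-- On shifts, the invariant can be computed from `Ĥ⁻¹`. -/
theorem tateLog_shiftClass (K : Subgroup G) (B : Set (MonoidAlgebra ℤ G))
    {X Y : TorsionModule (MonoidAlgebra ℤ G)} (h : IsShift X Y) :
    tateLog K B (shiftClass X) = Real.log (torsionCount B (TateNegOne K X)) := by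
  rw [h.shiftClass_eq]
  obtain ⟨P, hP, i, q, hi, he, hq⟩ := h
  obtain ⟨e⟩ := nonempty_tate_equiv_tateNegOne i q (hP.cohTrivial K) hi he hq
  exact congrArg (fun n : ℕ => Real.log n) (torsionCount_congr B e)

end Tate

/-! ### The invariants of the modules `ℤ[Γ/I] / (1 + #Γ - φ)` -/

section Torsion

variable {R : Type u} [CommRing R]

theorem torsionCount_insert (a : R) (C : Set R) (M : Type u) [AddCommGroup M] [Module R M] :
    torsionCount (insert a C) M = torsionCount C (LinearMap.ker (LinearMap.lsmul R M a)) := by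
  refine Nat.card_congr (Equiv.symm ((Equiv.subtypeEquivRight fun x => ?_).trans
    ((Equiv.subtypeSubtypeEquivSubtypeInter (fun x : M => a • x = 0)
      fun x : M => ∀ b ∈ C, b • x = 0).trans (Equiv.subtypeEquivRight fun x => ?_))))
  · exact forall₂_congr fun b _ => Subtype.ext_iff
  · exact (Set.forall_mem_insert (P := fun b : R => b • x = 0)).symm

/-- The symmetry `Tor₁(R/g, R/a) ≅ Tor₁(R/a, R/g)`, for non-zero-divisors `a` and `g`. -/
theorem torsionCount_swap {a g : R} (ha : a ∈ R⁰) (hg : g ∈ R⁰) (C : Set R) :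
    torsionCount (insert a C) (R ⧸ Ideal.span {g}) =
      torsionCount (insert g C) (R ⧸ Ideal.span {a}) := by
  rw [torsionCount_insert, torsionCount_insert]
  let Z : Submodule R (R × R) := LinearMap.ker
    (LinearMap.lsmul R R a ∘ₗ LinearMap.fst R R R - LinearMap.lsmul R R g ∘ₗ LinearMap.snd R R R)
  have hZ : ∀ {z : R × R}, z ∈ Z → a * z.1 = g * z.2 := fun hz => sub_eq_zero.1 hz
  have hZ' : ∀ {r b : R}, a * r = g * b → (r, b) ∈ Z := fun h => sub_eq_zero.2 h
  let f : Z →ₗ[R] LinearMap.ker (LinearMap.lsmul R (R ⧸ Ideal.span {g}) a) :=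
    LinearMap.restrict (Submodule.mkQ (Ideal.span {g}) ∘ₗ LinearMap.fst R R R) (p := Z)
      fun z hz => (Submodule.Quotient.mk_eq_zero (Ideal.span {g})).2
        (Ideal.mem_span_singleton.2 ⟨z.2, hZ hz⟩)
  let f' : Z →ₗ[R] LinearMap.ker (LinearMap.lsmul R (R ⧸ Ideal.span {a}) g) :=
    LinearMap.restrict (Submodule.mkQ (Ideal.span {a}) ∘ₗ LinearMap.snd R R R) (p := Z)
      fun z hz => (Submodule.Quotient.mk_eq_zero (Ideal.span {a})).2
        (Ideal.mem_span_singleton.2 ⟨z.1, (hZ hz).symm⟩)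
  refine (equiv_of_ker_eq f f' ?_ ?_ ?_).elim fun e => torsionCount_congr C e
  · rintro ⟨x, hx⟩
    obtain ⟨r, rfl⟩ := Submodule.mkQ_surjective _ x
    obtain ⟨b, hb⟩ := Ideal.mem_span_singleton.1
      ((Submodule.Quotient.mk_eq_zero (Ideal.span {g}) (x := a * r)).1 hx)
    exact ⟨⟨(r, b), hZ' hb⟩, rfl⟩
  · rintro ⟨x, hx⟩
    obtain ⟨b, rfl⟩ := Submodule.mkQ_surjective _ x
    obtain ⟨r, hr⟩ := Ideal.mem_span_singleton.1
      ((Submodule.Quotient.mk_eq_zero (Ideal.span {a}) (x := g * b)).1 hx)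
    exact ⟨⟨(r, b), hZ' hr.symm⟩, rfl⟩
  · rintro ⟨⟨r, b⟩, hz⟩
    have hz' : a * r = g * b := hZ hz
    have h1 : f ⟨(r, b), hz⟩ = 0 ↔ g ∣ r := by
      rw [Subtype.ext_iff, ← Ideal.mem_span_singleton]
      exact Submodule.Quotient.mk_eq_zero (Ideal.span {g})
    have h2 : f' ⟨(r, b), hz⟩ = 0 ↔ a ∣ b := by
      rw [Subtype.ext_iff, ← Ideal.mem_span_singleton]
      exact Submodule.Quotient.mk_eq_zero (Ideal.span {a})
    rw [h1, h2]
    constructor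
    · rintro ⟨t, rfl⟩
      refine ⟨t, (mul_cancel_left_mem_nonZeroDivisors hg).1 ?_⟩
      rw [← hz']
      ring
    · rintro ⟨t, rfl⟩
      refine ⟨t, (mul_cancel_left_mem_nonZeroDivisors ha).1 ?_⟩
      rw [hz']
      ring

theorem torsionCount_quotient_of_surjective {S : Type u} [CommRing S] (π : R →+* S)
    (hπ : Function.Surjective π) (g : R) (B : Set R) :
    torsionCount B (R ⧸ (RingHom.ker π ⊔ Ideal.span {g})) =
      torsionCount (π '' B) (S ⧸ Ideal.span {π g}) := by
  have hker : RingHom.ker ((Ideal.Quotient.mk (Ideal.span {π g})).comp π) =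
      RingHom.ker π ⊔ Ideal.span {g} := by
    rw [← RingHom.comap_ker, Ideal.mk_ker, ← Set.image_singleton, ← Ideal.map_span,
      Ideal.comap_map_of_surjective π hπ, sup_comm]
    rfl
  let e : R ⧸ (RingHom.ker π ⊔ Ideal.span {g}) ≃+* S ⧸ Ideal.span {π g} :=
    (Ideal.quotEquivOfEq hker.symm).trans
      (RingHom.quotientKerEquivOfSurjective (Ideal.Quotient.mk_surjective.comp hπ))
  refine Nat.card_congr (e.toEquiv.subtypeEquiv fun x => ?_)
  rw [Set.forall_mem_image]
  refine forall₂_congr fun b _ => ?_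
  obtain ⟨r, rfl⟩ := Ideal.Quotient.mk_surjective x
  have h1 : π b • e (Ideal.Quotient.mk _ r) = e (b • Ideal.Quotient.mk _ r) :=
    (map_mul (Ideal.Quotient.mk (Ideal.span {π g})) (π b) (π r)).symm.trans
      (congrArg (Ideal.Quotient.mk (Ideal.span {π g})) (map_mul π b r).symm)
  change _ ↔ π b • e (Ideal.Quotient.mk _ r) = 0
  rw [h1, EmbeddingLike.map_eq_zero_iff]

end Torsion

section Functions

variable {G : Type u} [CommGroup G] [Finite G]

/-- `ℤ[G] / N` is the group of functions on `G` with values in `ℤ/N`. -/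
theorem exists_quotient_natCast_equiv (N : ℕ) :
    ∃ e : (MonoidAlgebra ℤ G ⧸ Ideal.span {(N : MonoidAlgebra ℤ G)}) ≃+ (G → ZMod N),
      ∀ (g h : G) x, e (gp g • x) (g * h) = e x h := by
  let ρ : MonoidAlgebra ℤ G →+ (G → ZMod N) :=
    { toFun := fun x g => ((x.coeff g : ℤ) : ZMod N)
      map_zero' := by
        ext g
        simp
      map_add' := fun x y => by
        ext g
        simp }
  have hρ : Function.Surjective ρ := by
    intro f
    refine ⟨MonoidAlgebra.ofCoeff (Finsupp.equivFunOnFinite.symm fun g => (f g).cast), ?_⟩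
    ext g
    exact ZMod.intCast_zmod_cast (f g)
  have hker : ∀ x, ρ x = 0 ↔ x ∈ Ideal.span {(N : MonoidAlgebra ℤ G)} := by
    intro x
    rw [Ideal.mem_span_singleton]
    constructor
    · intro hx
      have h1 : ∀ g, (N : ℤ) ∣ x.coeff g := fun g =>
        (ZMod.intCast_zmod_eq_zero_iff_dvd _ _).1 (congrFun hx g)
      choose y hy using h1
      refine ⟨MonoidAlgebra.ofCoeff (Finsupp.equivFunOnFinite.symm y), ?_⟩
      rw [← nsmul_eq_mul]
      ext g
      rw [hy g]
      simp [-nsmul_eq_mul]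
    · rintro ⟨y, rfl⟩
      ext g
      rw [← nsmul_eq_mul, map_nsmul]
      simp
  let e : (MonoidAlgebra ℤ G ⧸ Ideal.span {(N : MonoidAlgebra ℤ G)}) ≃+ (G → ZMod N) :=
    (QuotientAddGroup.quotientAddEquivOfEq (by
      ext x
      exact (hker x).symm)).trans (QuotientAddGroup.quotientKerEquivOfSurjective ρ hρ)
  refine ⟨e, fun g h x => ?_⟩
  obtain ⟨y, rfl⟩ := Ideal.Quotient.mk_surjective x
  change ρ (gp g * y) (g * h) = ρ y h
  change (((gp g * y).coeff (g * h) : ℤ) : ZMod N) = ((y.coeff h : ℤ) : ZMod N)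
  congr 1
  rw [gp, MonoidAlgebra.of_apply]
  simp [MonoidAlgebra.coeff_single_mul_apply]

/-- The `E`-invariant functions on `G ⧸ I` are the functions on `G ⧸ E`. -/
theorem card_invariant_functions (I E : Subgroup G) (hIE : I ≤ E) (N : ℕ) :
    Nat.card {f : G ⧸ I → ZMod N // ∀ γ ∈ E, ∀ q : G ⧸ I, f ((γ : G ⧸ I) * q) = f q} =
      N ^ E.index := by
  let p : G ⧸ I →* G ⧸ E := QuotientGroup.map I E (MonoidHom.id G) hIE
  have hp : Function.Surjective p := fun y => by
    obtain ⟨g, rfl⟩ := QuotientGroup.mk_surjective y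
    exact ⟨g, rfl⟩
  have hpE : ∀ γ ∈ E, p (γ : G ⧸ I) = 1 := fun γ hγ => (QuotientGroup.eq_one_iff γ).2 hγ
  rw [Subgroup.index, ← Nat.card_zmod N, ← Nat.card_fun, Nat.card_zmod]
  symm
  refine Nat.card_congr (Equiv.ofBijective
    (fun F : G ⧸ E → ZMod N => ⟨F ∘ p, fun γ hγ q => ?_⟩) ⟨?_, ?_⟩)
  · rw [Function.comp_apply, map_mul, hpE γ hγ, one_mul]
    rfl
  · intro F F' h
    exact hp.injective_comp_right (congrArg Subtype.val h)
  · rintro ⟨f, hf⟩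
    refine ⟨fun y => f (Function.surjInv hp y), Subtype.ext (funext fun q => ?_)⟩
    obtain ⟨g, rfl⟩ := QuotientGroup.mk_surjective q
    change f (Function.surjInv hp (p g)) = f g
    obtain ⟨h, hh⟩ := QuotientGroup.mk_surjective (Function.surjInv hp (p g))
    have h1 : p (h : G ⧸ I) = p (g : G ⧸ I) := hh ▸ Function.surjInv_eq hp _
    have h2 : h * g⁻¹ ∈ E := by
      rw [← div_eq_mul_inv]
      exact QuotientGroup.eq_iff_div_mem.1 h1
    rw [← hh, ← hf _ h2 g, ← QuotientGroup.mk_mul, inv_mul_cancel_right]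

end Functions

section RelModule

variable {Γ : Type u} [CommGroup Γ]

/-- The scalars `N` and `h - 1`, for `h ∈ L`: they kill `x` if and only if `x` is an `L`-invariant
element of order dividing `N`. -/
def fixScalars (N : ℕ) (L : Subgroup Γ) : Set (MonoidAlgebra ℤ Γ) :=
  insert (N : MonoidAlgebra ℤ Γ) {x | ∃ h ∈ L, x = gp h - 1}

/-- The elements of `Γ` that fix an element of a `ℤ[Γ/I]`-module. -/
def fixer (I : Subgroup Γ) {M : Type u} [AddCommGroup M] [Module (MonoidAlgebra ℤ (Γ ⧸ I)) M]
    (x : M) : Subgroup Γ where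
  carrier := {γ | gp (γ : Γ ⧸ I) • x = x}
  one_mem' := by
    change gp (1 : Γ ⧸ I) • x = x
    rw [gp_one, one_smul]
  mul_mem' := by
    intro a b ha hb
    change gp ((a : Γ ⧸ I) * (b : Γ ⧸ I)) • x = x
    rw [gp_mul, mul_smul, show gp (b : Γ ⧸ I) • x = x from hb, show gp (a : Γ ⧸ I) • x = x from ha]
  inv_mem' := by
    intro a ha
    have ha' : gp (a : Γ ⧸ I) • x = x := ha
    change gp (a : Γ ⧸ I)⁻¹ • x = x
    conv_lhs => rw [← ha']
    rw [← mul_smul, ← gp_mul, inv_mul_cancel, gp_one, one_smul]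

theorem mem_fixer {I : Subgroup Γ} {M : Type u} [AddCommGroup M]
    [Module (MonoidAlgebra ℤ (Γ ⧸ I)) M] {x : M} {γ : Γ} :
    γ ∈ fixer I x ↔ gp (γ : Γ ⧸ I) • x = x := Iff.rfl

variable [Finite Γ]

/-- The `L`-invariant `N`-torsion of `ℤ[Γ/I] / (1 + #Γ - φ)` is as large as the group of functions
`Γ → ℤ/N` that are invariant under `I`, `φ` and `L`: by symmetry of `Tor` it can be computed in
`(ℤ/N)[Γ/I]`, where `1 + #Γ - φ` acts as `1 - φ`. -/
theorem torsionCount_relModule (I : Subgroup Γ) (φ : Γ) (L : Subgroup Γ) {N : ℕ} (hN : N ≠ 0)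
    (hd : N ∣ Nat.card Γ) :
    torsionCount (fixScalars N L) (relModule I φ) =
      N ^ (I ⊔ Subgroup.zpowers φ ⊔ L).index := by
  set π := MonoidAlgebra.mapDomainRingHom ℤ (QuotientGroup.mk' I) with hπ
  set g : MonoidAlgebra ℤ Γ := ((1 + Nat.card Γ : ℕ) : MonoidAlgebra ℤ Γ) - gp φ with hg
  have hπg : π g = ((1 + Nat.card Γ : ℕ) : MonoidAlgebra ℤ (Γ ⧸ I)) - gp (φ : Γ ⧸ I) := by
    rw [hg, map_sub, map_natCast, hπ, mapDomainRingHom_gp]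
  have hNreg : (N : MonoidAlgebra ℤ (Γ ⧸ I)) ∈ (MonoidAlgebra ℤ (Γ ⧸ I))⁰ := by
    have h1 := intCast_mem_nonZeroDivisors (G := Γ ⧸ I) (Int.natCast_ne_zero.2 hN)
    rwa [Int.cast_natCast] at h1
  have hgreg : π g ∈ (MonoidAlgebra ℤ (Γ ⧸ I))⁰ :=
    hπg ▸ natCast_sub_gp_mem_nonZeroDivisors two_le_one_add_card _
  refine (torsionCount_quotient_of_surjective π (mapDomainRingHom_surjective I) g _).trans ?_
  rw [fixScalars, Set.image_insert_eq, map_natCast, torsionCount_swap hNreg hgreg,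
    ← card_invariant_functions I _ (le_sup_left.trans le_sup_left) N]
  obtain ⟨e, he⟩ := exists_quotient_natCast_equiv (G := Γ ⧸ I) N
  refine Nat.card_congr (e.toEquiv.subtypeEquiv fun x => ?_)
  have hinv : ∀ γ : Γ, γ ∈ fixer I x ↔ ∀ q : Γ ⧸ I, e x ((γ : Γ ⧸ I) * q) = e x q := by
    intro γ
    rw [mem_fixer]
    constructor
    · intro h q
      rw [← he γ q x, h]
    · intro h
      apply e.injective
      ext q
      have h1 := he γ ((γ : Γ ⧸ I)⁻¹ * q) x
      have h2 := h ((γ : Γ ⧸ I)⁻¹ * q)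
      rw [mul_inv_cancel_left] at h1 h2
      rw [h1, h2]
  have hcard : ((Nat.card Γ : ℕ) : MonoidAlgebra ℤ (Γ ⧸ I)) • x = 0 := by
    obtain ⟨m, hm⟩ := hd
    exact smul_cyclicModule_eq_zero (h := ⟨_, Ideal.mem_span_singleton_self _, hNreg⟩)
      (Ideal.mem_span_singleton.2 ⟨m, by rw [hm, Nat.cast_mul]⟩) x
  have hφ : π g • x = 0 ↔ φ ∈ fixer I x := by
    rw [hπg, Nat.cast_add, Nat.cast_one, sub_smul, add_smul, one_smul, hcard, add_zero,
      sub_eq_zero, mem_fixer, eq_comm]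
  have hI : I ≤ fixer I x := fun γ hγ => by
    rw [mem_fixer, (QuotientGroup.eq_one_iff γ).2 hγ, gp_one, one_smul]
  have hL : (∀ b ∈ π '' {x | ∃ h ∈ L, x = gp h - 1}, b • x = 0) ↔ L ≤ fixer I x := by
    rw [Set.forall_mem_image]
    constructor
    · intro h γ hγ
      have h1 := h ⟨γ, hγ, rfl⟩
      rwa [map_sub, map_one, hπ, mapDomainRingHom_gp, sub_smul, one_smul, sub_eq_zero] at h1
    · rintro h _ ⟨γ, hγ, rfl⟩
      rw [map_sub, map_one, hπ, mapDomainRingHom_gp, sub_smul, one_smul, sub_eq_zero]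
      exact h hγ
  have h1 : (∀ b ∈ insert (π g) (π '' {x | ∃ h ∈ L, x = gp h - 1}), b • x = 0) ↔
      I ⊔ Subgroup.zpowers φ ⊔ L ≤ fixer I x := by
    rw [Set.forall_mem_insert (P := fun b => b • x = 0), hφ, hL, sup_le_iff, sup_le_iff,
      Subgroup.zpowers_le, and_assoc]
    exact (and_iff_right hI).symm
  rw [h1]
  exact forall₂_congr fun γ _ => hinv γ

/-- If `K ⊆ I`, then `Ĥ⁻¹(K, -)` of a quotient of `ℤ[Γ/I]` is its `#K`-torsion. -/
theorem torsionCount_tateNegOne_of_le {K I : Subgroup Γ} (hK : K ≤ I) (φ : Γ) (L : Subgroup Γ)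
    {N : ℕ} (hN : N ∣ Nat.card K) :
    torsionCount (fixScalars N L) (TateNegOne K (relModule I φ)) =
      torsionCount (fixScalars N L) (relModule I φ) := by
  have hle : augIdeal K ≤ relIdeal I φ := (augIdeal_mono hK).trans le_sup_left
  have hbot : (augIdeal K • (⊤ : Submodule (MonoidAlgebra ℤ Γ) (relModule I φ))).submoduleOf
      (nrmKer K (relModule I φ)) = ⊥ := by
    have h1 : augIdeal K • (⊤ : Submodule (MonoidAlgebra ℤ Γ) (relModule I φ)) = ⊥ :=
      le_bot_iff.1 (Submodule.smul_le.2 fun r hr x _ => smul_cyclicModule_eq_zero (hle hr) x)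
    rw [h1, Submodule.submoduleOf, Submodule.comap_bot, Submodule.ker_subtype]
  rw [torsionCount_congr _ (Submodule.quotEquivOfEqBot _ hbot)]
  refine Nat.card_congr ⟨fun x => ⟨x.1, fun b hb => congrArg Subtype.val (x.2 b hb)⟩,
    fun x => ⟨⟨x.1, ?_⟩, fun b hb => Subtype.ext (x.2 b hb)⟩, fun _ => rfl, fun _ => rfl⟩
  obtain ⟨m, hm⟩ := hN
  have h1 : normElt K = (normElt K - (Nat.card K : MonoidAlgebra ℤ Γ)) +
      (m : MonoidAlgebra ℤ Γ) * (N : MonoidAlgebra ℤ Γ) := by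
    rw [hm]
    push_cast
    ring
  have h2 : (normElt K - (Nat.card K : MonoidAlgebra ℤ Γ)) • (x.1 : relModule I φ) = 0 :=
    smul_cyclicModule_eq_zero (hle (normElt_sub_card_mem K)) x.1
  rw [mem_nrmKer, h1, add_smul, h2, mul_smul, x.2 _ (Set.mem_insert _ _), smul_zero, add_zero]

/-- The image of `N_K` in `ℤ[Γ/I]` is `#(K ∩ I)` times the norm element of the image of `K`. -/
theorem exists_mapDomainRingHom_normElt {p n : ℕ} (hp : p.Prime) {K I : Subgroup Γ}
    (hKI : ¬ K ≤ I) (hK : Nat.card K = p ^ n) :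
    ∃ ν : ℕ, ν ∣ p ^ (n - 1) ∧
      MonoidAlgebra.mapDomainRingHom ℤ (QuotientGroup.mk' I) (normElt K) =
        ν * normElt (K.map (QuotientGroup.mk' I)) := by
  classical
  let := Fintype.ofFinite K
  let := Fintype.ofFinite (K.map (QuotientGroup.mk' I))
  let f : K →* K.map (QuotientGroup.mk' I) := (QuotientGroup.mk' I).subgroupMap K
  have hf : Function.Surjective f := (QuotientGroup.mk' I).subgroupMap_surjective K
  refine ⟨Nat.card f.ker, ?_, ?_⟩
  · obtain ⟨m, hm, hm'⟩ := (Nat.dvd_prime_pow hp).1 (hK ▸ f.ker.card_subgroup_dvd_card)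
    rw [hm']
    refine pow_dvd_pow p (Nat.le_sub_one_of_lt (lt_of_le_of_ne hm ?_))
    rintro rfl
    have h1 : f.ker = ⊤ := Subgroup.eq_top_of_card_eq _ (hm'.trans hK.symm)
    apply hKI
    intro k hk
    have h2 : (⟨k, hk⟩ : K) ∈ f.ker := h1 ▸ trivial
    exact (QuotientGroup.eq_one_iff k).1 (congrArg Subtype.val h2)
  · rw [normElt_eq, normElt_eq, map_sum, Finset.mul_sum]
    have h1 : ∀ k : K, MonoidAlgebra.mapDomainRingHom ℤ (QuotientGroup.mk' I) (gp (k : Γ)) =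
        gp ((f k : K.map (QuotientGroup.mk' I)) : Γ ⧸ I) := fun k => mapDomainRingHom_gp I k
    simp_rw [h1]
    rw [← Finset.sum_fiberwise Finset.univ f]
    refine Finset.sum_congr rfl fun y _ => ?_
    rw [Finset.sum_congr rfl (g := fun _ => gp (y : Γ ⧸ I)) fun k hk => by
      rw [(Finset.mem_filter.1 hk).2], Finset.sum_const, nsmul_eq_mul]
    congr 2
    rw [MonoidHom.card_fiber_eq_of_mem_range f (hf y) ⟨1, map_one f⟩, ← Nat.card_eq_finsetCard]
    exact Nat.card_congr (Equiv.subtypeEquivRight fun k => by simp [MonoidHom.mem_ker])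

/-- If `K ⊈ I`, then the order of `K ∩ I`, a proper divisor of the order of `K`, kills
`Ĥ⁻¹(K, ℤ[Γ/I] / (1 + #Γ - φ))`. -/
theorem smul_tateNegOne_eq_zero {p n : ℕ} (hp : p.Prime) {K I : Subgroup Γ}
    (hKI : ¬ K ≤ I) (hK : Nat.card K = p ^ n) (φ : Γ) (x : TateNegOne K (relModule I φ)) :
    ((p ^ (n - 1) : ℕ) : MonoidAlgebra ℤ Γ) • x = 0 := by
  obtain ⟨ν, ⟨m, hm⟩, hν⟩ := exists_mapDomainRingHom_normElt hp hKI hK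
  set π := MonoidAlgebra.mapDomainRingHom ℤ (QuotientGroup.mk' I) with hπ
  have hπs : Function.Surjective π := mapDomainRingHom_surjective I
  set g : MonoidAlgebra ℤ Γ := ((1 + Nat.card Γ : ℕ) : MonoidAlgebra ℤ Γ) - gp φ with hg
  have hπg : π g = ((1 + Nat.card Γ : ℕ) : MonoidAlgebra ℤ (Γ ⧸ I)) - gp (φ : Γ ⧸ I) := by
    rw [hg, map_sub, map_natCast, hπ, mapDomainRingHom_gp]
  have hgreg : π g ∈ (MonoidAlgebra ℤ (Γ ⧸ I))⁰ :=
    hπg ▸ natCast_sub_gp_mem_nonZeroDivisors two_le_one_add_card _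
  set K' := K.map (QuotientGroup.mk' I) with hK'
  suffices h : (ν : MonoidAlgebra ℤ Γ) • x = 0 by
    rw [hm, mul_comm, Nat.cast_mul, mul_smul, h, smul_zero]
  obtain ⟨⟨y, hy⟩, rfl⟩ := Submodule.mkQ_surjective _ x
  obtain ⟨r, rfl⟩ := Submodule.mkQ_surjective (relIdeal I φ) y
  have hy' : normElt K * r ∈ relIdeal I φ :=
    (Submodule.Quotient.mk_eq_zero (relIdeal I φ)).1 (mem_nrmKer.1 hy)
  obtain ⟨j, hj, z, hz, hjz⟩ := Submodule.mem_sup.1 hy'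
  obtain ⟨s, rfl⟩ := Ideal.mem_span_singleton.1 hz
  have h1 : normElt K' * (ν * π r) = π g * π s := by
    have h2 := congrArg π hjz
    rw [map_add, map_mul, map_mul, show π j = 0 from hj, zero_add, hν] at h2
    rw [h2]
    ring
  obtain ⟨t, ht⟩ := (relProj_self K').exists_norm_smul (x := π s) fun σ => by
    rw [smul_eq_mul, ← mul_cancel_left_mem_nonZeroDivisors hgreg, mul_left_comm, ← h1, ← mul_assoc,
      gp_mul_normElt σ.2]
  have h2 : ν * π r - π g * t ∈ augIdeal K' := by
    have h3 := (relProj_self K').mem_augIdeal_smul (x := ν * π r - π g * t) (by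
      rw [smul_eq_mul, mul_sub, h1, mul_left_comm, ← smul_eq_mul (normElt K') t, ht, sub_self])
    rwa [smul_eq_mul, Ideal.mul_top] at h3
  have h3 : (augIdeal K).map π = augIdeal K' := by
    rw [augIdeal_eq_span, augIdeal_eq_span, Ideal.map_span]
    congr 1
    ext w
    constructor
    · rintro ⟨_, ⟨k, hk, rfl⟩, rfl⟩
      exact ⟨k, ⟨k, hk, rfl⟩, by rw [map_sub, map_one, hπ, mapDomainRingHom_gp]⟩
    · rintro ⟨_, ⟨k, hk, rfl⟩, rfl⟩
      refine ⟨gp k - 1, ⟨k, hk, rfl⟩, ?_⟩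
      rw [map_sub, map_one, hπ, mapDomainRingHom_gp]
      rfl
  obtain ⟨t', rfl⟩ := hπs t
  rw [← h3, Ideal.mem_map_iff_of_surjective π hπs] at h2
  obtain ⟨w, hw, hw'⟩ := h2
  refine (Submodule.Quotient.mk_eq_zero _).2 ?_
  have h4 : (ν : MonoidAlgebra ℤ Γ) * r - w ∈ relIdeal I φ := by
    have h5 : (ν * r - w - g * t') ∈ augIdeal I := by
      rw [augIdeal, RingHom.mem_ker, ← hπ, map_sub, map_sub, hw', map_mul, map_mul, map_natCast]
      ring
    have h6 : (ν : MonoidAlgebra ℤ Γ) * r - w = (ν * r - w - g * t') + g * t' := by ring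
    rw [h6]
    exact add_mem (Ideal.mem_sup_left h5)
      (Ideal.mem_sup_right (Ideal.mul_mem_right _ _ (Ideal.mem_span_singleton_self _)))
  change (Submodule.Quotient.mk ((ν : MonoidAlgebra ℤ Γ) * r) : MonoidAlgebra ℤ Γ ⧸ relIdeal I φ) ∈
    augIdeal K • (⊤ : Submodule (MonoidAlgebra ℤ Γ) (MonoidAlgebra ℤ Γ ⧸ relIdeal I φ))
  rw [(Submodule.Quotient.eq (relIdeal I φ)).2 h4]
  have h5 := Submodule.smul_mem_smul hw (Submodule.mem_top
    (x := (Submodule.Quotient.mk 1 : MonoidAlgebra ℤ Γ ⧸ relIdeal I φ)))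
  rwa [← Submodule.Quotient.mk_smul, smul_eq_mul, mul_one] at h5

theorem torsionCount_tateNegOne_of_not_le {p n : ℕ} (hp : p.Prime) {K I : Subgroup Γ}
    (hKI : ¬ K ≤ I) (hK : Nat.card K = p ^ n) (φ : Γ) (L : Subgroup Γ) :
    torsionCount (fixScalars (p ^ n) L) (TateNegOne K (relModule I φ)) =
      torsionCount (fixScalars (p ^ (n - 1)) L) (TateNegOne K (relModule I φ)) := by
  refine Nat.card_congr (Equiv.subtypeEquivRight fun x => ?_)
  have h1 := smul_tateNegOne_eq_zero hp hKI hK φ x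
  have h2 : ((p ^ n : ℕ) : MonoidAlgebra ℤ Γ) • x = 0 := by
    obtain ⟨m, hm⟩ := pow_dvd_pow p (Nat.sub_le n 1)
    rw [hm, mul_comm, Nat.cast_mul, mul_smul, h1, smul_zero]
  rw [fixScalars, fixScalars, Set.forall_mem_insert (P := fun b => b • x = 0),
    Set.forall_mem_insert (P := fun b => b • x = 0), and_iff_right h1, and_iff_right h2]

/-- The value on the basis of the invariant of `𝒞/∼` attached to a `p`-group `K` and a subgroup
`L`. -/
theorem tateLog_sub_shift {p n : ℕ} (hp : p.Prime) (hn : n ≠ 0) {K : Subgroup Γ}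
    (hK : Nat.card K = p ^ n) (L : Subgroup Γ) (s : SetS Γ) [Decidable (K ≤ s.I)] :
    tateLog K (fixScalars (p ^ n) L) s.shift - tateLog K (fixScalars (p ^ (n - 1)) L) s.shift =
      (if K ≤ s.I then ((s.D ⊔ L).index : ℝ) else 0) * Real.log p := by
  obtain ⟨Y, hY⟩ := exists_isShift_relModule s.I s.gen
  rw [SetS.shift, tateLog_shiftClass _ _ hY, tateLog_shiftClass _ _ hY]
  have hd : ∀ j ≤ n, p ^ j ∣ Nat.card K := fun j hj => hK ▸ pow_dvd_pow p hj
  have hval : K ≤ s.I → ∀ j ≤ n, torsionCount (fixScalars (p ^ j) L)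
      (TateNegOne K (relModule s.I s.gen)) = (p ^ j) ^ (s.D ⊔ L).index := by
    intro hKI j hj
    rw [torsionCount_tateNegOne_of_le hKI _ _ (hd j hj), torsionCount_relModule _ _ _
      (pow_ne_zero _ hp.ne_zero) ((hd j hj).trans K.card_subgroup_dvd_card), ← s.D_eq]
  split_ifs with hKI
  · rw [hval hKI n le_rfl, hval hKI (n - 1) (Nat.sub_le n 1)]
    push_cast
    rw [Real.log_pow, Real.log_pow, Real.log_pow, Real.log_pow, ← mul_sub, ← sub_mul,
      Nat.cast_sub (Nat.one_le_iff_ne_zero.2 hn)]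
    push_cast
    ring
  · rw [torsionCount_tateNegOne_of_not_le hp hKI hK, sub_self, zero_mul]

end RelModule

/-! ### Linear independence modulo the kernel of `β` -/

section Moebius

/-- Downward induction: sums over the fibres of `τ` vanish if the sums over the preimages of the
intervals `[x, ∞)` do. It is enough to test those `x` that are values of `τ` on the support of
`w`. -/
theorem sum_fiber_eq_zero {S P : Type*} [Fintype S] [PartialOrder P] [WellFoundedGT P]
    [DecidableEq P] [DecidableLE P] (τ : S → P) (w : S → ℂ)
    (h : ∀ s₀, w s₀ ≠ 0 → ∑ s with τ s₀ ≤ τ s, w s = 0) (x : P) : ∑ s with τ s = x, w s = 0 := by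
  induction x using WellFoundedGT.induction with
  | ind x ih =>
    by_cases hex : ∃ s₀, τ s₀ = x ∧ w s₀ ≠ 0
    · obtain ⟨s₀, rfl, hs₀⟩ := hex
      have h1 := h s₀ hs₀
      rw [← Finset.sum_fiberwise_of_maps_to (t := Finset.univ.image τ) (g := τ)
        (fun s _ => Finset.mem_image_of_mem τ (Finset.mem_univ s)),
        Finset.sum_eq_single (τ s₀)] at h1
      · rw [← h1, Finset.filter_filter]
        refine Finset.sum_congr (Finset.filter_congr fun s _ => ?_) fun _ _ => rfl
        exact ⟨fun h => ⟨h.ge, h⟩, fun h => h.2⟩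
      · intro y _ hy
        rw [Finset.filter_filter]
        by_cases hlt : τ s₀ < y
        · rw [← ih y hlt]
          refine Finset.sum_congr (Finset.filter_congr fun s _ => ?_) fun _ _ => rfl
          exact ⟨fun h => h.2, fun h => ⟨h ▸ hlt.le, h⟩⟩
        · refine Finset.sum_eq_zero fun s hs => absurd ?_ hlt
          obtain ⟨-, h2, h3⟩ := Finset.mem_filter.1 hs
          exact lt_of_le_of_ne (h3 ▸ h2) hy.symm
      · intro h2
        exact absurd (Finset.mem_image_of_mem τ (Finset.mem_univ s₀)) h2
    · push Not at hex
      exact Finset.sum_eq_zero fun s hs => hex s (Finset.mem_filter.1 hs).2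

variable {G : Type u} [CommGroup G]

theorem index_sup_mul_card (D L : Subgroup G) :
    (D ⊔ L).index * (Nat.card D * Nat.card L) = Nat.card G * Nat.card (D ⊓ L : Subgroup G) := by
  have h1 : L.relIndex (D ⊔ L) = L.relIndex D := Subgroup.relIndex_sup_right D L
  have h2 := Subgroup.relIndex_inf_mul_relIndex ⊥ L D
  have h3 := Subgroup.relIndex_mul_relIndex ⊥ L (D ⊔ L) bot_le le_sup_right
  have h4 := (D ⊔ L).card_mul_index
  rw [Subgroup.relIndex_bot_left, bot_inf_eq, Subgroup.relIndex_bot_left, inf_comm] at h2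
  rw [Subgroup.relIndex_bot_left, Subgroup.relIndex_bot_left, h1] at h3
  rw [← h2, ← h4, ← h3]
  ring

variable [Finite G]

/-- A function that only depends on the subgroup generated by its argument is determined by its
sums over subgroups. -/
theorem eq_zero_of_sum_subgroup [Fintype G] (ψ : G → ℂ)
    (hψ : ∀ x y, Subgroup.zpowers x = Subgroup.zpowers y → ψ x = ψ y)
    (h : ∀ L : Subgroup G, ∀ [DecidablePred (· ∈ L)], ∑ x with x ∈ L, ψ x = 0) (x : G) :
    ψ x = 0 := by
  classical
  induction hn : Nat.card (Subgroup.zpowers x) using Nat.strong_induction_on generalizing x with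
  | _ n ih =>
    subst hn
    have h1 := h (Subgroup.zpowers x)
    have h2 : ∀ y ∈ Finset.univ.filter (· ∈ Subgroup.zpowers x),
        ψ y = if Subgroup.zpowers y = Subgroup.zpowers x then ψ x else 0 := by
      intro y hy
      split_ifs with hxy
      · exact hψ y x hxy
      · have hle : Subgroup.zpowers y ≤ Subgroup.zpowers x :=
          Subgroup.zpowers_le.2 (Finset.mem_filter.1 hy).2
        refine ih _ (lt_of_le_of_ne (Subgroup.card_le_of_le hle) fun hc => hxy ?_) y rfl
        exact Subgroup.eq_of_le_of_card_ge hle hc.ge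
    rw [Finset.sum_congr rfl h2, ← Finset.sum_filter, Finset.sum_const, nsmul_eq_mul,
      mul_eq_zero] at h1
    refine h1.resolve_left (Nat.cast_ne_zero.2 (Finset.card_ne_zero.2 ⟨x, ?_⟩))
    simp

theorem exists_character_ker_eq (H : Subgroup G) [IsCyclic (G ⧸ H)] :
    ∃ χ : G →* ℂˣ, χ.ker = H := by
  have hne : NeZero (Nat.card (G ⧸ H)) := ⟨Nat.card_pos.ne'⟩
  have hcard : Nat.card (G ⧸ H) = Nat.card (rootsOfUnity (Nat.card (G ⧸ H)) ℂ) := by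
    rw [Complex.card_rootsOfUnity]
  let ε := mulEquivOfCyclicCardEq hcard
  refine ⟨((Subgroup.subtype _).comp ε.toMonoidHom).comp (QuotientGroup.mk' H), ?_⟩
  ext g
  rw [MonoidHom.mem_ker]
  change ((ε (g : G ⧸ H) : rootsOfUnity (Nat.card (G ⧸ H)) ℂ) : ℂˣ) = 1 ↔ _
  rw [OneMemClass.coe_eq_one, EmbeddingLike.map_eq_one_iff, QuotientGroup.eq_one_iff]

theorem sum_character_subgroup [Fintype G] (χ : G →* ℂˣ) (D : Subgroup G)
    [DecidablePred (· ∈ D)] [Decidable (D ≤ χ.ker)] :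
    ∑ x with x ∈ D, (χ x : ℂ) = if D ≤ χ.ker then (Nat.card D : ℂ) else 0 := by
  classical
  let := Fintype.ofFinite D
  have h1 := sum_hom_units ((Units.coeHom ℂ).comp (χ.comp D.subtype))
  have h2 : ∑ x with x ∈ D, (χ x : ℂ) = ∑ x : D, (χ (x : G) : ℂ) :=
    Finset.sum_subtype _ (fun x => by simp) _
  rw [h2]
  refine h1.trans ?_
  have h3 : (Units.coeHom ℂ).comp (χ.comp D.subtype) = 1 ↔ D ≤ χ.ker := by
    constructor
    · intro h x hx
      exact Units.ext (DFunLike.congr_fun h (⟨x, hx⟩ : D))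
    · intro h
      ext x
      exact congrArg Units.val (h x.2)
  simp only [h3]
  split_ifs
  · rw [Nat.card_eq_fintype_card]
  · simp

end Moebius

section Independence

variable {Γ : Type u} [CommGroup Γ]

theorem IsPrimaryProj.le_map_iff {p : ℕ} {e : Γ →* Γ} (he : IsPrimaryProj p e) {K I : Subgroup Γ} :
    K.map e ≤ I.map e ↔ K.map e ≤ I := by
  refine ⟨fun h => h.trans (he.map_le I), fun h => ?_⟩
  rintro _ ⟨x, hx, rfl⟩
  exact ⟨e x, h ⟨x, hx, rfl⟩, he.idem x⟩

theorem IsPrimaryProj.mem_iff {p : ℕ} {e : Γ →* Γ} (he : IsPrimaryProj p e) {D : Subgroup Γ}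
    {x : Γ} : x ∈ D ↔ e x ∈ D.map e ∧ x * (e x)⁻¹ ∈ D := by
  constructor
  · intro hx
    have h1 : e x ∈ D.map e := ⟨x, hx, rfl⟩
    exact ⟨h1, D.mul_mem hx (D.inv_mem (he.map_le D h1))⟩
  · rintro ⟨h1, h2⟩
    have h3 := D.mul_mem h2 (he.map_le D h1)
    rwa [inv_mul_cancel_right] at h3

theorem IsPrimaryProj.isPGroup_map {p : ℕ} {e : Γ →* Γ} (he : IsPrimaryProj p e)
    (K : Subgroup Γ) : IsPGroup p (K.map e) := by
  obtain ⟨k, hk⟩ := he.exists_pow_eq_one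
  rintro ⟨_, ⟨x, hx, rfl⟩⟩
  exact ⟨k, Subtype.ext (hk x)⟩

theorem card_eq_card_inf_ker_mul (e : Γ →* Γ) (D : Subgroup Γ) :
    Nat.card D = Nat.card (D ⊓ e.ker : Subgroup Γ) * Nat.card (D.map e) := by
  have h1 := Subgroup.card_mul_index (e.subgroupMap D).ker
  rw [Subgroup.index_ker, MonoidHom.range_eq_top.2 (e.subgroupMap_surjective D),
    Subgroup.card_top] at h1
  rw [← h1]
  congr 1
  refine Nat.card_congr ⟨fun x => ⟨x.1, x.1.2, congrArg Subtype.val x.2⟩,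
    fun x => ⟨⟨x.1, x.2.1⟩, Subtype.ext x.2.2⟩, fun _ => rfl, fun _ => rfl⟩

variable [Finite Γ]

instance : Finite (SetS Γ) := by
  refine Finite.of_injective (fun s : SetS Γ => (s.I, s.D)) ?_
  rintro ⟨I, D, _, _, _, _⟩ ⟨I', D', _, _, _, _⟩ h
  obtain ⟨rfl, rfl⟩ := Prod.mk.inj h
  rfl

open scoped Classical in
theorem beta_apply [Fintype (SetS Γ)] (c : SetS Γ →₀ ℕ) (t : SetT Γ) :
    beta Γ c t = ∑ s with s.D ≤ t.H ∧ pPart t.p s.I = t.I ∧ pPart t.p s.D = t.D, c s := by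
  let := Fintype.ofFinite (SetT Γ)
  induction c using Finsupp.induction_linear with
  | zero => simp
  | add f g hf hg =>
    rw [map_add, Finsupp.add_apply, hf, hg, ← Finset.sum_add_distrib]
    rfl
  | single s n =>
    rw [beta_single, Finsupp.smul_apply, Finsupp.finsetSum_apply, Finset.sum_filter,
      Finset.sum_filter, Finset.sum_eq_single t (fun t' _ ht' => by simp [ht']) (by simp),
      Finset.sum_eq_single s (fun s' _ hs' => by simp [hs'.symm]) (by simp)]
    split_ifs <;> simp

theorem apply_shiftHom [Fintype (SetS Γ)] (f : Classes (MonoidAlgebra ℤ Γ) →+ ℝ)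
    (c : SetS Γ →₀ ℕ) : f (shiftHom Γ c) = ∑ s, (c s : ℝ) * f s.shift := by
  induction c using Finsupp.induction_linear with
  | zero => simp
  | add c d hc hd =>
    rw [map_add, map_add, hc, hd, ← Finset.sum_add_distrib]
    exact Finset.sum_congr rfl fun s _ => by rw [Finsupp.add_apply, Nat.cast_add, add_mul]
  | single s n =>
    classical
    rw [shiftHom_single, map_nsmul, nsmul_eq_mul,
      Finset.sum_eq_single s (fun s' _ hs' => by simp [hs'.symm]) (by simp),
      Finsupp.single_eq_same]

open scoped Classical in
/-- The relations among the coefficients given by the invariants `tateLog`. -/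
theorem sum_index_eq_zero [Fintype (SetS Γ)] {c d : SetS Γ →₀ ℕ} (h : shiftHom Γ c = shiftHom Γ d)
    {p n : ℕ} (hp : p.Prime) (hn : n ≠ 0) {K : Subgroup Γ} (hK : Nat.card K = p ^ n)
    (L : Subgroup Γ) :
    ∑ s : SetS Γ with K ≤ s.I, ((c s : ℂ) - d s) * (s.D ⊔ L).index = 0 := by
  let f : Classes (MonoidAlgebra ℤ Γ) →+ ℝ :=
    tateLog K (fixScalars (p ^ n) L) - tateLog K (fixScalars (p ^ (n - 1)) L)
  have hf : ∀ s : SetS Γ, f s.shift =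
      (if K ≤ s.I then ((s.D ⊔ L).index : ℝ) else 0) * Real.log p := fun s =>
    tateLog_sub_shift hp hn hK L s
  have h1 := congrArg f h
  rw [apply_shiftHom, apply_shiftHom, ← sub_eq_zero, ← Finset.sum_sub_distrib] at h1
  simp_rw [hf, ← sub_mul, ← mul_assoc] at h1
  rw [← Finset.sum_mul] at h1
  have h2 := (mul_eq_zero.1 h1).resolve_right
    (Real.log_pos (Nat.one_lt_cast.2 hp.one_lt)).ne'
  simp_rw [mul_ite, mul_zero] at h2
  rw [← Finset.sum_filter] at h2
  exact_mod_cast congrArg (fun x : ℝ => (x : ℂ)) h2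

variable {a : SetS Γ → ℂ} {p : ℕ} {e : Γ →* Γ}

open scoped Classical in
/-- As `[Γ : D L] = #Γ #(D ∩ L) / (#D #L)`, the hypothesis says that the function
`∑ a_s / #D_s · 1_{D_s}` has sum zero over every subgroup `L`. -/
theorem sum_indicator_eq_zero {F : Finset (SetS Γ)}
    (hF : ∀ L : Subgroup Γ, ∑ s ∈ F, a s * (s.D ⊔ L).index = 0) (x : Γ) :
    ∑ s ∈ F with x ∈ s.D, a s / Nat.card s.D = 0 := by
  let := Fintype.ofFinite Γ
  let ψ : Γ → ℂ := fun x => ∑ s ∈ F with x ∈ s.D, a s / Nat.card s.D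
  refine eq_zero_of_sum_subgroup ψ ?_ ?_ x
  · intro x y hxy
    refine Finset.sum_congr (Finset.filter_congr fun s _ => ?_) fun _ _ => rfl
    rw [← Subgroup.zpowers_le, hxy, Subgroup.zpowers_le]
  · intro L _
    have hG : (Nat.card Γ : ℂ) ≠ 0 := Nat.cast_ne_zero.2 Nat.card_pos.ne'
    have hL : (Nat.card L : ℂ) ≠ 0 := Nat.cast_ne_zero.2 Nat.card_pos.ne'
    have h1 : ∀ s : SetS Γ, a s / Nat.card s.D * Nat.card (s.D ⊓ L : Subgroup Γ) =
        (Nat.card L / Nat.card Γ) * (a s * (s.D ⊔ L).index) := by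
      intro s
      have hD : (Nat.card s.D : ℂ) ≠ 0 := Nat.cast_ne_zero.2 Nat.card_pos.ne'
      have h2 : ((s.D ⊔ L).index : ℂ) * (Nat.card s.D * Nat.card L) =
          Nat.card Γ * Nat.card (s.D ⊓ L : Subgroup Γ) := by
        exact_mod_cast index_sup_mul_card s.D L
      field_simp
      linear_combination (-a s) * h2
    calc ∑ x with x ∈ L, ψ x
        = ∑ s ∈ F, a s / Nat.card s.D * Nat.card (s.D ⊓ L : Subgroup Γ) := by
          simp_rw [ψ, Finset.sum_filter (s := F)]
          rw [Finset.sum_comm]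
          refine Finset.sum_congr rfl fun s _ => ?_
          rw [← Finset.sum_filter, Finset.filter_filter, Finset.sum_const, nsmul_eq_mul, mul_comm]
          congr 2
          rw [Nat.card_eq_fintype_card, Fintype.card_subtype]
          congr 1
          ext x
          simp [and_comm]
      _ = 0 := by
          simp_rw [h1]
          rw [← Finset.mul_sum, hF, mul_zero]

open scoped Classical in
/-- Pairing with a character with kernel `H` on the prime-to-`p` part of `Γ` extracts the
coefficients with `D ⊆ H`. -/
theorem sum_coefficient_eq_zero (he : IsPrimaryProj p e) {F : Finset (SetS Γ)} {E : Subgroup Γ}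
    (hFE : ∀ s ∈ F, s.D.map e = E)
    (hF : ∀ x ∈ e.ker, ∑ s ∈ F with x ∈ s.D, a s / Nat.card s.D = 0)
    {H : Subgroup Γ} [IsCyclic (Γ ⧸ H)] (hH : (Nat.card (Γ ⧸ H)).Coprime p) :
    ∑ s ∈ F with s.D ≤ H, a s = 0 := by
  let := Fintype.ofFinite Γ
  obtain ⟨χ, rfl⟩ := exists_character_ker_eq H
  have hE : (Nat.card E : ℂ) ≠ 0 := Nat.cast_ne_zero.2 Nat.card_pos.ne'
  -- `χ` is trivial on the `p`-part of `Γ`.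
  have hχe : ∀ x, e x ∈ χ.ker := by
    intro x
    obtain ⟨k, hk⟩ := he.exists_pow_eq_one
    rw [← QuotientGroup.eq_one_iff, ← orderOf_eq_one_iff]
    refine Nat.eq_one_of_dvd_coprimes (hH.pow_right k) (orderOf_dvd_natCard _)
      (orderOf_dvd_of_pow_eq_one ?_)
    rw [← QuotientGroup.mk_pow, hk, QuotientGroup.mk_one]
  have hle : ∀ s : SetS Γ, s.D ⊓ e.ker ≤ χ.ker ↔ s.D ≤ χ.ker := by
    intro s
    refine ⟨fun h x hx => ?_, fun h => inf_le_left.trans h⟩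
    have h1 := mul_mem (h ⟨(he.mem_iff.1 hx).2, he.mul_inv_mem_ker x⟩) (hχe x)
    rwa [inv_mul_cancel_right] at h1
  have hterm : ∀ s ∈ F, ∑ x with x ∈ s.D ⊓ e.ker, (χ x : ℂ) * (a s / Nat.card s.D) =
      (Nat.card E : ℂ)⁻¹ * if s.D ≤ χ.ker then a s else 0 := by
    intro s hs
    have hD : (Nat.card (s.D ⊓ e.ker : Subgroup Γ) : ℂ) ≠ 0 :=
      Nat.cast_ne_zero.2 Nat.card_pos.ne'
    rw [← Finset.sum_mul, sum_character_subgroup, card_eq_card_inf_ker_mul e s.D, hFE s hs]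
    simp only [hle]
    split_ifs
    · push_cast
      field_simp
    · simp
  have h1 : ∑ x with x ∈ e.ker, (χ x : ℂ) * ∑ s ∈ F with x ∈ s.D, a s / Nat.card s.D = 0 :=
    Finset.sum_eq_zero fun x hx => by rw [hF x (Finset.mem_filter.1 hx).2, mul_zero]
  have h2 : ∑ x with x ∈ e.ker, (χ x : ℂ) * ∑ s ∈ F with x ∈ s.D, a s / Nat.card s.D =
      ∑ s ∈ F, ∑ x with x ∈ s.D ⊓ e.ker, (χ x : ℂ) * (a s / Nat.card s.D) := by
    simp_rw [Finset.mul_sum, Finset.sum_filter (s := F)]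
    rw [Finset.sum_comm]
    refine Finset.sum_congr rfl fun s _ => ?_
    rw [← Finset.sum_filter, Finset.filter_filter]
    refine Finset.sum_congr (Finset.filter_congr fun x _ => ?_) fun _ _ => rfl
    rw [Subgroup.mem_inf, and_comm]
  rw [h2, Finset.sum_congr rfl hterm, ← Finset.mul_sum, ← Finset.sum_filter] at h1
  exact (mul_eq_zero.1 h1).resolve_left (inv_ne_zero hE)

section Fiber

variable [Fintype (SetS Γ)]

open scoped Classical in
/-- Möbius inversion over `K` isolates the pairs with a given `p`-part of `I`. -/
theorem sum_index_fiber_eq_zero (he : IsPrimaryProj p e)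
    (ha : ∀ (n : ℕ) (K : Subgroup Γ), n ≠ 0 → Nat.card K = p ^ n → ∀ L : Subgroup Γ,
      ∑ s : SetS Γ with K ≤ s.I, a s * (s.D ⊔ L).index = 0)
    {Q : Subgroup Γ} (hQ : Q ≠ ⊥) (L : Subgroup Γ) :
    ∑ s : SetS Γ with s.I.map e = Q, a s * (s.D ⊔ L).index = 0 := by
  have := Fact.mk he.prime
  let w : SetS Γ → ℂ := fun s => if s.I.map e = ⊥ then 0 else a s * (s.D ⊔ L).index
  have hw : ∀ s, s.I.map e ≠ ⊥ → w s = a s * (s.D ⊔ L).index := fun s hs => if_neg hs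
  have h1 := sum_fiber_eq_zero (fun s : SetS Γ => s.I.map e) w ?_ Q
  · rw [← h1]
    refine Finset.sum_congr rfl fun s hs => (hw s ?_).symm
    rw [(Finset.mem_filter.1 hs).2]
    exact hQ
  · intro s₀ hs₀
    have hne : s₀.I.map e ≠ ⊥ := fun h => hs₀ (if_pos h)
    obtain ⟨n, hn⟩ := IsPGroup.iff_card.1 (he.isPGroup_map s₀.I)
    have hn0 : n ≠ 0 := by
      rintro rfl
      rw [pow_zero] at hn
      exact hne (Subgroup.card_eq_one.1 hn)
    rw [← ha n _ hn0 hn L]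
    refine Finset.sum_congr (Finset.filter_congr fun s _ => he.le_map_iff) fun s hs => hw s ?_
    intro hbot
    have h2 := he.le_map_iff.2 (Finset.mem_filter.1 hs).2
    rw [hbot] at h2
    exact hne (le_bot_iff.1 h2)

open scoped Classical in
/-- Möbius inversion over the `p`-part of `D`. For `I` with `p`-part `Q`, the `p`-part of `D`
contains that of `D₀` if and only if it contains the `p`-part of a generator of `D₀ / I₀`. -/
theorem sum_indicator_fiber_eq_zero (he : IsPrimaryProj p e) {Q : Subgroup Γ}
    (hQ : ∀ x, ∑ s : SetS Γ with s.I.map e = Q ∧ x ∈ s.D, a s / Nat.card s.D = 0)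
    (E : Subgroup Γ) {x : Γ} (hx : x ∈ e.ker) :
    ∑ s : SetS Γ with (s.I.map e = Q ∧ s.D.map e = E) ∧ x ∈ s.D, a s / Nat.card s.D = 0 := by
  let w : SetS Γ → ℂ := fun s => if s.I.map e = Q ∧ x ∈ s.D then a s / Nat.card s.D else 0
  have h1 := sum_fiber_eq_zero (fun s : SetS Γ => s.D.map e) w ?_ E
  · rw [← h1, ← Finset.sum_filter, Finset.filter_filter]
    refine Finset.sum_congr (Finset.filter_congr fun s _ => ?_) fun _ _ => rfl
    tauto
  · intro s₀ hs₀
    have hs₀' : s₀.I.map e = Q := by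
      by_contra hne
      exact hs₀ (if_neg fun h => hne h.1)
    rw [← hQ (e s₀.gen * x), ← Finset.sum_filter, Finset.filter_filter]
    refine Finset.sum_congr (Finset.filter_congr fun s _ => ?_) fun _ _ => rfl
    have hex : e (e s₀.gen * x) = e s₀.gen := by rw [map_mul, he.idem, hx, mul_one]
    rw [he.mem_iff (D := s.D) (x := e s₀.gen * x), hex, mul_comm (e s₀.gen) x,
      mul_inv_cancel_right, ← and_assoc, and_comm (a := s₀.D.map e ≤ s.D.map e),
      and_assoc, and_congr_right_iff]
    intro hs
    rw [s₀.D_eq, Subgroup.map_sup, MonoidHom.map_zpowers, sup_le_iff,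
      Subgroup.zpowers_le, hs₀', ← hs]
    exact and_congr_left fun _ => and_iff_right (Subgroup.map_mono s.le)

end Fiber

theorem beta_eq_of_shiftHom_eq {c d : SetS Γ →₀ ℕ} (h : shiftHom Γ c = shiftHom Γ d) :
    beta Γ c = beta Γ d := by
  classical
  let := Fintype.ofFinite (SetS Γ)
  ext t
  obtain ⟨e, he⟩ := exists_isPrimaryProj (G := Γ) t.prime
  have := t.cyclic_quotient
  suffices hsum : ∑ s with s.D ≤ t.H ∧ pPart t.p s.I = t.I ∧ pPart t.p s.D = t.D,
      ((c s : ℂ) - d s) = 0 by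
    rw [Finset.sum_sub_distrib, sub_eq_zero] at hsum
    rw [beta_apply, beta_apply]
    exact_mod_cast hsum
  by_cases hex : ∃ s₀ : SetS Γ, pPart t.p s₀.I = t.I ∧ pPart t.p s₀.D = t.D
  · obtain ⟨s₀, hI, hD⟩ := hex
    have hQ : s₀.I.map e ≠ ⊥ := fun hbot => t.ne_bot (hI ▸ he.pPart_eq_bot_iff.2 hbot)
    have h1 := sum_index_fiber_eq_zero (a := fun s => (c s : ℂ) - d s) he
      (fun n K hn hK L => sum_index_eq_zero h t.prime hn hK L) hQ
    have h2 := fun x => sum_indicator_eq_zero h1 x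
    simp_rw [Finset.filter_filter] at h2
    have h3 := fun x hx => sum_indicator_fiber_eq_zero he h2 (s₀.D.map e) (x := x) hx
    have h4 := sum_coefficient_eq_zero he
      (F := {s : SetS Γ | s.I.map e = s₀.I.map e ∧ s.D.map e = s₀.D.map e})
      (fun s hs => (Finset.mem_filter.1 hs).2.2)
      (fun x hx => by rw [Finset.filter_filter]; exact h3 x hx) t.coprime
    rw [← h4, Finset.filter_filter]
    refine Finset.sum_congr (Finset.filter_congr fun s _ => ?_) fun _ _ => rfl
    rw [← hI, ← hD, he.pPart_eq_iff, he.pPart_eq_iff, and_comm]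
  · refine Finset.sum_eq_zero fun s hs => absurd ?_ hex
    exact ⟨s, (Finset.mem_filter.1 hs).2.2⟩

end Independence

/-! ### The structure of `𝒵^adm` -/

theorem nonempty_mrange_equiv {A B C : Type*} [AddCommMonoid A] [AddCommMonoid B] [AddCommMonoid C]
    (f : A →+ B) (g : A →+ C) (h : ∀ x y, f x = f y ↔ g x = g y) :
    Nonempty (AddMonoidHom.mrange f ≃+ AddMonoidHom.mrange g) := by
  have hk : AddCon.ker f = AddCon.ker g := by
    ext x y
    exact h x y
  exact ⟨(AddCon.quotientKerEquivRange f).symm.trans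
    ((AddCon.congr (AddEquiv.refl A) (by rw [hk]; rfl)).trans (AddCon.quotientKerEquivRange g))⟩

variable {Γ : Type u} [CommGroup Γ]

theorem IsPGroup.isElementary {p : ℕ} (hp : p.Prime) {G : Type u} [Group G] (h : IsPGroup p G) :
    IsElementary G := by
  refine ⟨p, hp, ⊤, ⊥, h.to_subgroup ⊤, inferInstance, ⟨?_⟩⟩
  exact Subgroup.topEquiv.symm.trans MulEquiv.prodUnique.symm

theorem pKernel_eq_bot {p : ℕ} (h : IsPGroup p Γ) : pKernel Γ p = ⊥ :=
  le_bot_iff.1 (sInf_le (h.to_quotient ⊥))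

theorem pPart_injective {p : ℕ} (h : IsPGroup p Γ) :
    Function.Injective (pPart (Γ := Γ) p) :=
  Subgroup.map_injective ((MonoidHom.ker_eq_bot_iff _).1
    ((QuotientGroup.ker_mk' _).trans (pKernel_eq_bot h)))

theorem pPart_surjective (p : ℕ) : Function.Surjective (pPart (Γ := Γ) p) := fun K =>
  ⟨_, Subgroup.map_comap_eq_self_of_surjective (QuotientGroup.mk'_surjective _) K⟩

variable [Finite Γ]

theorem SetT.p_eq {p : ℕ} (hp : p.Prime) (h : IsPGroup p Γ) (t : SetT Γ) : t.p = p := by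
  have := Fact.mk hp
  obtain ⟨k, hk⟩ := IsPGroup.iff_card.1 h
  exact (Nat.prime_dvd_prime_iff_eq t.prime hp).1 (t.prime.dvd_of_dvd_pow (hk ▸ t.dvd_card))

theorem SetT.H_eq_top {p : ℕ} (hp : p.Prime) (h : IsPGroup p Γ) (t : SetT Γ) : t.H = ⊤ := by
  have := Fact.mk hp
  obtain ⟨k, hk⟩ := IsPGroup.iff_card.1 h
  have h1 : Nat.card (Γ ⧸ t.H) ∣ p ^ k := hk ▸ t.H.card_quotient_dvd_card
  have h2 := t.coprime
  rw [t.p_eq hp h] at h2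
  exact Subgroup.index_eq_one.1 (Nat.Coprime.eq_one_of_dvd (h2.pow_right k) h1)

/-- For a `p`-group, the tuples in `𝒯` are the pairs in `𝒮`. -/
def SetS.toT {p : ℕ} (hp : p.Prime) (h : IsPGroup p Γ) (s : SetS Γ) : SetT Γ where
  p := p
  prime := hp
  H := ⊤
  cyclic_quotient := by
    have := QuotientGroup.subsingleton_quotient_top (G := Γ)
    exact isCyclic_of_subsingleton
  coprime := by
    have h1 : Nat.card (Γ ⧸ (⊤ : Subgroup Γ)) = 1 := Subgroup.index_top
    rw [h1]
    exact Nat.coprime_one_left p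
  I := pPart p s.I
  D := pPart p s.D
  le := Subgroup.map_mono s.le
  ne_bot := fun hbot => s.ne_bot (pPart_injective h (hbot.trans (Subgroup.map_bot _).symm))
  cyclic := isCyclic_pPart s p

theorem SetS.toT_eq_iff {p : ℕ} (hp : p.Prime) (h : IsPGroup p Γ) (s : SetS Γ) (t : SetT Γ) :
    s.toT hp h = t ↔ s.D ≤ t.H ∧ pPart t.p s.I = t.I ∧ pPart t.p s.D = t.D := by
  constructor
  · rintro rfl
    exact ⟨le_top, rfl, rfl⟩
  · rintro ⟨-, hI, hD⟩
    exact SetT.ext_of_pPart (I := s.I) (D := s.D) (t.p_eq hp h).symm (t.H_eq_top hp h).symm rfl hI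
      rfl hD

theorem SetS.toT_bijective {p : ℕ} (hp : p.Prime) (h : IsPGroup p Γ) :
    Function.Bijective (SetS.toT hp h) := by
  constructor
  · intro s s' hs
    obtain ⟨-, hI, hD⟩ := (s.toT_eq_iff hp h _).1 hs
    have hI' := pPart_injective h hI
    have hD' := pPart_injective h hD
    obtain ⟨I, D, _, _, _, _⟩ := s
    obtain ⟨I', D', _, _, _, _⟩ := s'
    obtain rfl : I = I' := hI'
    obtain rfl : D = D' := hD'
    rfl
  · intro t
    have htp := t.p_eq hp h
    obtain ⟨I, hI⟩ := pPart_surjective t.p t.I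
    obtain ⟨D, hD⟩ := pPart_surjective t.p t.D
    have hinj : Function.Injective (pPart (Γ := Γ) t.p) := htp ▸ pPart_injective h
    have hle : I ≤ D := by
      have h1 : pPart t.p (I ⊔ D) = pPart t.p D := by
        rw [pPart, Subgroup.map_sup]
        exact sup_eq_right.2 (hI ▸ hD ▸ t.le : pPart t.p I ≤ pPart t.p D)
      exact sup_eq_right.1 (hinj h1)
    obtain ⟨φ, hφ⟩ := (isCyclic_quotient_iff t.le).1 t.cyclic
    obtain ⟨g, rfl⟩ := QuotientGroup.mk'_surjective _ φ
    have hg : D = I ⊔ Subgroup.zpowers g := by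
      apply hinj
      rw [hD, hφ, ← hI, pPart, pPart, Subgroup.map_sup, MonoidHom.map_zpowers]
    refine ⟨⟨I, D, hle, ?_, IsPGroup.isElementary hp (h.to_subgroup I),
      (isCyclic_quotient_iff hle).2 ⟨g, hg⟩⟩, ?_⟩
    · rintro rfl
      exact t.ne_bot (hI ▸ Subgroup.map_bot _)
    · exact (SetS.toT_eq_iff hp h _ t).2 ⟨t.H_eq_top hp h ▸ le_top, hI, hD⟩

theorem beta_injective_of_isPGroup {p : ℕ} (hp : p.Prime) (h : IsPGroup p Γ) :
    Function.Injective (beta Γ) := by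
  classical
  let := Fintype.ofFinite (SetS Γ)
  have key : ∀ c s, beta Γ c (SetS.toT hp h s) = c s := by
    intro c s
    rw [beta_apply, Finset.sum_filter, Finset.sum_eq_single s]
    · rw [if_pos ((s.toT_eq_iff hp h _).1 rfl)]
    · intro s' _ hs'
      exact if_neg fun h1 => hs' ((SetS.toT_bijective hp h).1 ((s'.toT_eq_iff hp h _).2 h1))
    · exact fun h1 => absurd (Finset.mem_univ s) h1
  intro c d hcd
  ext s
  rw [← key, hcd, key]

theorem nonempty_Zadm_equiv_mrange_beta (Γ : Type u) [CommGroup Γ] [Finite Γ] :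
    Nonempty (Zadm Γ ≃+ AddMonoidHom.mrange (beta Γ)) := by
  rw [← mrange_shiftHom]
  exact nonempty_mrange_equiv _ _ fun _ _ => ⟨beta_eq_of_shiftHom_eq, shiftHom_eq_of_beta_eq⟩

end GroupRingClasses

end

theorem theorem5p2 (Γ : Type u) [CommGroup Γ] [Finite Γ] :
    Nonempty (GroupRingClasses.Zadm Γ ≃+ AddMonoidHom.mrange (GroupRingClasses.beta Γ)) ∧
    (∀ p : ℕ, p.Prime → IsPGroup p Γ →
      Nonempty (GroupRingClasses.Zadm Γ ≃+ (Fin (Nat.card (GroupRingClasses.SetS Γ)) →₀ ℕ)) ∧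
      Nat.card (GroupRingClasses.SetS Γ) = Nat.card (GroupRingClasses.SetT Γ)) := by
  refine ⟨GroupRingClasses.nonempty_Zadm_equiv_mrange_beta Γ, fun p hp h => ⟨?_, ?_⟩⟩
  · obtain ⟨E⟩ := GroupRingClasses.nonempty_Zadm_equiv_mrange_beta Γ
    have hinj := GroupRingClasses.beta_injective_of_isPGroup hp h
    let E' : (GroupRingClasses.SetS Γ →₀ ℕ) ≃+ AddMonoidHom.mrange (GroupRingClasses.beta Γ) :=
      AddEquiv.ofBijective (GroupRingClasses.beta Γ).mrangeRestrict
        ⟨fun x y hxy => hinj (congrArg Subtype.val hxy),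
          (GroupRingClasses.beta Γ).mrangeRestrict_surjective⟩
    exact ⟨E.trans (E'.symm.trans
      (Finsupp.domCongr (Finite.equivFin (GroupRingClasses.SetS Γ))))⟩
  · exact Nat.card_congr (Equiv.ofBijective _ (GroupRingClasses.SetS.toT_bijective hp h))
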